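/- Let $\mathbf{Sp}(3,\mathbb{R})$ be the group of real $6\times 6$ matrices preserving the standard symplectic form on $\mathbb{R}^6$, whose matrix has the $3\times3$ blocks $0,-I,I,0$, with Lie algebra $\mathfrak{sp}(3,\mathbb{R})$, and let $P\subset\mathbf{Sp}(3,\mathbb{R})$ be the subgroup preserving the flag $N_1=\mathrm{Span}(e_1,e_2)\subset N_2=\mathrm{Span}(e_1,e_2,e_3)\subset\mathbb{R}^6$. Grade $\mathfrak{sp}(3,\mathbb{R})=\mathfrak{g}_{-3}\oplus\dots\oplus\mathfrak{g}_{3}$ by the eigenvalues of $\mathrm{ad}\,\mathrm{diag}(\tfrac32,\tfrac32,\tfrac12,-\tfrac32,-\tfrac32,-\tfrac12)$, and let $\mathfrak{m}=\mathfrak{g}_{-3}\oplus\mathfrak{g}_{-2}\oplus\mathfrak{g}_{-1}$. Definitions. The symbol algebra of a distribution $\mathcal{D}$ on a manifold $M$ at $x\in M$ is $\bigoplus_{k\ge1}\mathcal{D}^k_x/\mathcal{D}^{k-1}_x$, where $\mathcal{D}^0=0$, $\mathcal{D}^1=\mathcal{D}$, $\mathcal{D}^{k+1}=\mathcal{D}^k+[\mathcal{D},\mathcal{D}^k]$,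 the $k$-th summand has degree $-k$, and the bracket is induced by the bracket of vector fields. The Tanaka prolongation of a negatively graded Lie algebra $\mathfrak{n}$ is the largest graded Lie algebra with negative part $\mathfrak{n}$ in which no nonzero element of nonnegative degree commutes with $\mathfrak{n}$. The distribution $\mathcal{D}$ is Monge if (i) it is bracket generating; (ii) its symbol algebra is, at all points, isomorphic to one graded Lie algebra $\mathfrak{n}=\mathfrak{n}_{-1}\oplus\dots\oplus\mathfrak{n}_{-p}$, $p\ge2$, with $\dim\mathfrak{n}=\dim M$; (iii) $\mathfrak{n}_{-1}$ contains an abelian subalgebra $\mathfrak{h}$ of codimension one in $\mathfrak{n}_{-1}$ with $[\mathfrak{n}_{-1},\mathfrak{h}]=\mathfrak{n}_{-2}$; (iv) the Tanaka prolongation of $\mathfrak{n}$ is a simple real Lie algebra. Proposition. (a) $P$ is a parabolic subgroup, i.e. the normalizer of a parabolic subalgebra of $\mathfrak{sp}(3,\mathbb{R})$ (the nonnegative part of a $\mathbb{Z}$-grading). With $\mathbf{Sp}(3,\mathbb{R})$ a 21-dimensional submanifold of the space of matrices and $P$ a 13-dimensional Lie subgroup, the quotient $M=\mathbf{Sp}(3,\mathbb{R})/P$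 is an 8-dimensional smooth manifold with a smooth $\mathbf{Sp}(3,\mathbb{R})$-action, and $P\to\mathbf{Sp}(3,\mathbb{R})\to M$ is a smooth principal bundle. (b) The images under the projection of the left translates of $\mathfrak{g}_{-1}$ form a well-defined smooth $\mathbf{Sp}(3,\mathbb{R})$-invariant distribution $\mathcal{D}$ of rank 3 on $M$. It is a Monge distribution, its symbol algebra at every point is isomorphic to $\mathfrak{m}$, and the Tanaka prolongation of $\mathfrak{m}$ is $\mathfrak{sp}(3,\mathbb{R})$ with the above grading. (c) This is the flat $\mathbf{Sp}(3,\mathbb{R})$ Monge geometry: around every point of $M$ there are smooth coordinates $(t,x_1,x_2,y_1,y_2,z_{11},z_{12},z_{22})$ in which $\mathcal{D}$ is spanned by $\partial_t+y_1\partial_{x_1}+y_2\partial_{x_2}+y_1^2\partial_{z_{11}}+y_1y_2\partial_{z_{12}}+y_2^2\partial_{z_{22}}$, $\partial_{y_1}$ and $\partial_{y_2}$, the distribution of the system $\dot z_{11}=\dot x_1^2$, $\dot z_{12}=\dot x_1\dot x_2$, $\dot z_{22}=\dot x_2^2$. -/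

import Mathlib

open Set Function Bundle
open scoped Manifold ContDiff Matrix

universe u

/-! ### Distributions on manifolds -/

section Distributions

variable {E : Type*} [NormedAddCommGroup E] [NormedSpace ℝ E]
  {H : Type*} [TopologicalSpace H] (I : ModelWithCorners ℝ E H)
  (M : Type*) [TopologicalSpace M] [ChartedSpace H M]

/-- A field of linear subspaces of the tangent spaces of `M`. -/
abbrev TangentDistribution : Type _ := ∀ x : M, Submodule ℝ (TangentSpace I x)

end Distributions

namespace TangentDistribution

variable {E : Type*} [NormedAddCommGroup E] [NormedSpace ℝ E]
  {H : Type*} [TopologicalSpace H] {I : ModelWithCorners ℝ E H}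
  {M : Type*} [TopologicalSpace M] [ChartedSpace H M] [IsManifold I ∞ M]

/-- `V` is, on the set `U`, a smooth vector field with values in `D`. -/
def IsSectionOn (D : TangentDistribution I M) (U : Set M) (V : ∀ x : M, TangentSpace I x) : Prop :=
  ContMDiffOn I I.tangent ∞ (fun x => (⟨x, V x⟩ : TangentBundle I M)) U ∧ ∀ x ∈ U, V x ∈ D x

/-- `V` is a smooth section of `D` on some open neighbourhood of `x`. -/
def IsLocalSection (D : TangentDistribution I M) (x : M) (V : ∀ x : M, TangentSpace I x) : Prop :=
  ∃ U : Set M, IsOpen U ∧ x ∈ U ∧ D.IsSectionOn U V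

theorem IsLocalSection.mem {D : TangentDistribution I M} {x : M} {V : ∀ x : M, TangentSpace I x}
    (h : D.IsLocalSection x V) : V x ∈ D x := by
  obtain ⟨U, -, hx, hV⟩ := h
  exact hV.2 x hx

/-- `D` is a smooth distribution of rank `r`: around every point it is spanned by `r` smooth
pointwise linearly independent vector fields. -/
def IsSmoothOfRank (D : TangentDistribution I M) (r : ℕ) : Prop :=
  ∀ x : M, ∃ U : Set M, IsOpen U ∧ x ∈ U ∧ ∃ V : Fin r → ∀ x : M, TangentSpace I x,
    (∀ i, D.IsSectionOn U (V i)) ∧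
    ∀ y ∈ U, LinearIndependent ℝ (fun i => V i y) ∧
      Submodule.span ℝ (Set.range fun i => V i y) = D y

/-- The weak derived flag, with sections understood as local smooth vector fields:
`D⁰ = 0`, `D¹ = D`, `Dᵏ⁺¹ = Dᵏ + [D, Dᵏ]`. -/
noncomputable def derived (D : TangentDistribution I M) : ℕ → TangentDistribution I M
  | 0 => fun _ => ⊥
  | 1 => D
  | (k + 2) => fun x => derived D (k + 1) x ⊔
      Submodule.span ℝ {v | ∃ X Y : ∀ x : M, TangentSpace I x,
        IsLocalSection D x X ∧ IsLocalSection (derived D (k + 1)) x Y ∧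
        v = VectorField.mlieBracket I X Y x}

/-- `D + [D, D] + [D, [D, D]] + ... = TM`, a finite sum. -/
def IsBracketGenerating (D : TangentDistribution I M) : Prop :=
  ∃ k : ℕ, ∀ x : M, D.derived k x = ⊤

/-- The symbol algebra of `D` at `x`, that is the space `⨁_{k ≥ 1} Dᵏ(x) / Dᵏ⁻¹(x)`, where the
`k`-th summand has degree `-k`, with the bracket induced by the Lie bracket of local sections, is
isomorphic to the Lie algebra `L` with grading `𝒢`. The isomorphism is given by linear maps
`σ k : Dᵏ(x) → L` with image `𝒢 (-k)` and kernel `Dᵏ⁻¹(x)`. -/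
def HasSymbolAt (D : TangentDistribution I M) (x : M) {L : Type*} [LieRing L] [LieAlgebra ℝ L]
    (𝒢 : ℤ → Submodule ℝ L) : Prop :=
  ∃ σ : ∀ k : ℕ, D.derived k x →ₗ[ℝ] L,
    (∀ k : ℕ, 1 ≤ k → LinearMap.range (σ k) = 𝒢 (-(k : ℤ))) ∧
    (∀ (k : ℕ) (v : D.derived (k + 1) x),
      σ (k + 1) v = 0 ↔ (v : TangentSpace I x) ∈ D.derived k x) ∧
    ∀ i j : ℕ, 1 ≤ i → 1 ≤ j → ∀ X Y : ∀ x : M, TangentSpace I x,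
      ∀ (hX : IsLocalSection (D.derived i) x X) (hY : IsLocalSection (D.derived j) x Y),
        ∃ h : VectorField.mlieBracket I X Y x ∈ D.derived (i + j) x,
          σ (i + j) ⟨_, h⟩ = ⁅σ i ⟨X x, hX.mem⟩, σ j ⟨Y x, hY.mem⟩⁆

end TangentDistribution

/-! ### Graded Lie algebras and the Tanaka prolongation -/

/-- `𝒢` is a grading of the real Lie algebra `L`: `L = ⨁ 𝒢 k` and `[𝒢 i, 𝒢 j] ⊆ 𝒢 (i + j)`. -/
structure IsLieGrading {L : Type*} [LieRing L] [LieAlgebra ℝ L] (𝒢 : ℤ → Submodule ℝ L) :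
    Prop where
  isInternal : DirectSum.IsInternal 𝒢
  lie_mem : ∀ i j : ℤ, ∀ x ∈ 𝒢 i, ∀ y ∈ 𝒢 j, ⁅x, y⁆ ∈ 𝒢 (i + j)

/-- The graded Lie algebra `(A, 𝒜)` has the negatively graded Lie algebra `(L, 𝒢)`, embedded by
`ι`, as its negative part, and no nonzero element of nonnegative degree of `A` commutes with
this negative part. -/
structure IsTransitiveExtension {L : Type*} [LieRing L] [LieAlgebra ℝ L]
    (𝒢 : ℤ → Submodule ℝ L) {A : Type*} [LieRing A] [LieAlgebra ℝ A]
    (𝒜 : ℤ → Submodule ℝ A) (ι : L →ₗ⁅ℝ⁆ A) : Prop where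
  grading : IsLieGrading 𝒜
  injective : Injective ι
  map_neg : ∀ k : ℤ, k < 0 → (𝒢 k).map (ι : L →ₗ[ℝ] A) = 𝒜 k
  transitive : ∀ k : ℤ, 0 ≤ k → ∀ a ∈ 𝒜 k, (∀ x : L, ⁅a, ι x⁆ = 0) → a = 0

/-- `(A, 𝒜)` is the Tanaka prolongation of the negatively graded Lie algebra `(L, 𝒢)`: the
largest graded Lie algebra with negative part `L` in which no nonzero element of nonnegative
degree commutes with the negative part. -/
structure IsTanakaProlongation {L : Type u} [LieRing L] [LieAlgebra ℝ L]
    (𝒢 : ℤ → Submodule ℝ L) {A : Type u} [LieRing A] [LieAlgebra ℝ A]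
    (𝒜 : ℤ → Submodule ℝ A) (ι : L →ₗ⁅ℝ⁆ A) : Prop
    extends IsTransitiveExtension 𝒢 𝒜 ι where
  maximal : ∀ (B : Type u) [LieRing B] [LieAlgebra ℝ B] (ℬ : ℤ → Submodule ℝ B)
    (κ : L →ₗ⁅ℝ⁆ B), IsTransitiveExtension 𝒢 ℬ κ →
    ∃ f : B →ₗ⁅ℝ⁆ A, Injective f ∧ (∀ k : ℤ, (ℬ k).map (f : B →ₗ[ℝ] A) ≤ 𝒜 k) ∧
      ∀ x : L, f (κ x) = ι x

/-- Monge distributions: `D` is bracket generating; it has constant symbol algebra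
`L = 𝒢 (-1) ⊕ ... ⊕ 𝒢 (-p)`, `p ≥ 2`, whose dimension is that of the manifold; there is an abelian
`𝔥 ⊆ 𝒢 (-1)` of codimension one with `[𝒢 (-1), 𝔥] = 𝒢 (-2)`; and the Tanaka prolongation of `L` is
a simple Lie algebra. -/
def TangentDistribution.IsMonge {E : Type*} [NormedAddCommGroup E] [NormedSpace ℝ E]
    {H : Type*} [TopologicalSpace H] {I : ModelWithCorners ℝ E H}
    {M : Type*} [TopologicalSpace M] [ChartedSpace H M] [IsManifold I ∞ M] (D : TangentDistribution I M) : Prop :=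
  D.IsBracketGenerating ∧
  ∃ (L : Type) (_ : LieRing L) (_ : LieAlgebra ℝ L) (𝒢 : ℤ → Submodule ℝ L) (p : ℕ),
    IsLieGrading 𝒢 ∧ 2 ≤ p ∧ 𝒢 (-(p : ℤ)) ≠ ⊥ ∧
    (∀ k : ℤ, (k < -(p : ℤ) ∨ 0 ≤ k) → 𝒢 k = ⊥) ∧
    (∀ x : M, D.HasSymbolAt x 𝒢) ∧
    Module.Finite ℝ L ∧ Module.finrank ℝ L = Module.finrank ℝ E ∧
    (∃ 𝔥 : Submodule ℝ L, 𝔥 ≤ 𝒢 (-1) ∧ (∀ x ∈ 𝔥, ∀ y ∈ 𝔥, ⁅x, y⁆ = 0) ∧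
      Module.finrank ℝ 𝔥 + 1 = Module.finrank ℝ (𝒢 (-1)) ∧
      Submodule.span ℝ {z | ∃ x ∈ 𝒢 (-1), ∃ y ∈ 𝔥, z = ⁅x, y⁆} = 𝒢 (-2)) ∧
    ∃ (A : Type) (_ : LieRing A) (_ : LieAlgebra ℝ A) (𝒜 : ℤ → Submodule ℝ A)
      (ι : L →ₗ⁅ℝ⁆ A), IsTanakaProlongation 𝒢 𝒜 ι ∧ LieAlgebra.IsSimple ℝ A

/-! ### Homogeneous spaces -/

/-- For the given smooth structures, `G` is a Lie group, `P` is an embedded Lie subgroup, `G ⧸ P`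
is a Hausdorff smooth manifold on which `G` acts smoothly, and the projection `G → G ⧸ P` is a
smooth principal bundle with structure group `P`, acting by right multiplication. (The topologies
of `P` and of `G ⧸ P` are the subspace and the quotient topology.) -/
structure IsHomogeneousFibration {G : Type*} [Group G] [TopologicalSpace G] (P : Subgroup G)
    (EG : Type*) [NormedAddCommGroup EG] [NormedSpace ℝ EG] [ChartedSpace EG G]
    (EP : Type*) [NormedAddCommGroup EP] [NormedSpace ℝ EP] [ChartedSpace EP P]
    (EM : Type*) [NormedAddCommGroup EM] [NormedSpace ℝ EM] [ChartedSpace EM (G ⧸ P)]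
    [IsManifold 𝓘(ℝ, EM) ∞ (G ⧸ P)] : Prop where
  lieGroup_total : LieGroup 𝓘(ℝ, EG) ∞ G
  lieGroup_fibre : LieGroup 𝓘(ℝ, EP) ∞ P
  contMDiff_coe : ContMDiff 𝓘(ℝ, EP) 𝓘(ℝ, EG) ∞ (fun p : P => (p : G))
  injective_mfderiv_coe : ∀ p : P,
    Injective (mfderiv 𝓘(ℝ, EP) 𝓘(ℝ, EG) (fun p : P => (p : G)) p)
  t2Space_base : T2Space (G ⧸ P)
  contMDiff_smul : ContMDiff (𝓘(ℝ, EG).prod 𝓘(ℝ, EM)) 𝓘(ℝ, EM) ∞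
    (fun q : G × (G ⧸ P) => q.1 • q.2)
  contMDiff_mk : ContMDiff 𝓘(ℝ, EG) 𝓘(ℝ, EM) ∞ (QuotientGroup.mk : G → G ⧸ P)
  exists_trivialization : ∀ x : G ⧸ P,
    ∃ e : Bundle.Trivialization P (QuotientGroup.mk : G → G ⧸ P), x ∈ e.baseSet ∧
      ContMDiffOn 𝓘(ℝ, EG) (𝓘(ℝ, EM).prod 𝓘(ℝ, EP)) ∞ e e.source ∧
      ContMDiffOn (𝓘(ℝ, EM).prod 𝓘(ℝ, EP)) 𝓘(ℝ, EG) ∞ e.toOpenPartialHomeomorph.symm e.target ∧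
      ∀ g ∈ e.source, ∀ p : P, e (g * (p : G)) = ((e g).1, (e g).2 * p)

/-- A distribution on `G ⧸ P` invariant under all translations `x ↦ g • x`. -/
def TangentDistribution.IsInvariant {G : Type*} [Group G] [TopologicalSpace G] {P : Subgroup G}
    {E : Type*} [NormedAddCommGroup E] [NormedSpace ℝ E]
    {H : Type*} [TopologicalSpace H] {I : ModelWithCorners ℝ E H} [ChartedSpace H (G ⧸ P)]
    (D : TangentDistribution I (G ⧸ P)) : Prop :=
  ∀ (g : G) (x : G ⧸ P),
    (D x).map (mfderiv I I (fun y : G ⧸ P => g • y) x).toLinearMap = D (g • x)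

/-! ### The symplectic group in dimension six -/

/-- `Sp(3, ℝ)`, the real `6 × 6` matrices preserving the standard symplectic form, given by the
matrix with blocks `0, -1, 1, 0`. The six coordinates are ordered as
`inl 0, inl 1, inl 2, inr 0, inr 1, inr 2`. -/
abbrev Sp3 : Type := Matrix.symplecticGroup (Fin 3) ℝ

/-- The Lie algebra `𝔰𝔭(3, ℝ)`. -/
abbrev LieSp3 : Type := LieAlgebra.Symplectic.sp (Fin 3) ℝ

/-- The matrix entries of an element of `Sp(3, ℝ)`. -/
def Sp3.entries (g : Sp3) : Fin 3 ⊕ Fin 3 → Fin 3 ⊕ Fin 3 → ℝ :=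
  fun i j => (g : Matrix (Fin 3 ⊕ Fin 3) (Fin 3 ⊕ Fin 3) ℝ) i j

/-- The span of the first two standard basis vectors of `ℝ⁶`. -/
def flagN1 : Submodule ℝ (Fin 3 ⊕ Fin 3 → ℝ) :=
  Submodule.span ℝ {Pi.single (Sum.inl 0) 1, Pi.single (Sum.inl 1) 1}

/-- The span of the first three standard basis vectors of `ℝ⁶`. -/
def flagN2 : Submodule ℝ (Fin 3 ⊕ Fin 3 → ℝ) :=
  Submodule.span ℝ
    {Pi.single (Sum.inl 0) 1, Pi.single (Sum.inl 1) 1, Pi.single (Sum.inl 2) 1}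

/-- The subgroup of `Sp(3, ℝ)` preserving a linear subspace `N` of `ℝ⁶`. -/
def Sp3.stab (N : Submodule ℝ (Fin 3 ⊕ Fin 3 → ℝ)) : Subgroup Sp3 where
  carrier := {g | N.map (Matrix.toLin' (g : Matrix (Fin 3 ⊕ Fin 3) (Fin 3 ⊕ Fin 3) ℝ)) = N}
  mul_mem' := by
    intro a b ha hb
    simp only [mem_ofPred_eq] at ha hb ⊢
    rw [Submonoid.coe_mul, Matrix.toLin'_mul, Submodule.map_comp, hb, ha]
  one_mem' := by simp
  inv_mem' := by
    intro a ha
    simp only [mem_ofPred_eq] at ha ⊢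
    conv_lhs => rw [← ha]
    rw [← Submodule.map_comp, ← Matrix.toLin'_mul, ← Submonoid.coe_mul, inv_mul_cancel]
    simp

/-- The subgroup of `Sp(3, ℝ)` preserving the flag `N₁ ⊂ N₂ ⊂ ℝ⁶`. -/
def flagStabilizer : Subgroup Sp3 := Sp3.stab flagN1 ⊓ Sp3.stab flagN2

/-- `P` is a parabolic subgroup of `Sp(3, ℝ)`: the normalizer, in the adjoint action, of a
parabolic subalgebra of `𝔰𝔭(3, ℝ)`, that is of the sum of the components of nonnegative degree of a
`ℤ`-grading of `𝔰𝔭(3, ℝ)`. -/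
def IsParabolicSubgroup (P : Subgroup Sp3) : Prop :=
  ∃ 𝒢 : ℤ → Submodule ℝ LieSp3, IsLieGrading 𝒢 ∧
    ∀ g : Sp3, g ∈ P ↔ ∀ X : LieSp3, X ∈ (⨆ k : ℕ, 𝒢 k) ↔
      ∃ Y ∈ (⨆ k : ℕ, 𝒢 k), (Y : Matrix (Fin 3 ⊕ Fin 3) (Fin 3 ⊕ Fin 3) ℝ) =
        (g : Matrix (Fin 3 ⊕ Fin 3) (Fin 3 ⊕ Fin 3) ℝ) *
          (X : Matrix (Fin 3 ⊕ Fin 3) (Fin 3 ⊕ Fin 3) ℝ) *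
          ((g⁻¹ : Sp3) : Matrix (Fin 3 ⊕ Fin 3) (Fin 3 ⊕ Fin 3) ℝ)

/-- Twice the eigenvalues of the grading element `diag(3/2, 3/2, 1/2, -3/2, -3/2, -1/2)`. -/
def mongeWeight : Fin 3 ⊕ Fin 3 → ℤ := Sum.elim ![3, 3, 1] ![-3, -3, -1]

/-- The Monge gradation `𝔰𝔭(3, ℝ) = 𝔤₋₃ ⊕ ... ⊕ 𝔤₃`. In the block form of sizes `2, 1, 2, 1` the
matrix units `(i, j)` have the degrees
`0, 1, 3, 2 | -1, 0, 2, 1 | -3, -2, 0, -1 | -2, -1, 1, 0` (rows separated by bars). -/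
def mongeGrading (k : ℤ) : Submodule ℝ LieSp3 where
  carrier := {X | ∀ i j, mongeWeight i - mongeWeight j ≠ 2 * k →
    (X : Matrix (Fin 3 ⊕ Fin 3) (Fin 3 ⊕ Fin 3) ℝ) i j = 0}
  add_mem' := by
    intro X Y hX hY i j h
    simp [hX i j h, hY i j h]
  zero_mem' := by intro i j _; simp
  smul_mem' := by
    intro c X hX i j h
    simp [hX i j h]

/-- The nilpotent Lie algebra `𝔪 = 𝔤₋₃ ⊕ 𝔤₋₂ ⊕ 𝔤₋₁`, the negative part of the Monge gradation. -/
def mongeSymbol : LieSubalgebra ℝ LieSp3 where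
  carrier := {X | ∀ i j, mongeWeight j ≤ mongeWeight i →
    (X : Matrix (Fin 3 ⊕ Fin 3) (Fin 3 ⊕ Fin 3) ℝ) i j = 0}
  add_mem' := by
    intro X Y hX hY i j h
    simp [hX i j h, hY i j h]
  zero_mem' := by intro i j _; simp
  smul_mem' := by
    intro c X hX i j h
    simp [hX i j h]
  lie_mem' := by
    intro X Y hX hY i j h
    have key : ∀ A B : LieSp3,
        (∀ i j, mongeWeight j ≤ mongeWeight i →
          (A : Matrix (Fin 3 ⊕ Fin 3) (Fin 3 ⊕ Fin 3) ℝ) i j = 0) →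
        (∀ i j, mongeWeight j ≤ mongeWeight i →
          (B : Matrix (Fin 3 ⊕ Fin 3) (Fin 3 ⊕ Fin 3) ℝ) i j = 0) →
        ((A : Matrix (Fin 3 ⊕ Fin 3) (Fin 3 ⊕ Fin 3) ℝ) * B) i j = 0 := by
      intro A B hA hB
      rw [Matrix.mul_apply]
      refine Finset.sum_eq_zero fun l _ => ?_
      by_cases hl : mongeWeight l ≤ mongeWeight i
      · rw [hA i l hl, zero_mul]
      · rw [hB l j (by omega), mul_zero]
    change ((X.1 * Y.1 - Y.1 * X.1 : Matrix (Fin 3 ⊕ Fin 3) (Fin 3 ⊕ Fin 3) ℝ)) i j = 0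
    rw [Matrix.sub_apply, key X Y hX hY, key Y X hY hX, sub_zero]

/-- The grading of `𝔪`. -/
def mongeSymbolGrading (k : ℤ) : Submodule ℝ mongeSymbol :=
  if k < 0 then (mongeGrading k).comap (mongeSymbol.incl : mongeSymbol →ₗ[ℝ] LieSp3) else ⊥

/-- The distribution on `ℝ⁸`, with coordinates `(t, x₁, x₂, y₁, y₂, z₁₁, z₁₂, z₂₂)` where
`yᵢ = ẋᵢ`, of the system of ODEs `ż₁₁ = ẋ₁²`, `ż₁₂ = ẋ₁ẋ₂`, `ż₂₂ = ẋ₂²`: it is spanned by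
`∂_t + y₁ ∂_{x₁} + y₂ ∂_{x₂} + y₁² ∂_{z₁₁} + y₁y₂ ∂_{z₁₂} + y₂² ∂_{z₂₂}`, `∂_{y₁}`, `∂_{y₂}`. -/
noncomputable def flatMonge (a : EuclideanSpace ℝ (Fin 8)) :
    Submodule ℝ (EuclideanSpace ℝ (Fin 8)) :=
  Submodule.span ℝ {!₂[1, a 3, a 4, 0, 0, a 3 ^ 2, a 3 * a 4, a 4 ^ 2],
    EuclideanSpace.single 3 1, EuclideanSpace.single 4 1}

/-- Around every point there are smooth coordinates in which `D` is the distribution of the system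
`ż₁₁ = ẋ₁²`, `ż₁₂ = ẋ₁ẋ₂`, `ż₂₂ = ẋ₂²`. -/
def TangentDistribution.IsFlatMonge {M : Type*} [TopologicalSpace M]
    [ChartedSpace (EuclideanSpace ℝ (Fin 8)) M] (D : TangentDistribution (𝓡 8) M) : Prop :=
  ∀ x : M, ∃ φ ∈ IsManifold.maximalAtlas (𝓡 8) ∞ M, x ∈ φ.source ∧
    ∀ y ∈ φ.source, (D y).map (mfderiv (𝓡 8) (𝓡 8) φ y).toLinearMap = flatMonge (φ y)

/-! ### Gradings of Lie algebras -/

section Grading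

variable {L : Type*} [AddCommGroup L] [Module ℝ L]

/-- A finite family of projections onto submodules that kill the other submodules and add up to
the identity exhibits an internal direct sum. -/
theorem isInternal_of_projections {𝒢 : ℤ → Submodule ℝ L} (p : ℤ → L →ₗ[ℝ] L) (s : Finset ℤ)
    (hp_mem : ∀ k x, p k x ∈ 𝒢 k) (hp_self : ∀ k, ∀ x ∈ 𝒢 k, p k x = x)
    (hp_ne : ∀ k l, k ≠ l → ∀ x ∈ 𝒢 l, p k x = 0) (hp_sum : ∀ x, ∑ k ∈ s, p k x = x) :
    DirectSum.IsInternal 𝒢 := by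
  rw [DirectSum.isInternal_submodule_iff_iSupIndep_and_iSup_eq_top]
  constructor
  · rw [iSupIndep_def]
    intro k
    rw [Submodule.disjoint_def]
    intro x hx hx'
    have : (⨆ j, ⨆ (_ : j ≠ k), 𝒢 j) ≤ LinearMap.ker (p k) :=
      iSup₂_le fun j hj y hy => hp_ne k j hj.symm y hy
    rw [← hp_self k x hx]
    exact this hx'
  · rw [eq_top_iff]
    intro x _
    rw [← hp_sum x]
    exact Submodule.sum_mem _ fun k _ => Submodule.mem_iSup_of_mem k (hp_mem k x)

/-- A linear map on an internal direct sum can be prescribed on the components. -/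
theorem DirectSum.IsInternal.exists_linearMap {A : Type*} [AddCommGroup A] [Module ℝ A]
    {𝒢 : ℤ → Submodule ℝ L} (h : DirectSum.IsInternal 𝒢) (φ : ∀ k, 𝒢 k →ₗ[ℝ] A) :
    ∃ f : L →ₗ[ℝ] A, ∀ k (x : 𝒢 k), f x = φ k x := by
  let e := LinearEquiv.ofBijective (DirectSum.coeLinearMap 𝒢) h
  refine ⟨DirectSum.toModule ℝ ℤ A φ ∘ₗ e.symm.toLinearMap, fun k x => ?_⟩
  have : e.symm x = DirectSum.lof ℝ ℤ (fun k => 𝒢 k) k x := by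
    rw [LinearEquiv.symm_apply_eq]
    exact (DirectSum.coeLinearMap_lof 𝒢 k x).symm
  simp [this]

/-- Linear maps which agree on the components of an internal direct sum are equal. -/
theorem DirectSum.IsInternal.linearMap_ext {A : Type*} [AddCommGroup A] [Module ℝ A]
    {𝒢 : ℤ → Submodule ℝ L} (h : DirectSum.IsInternal 𝒢) {f g : L →ₗ[ℝ] A}
    (hfg : ∀ k, ∀ x ∈ 𝒢 k, f x = g x) : f = g := by
  have htop : (⊤ : Submodule ℝ L) ≤ LinearMap.eqLocus f g := by
    rw [← h.submodule_iSup_eq_top]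
    exact iSup_le hfg
  ext x
  exact htop Submodule.mem_top

/-- A graded map which is injective on the components is injective. -/
theorem DirectSum.IsInternal.injective_of_graded {A : Type*} [AddCommGroup A] [Module ℝ A]
    {ℬ : ℤ → Submodule ℝ L} {𝒜 : ℤ → Submodule ℝ A} (hB : DirectSum.IsInternal ℬ)
    (hA : DirectSum.IsInternal 𝒜) (f : L →ₗ[ℝ] A) (hf : ∀ k, ∀ x ∈ ℬ k, f x ∈ 𝒜 k)
    (hinj : ∀ k, ∀ x ∈ ℬ k, f x = 0 → x = 0) : Injective f := by
  classical
  rw [injective_iff_map_eq_zero]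
  intro x hx
  obtain ⟨y, rfl⟩ := hB.surjective x
  have hy : DirectSum.coeAddMonoidHom 𝒜
      (∑ k ∈ DFinsupp.support y, DirectSum.of (fun k => 𝒜 k) k ⟨f (y k), hf k _ (y k).2⟩) = 0 := by
    rw [map_sum]
    simp only [DirectSum.coeAddMonoidHom_of]
    rw [← map_sum, ← hx]
    congr 1
    conv_rhs => rw [← DirectSum.sum_support_of y]
    rw [map_sum]
    simp
  have hz := hA.injective (hy.trans (map_zero _).symm)
  have hyk : ∀ k, (y k : L) = 0 := by
    intro k
    by_cases hk : k ∈ DFinsupp.support y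
    · have := congrArg (fun z : DirectSum ℤ fun k => 𝒜 k => ((z k : 𝒜 k) : A)) hz
      simp only [DirectSum.zero_apply, ZeroMemClass.coe_zero] at this
      rw [DFinsupp.finsetSum_apply, AddSubmonoidClass.coe_finsetSum, Finset.sum_eq_single k] at this
      · refine hinj k _ (y k).2 ?_
        simpa using this
      · intro b _ hb
        rw [DirectSum.of_eq_of_ne _ _ _ hb.symm]
        rfl
      · exact fun h => absurd hk h
    · simpa using hk
  have : y = 0 := by
    ext k
    simpa using hyk k
  rw [this, map_zero]

end Grading

/-! ### A criterion for Tanaka prolongations -/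

section Tanaka

variable {L : Type u} [LieRing L] [LieAlgebra ℝ L] {𝒢 : ℤ → Submodule ℝ L}
  {A : Type u} [LieRing A] [LieAlgebra ℝ A] {𝒜 : ℤ → Submodule ℝ A} {ι : L →ₗ⁅ℝ⁆ A}
  {B : Type u} [LieRing B] [LieAlgebra ℝ B] {ℬ : ℤ → Submodule ℝ B} {κ : L →ₗ⁅ℝ⁆ B}

/-- A graded linear map over `L` that is equivariant under the negative part on elements of degree
less than `n`. -/
structure IsPartialProlongation (𝒜 : ℤ → Submodule ℝ A) (ι : L →ₗ⁅ℝ⁆ A)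
    (ℬ : ℤ → Submodule ℝ B) (κ : L →ₗ⁅ℝ⁆ B) (n : ℤ) (f : B →ₗ[ℝ] A) : Prop where
  mem : ∀ k, ∀ b ∈ ℬ k, f b ∈ 𝒜 k
  comp : ∀ x, f (κ x) = ι x
  lie : ∀ k < n, ∀ b ∈ ℬ k, ∀ x, f ⁅b, κ x⁆ = ⁅f b, ι x⁆

theorem IsTransitiveExtension.map_mem (h : IsTransitiveExtension 𝒢 𝒜 ι)
    (hneg : ∀ k : ℤ, 0 ≤ k → 𝒢 k = ⊥) {k : ℤ} {x : L} (hx : x ∈ 𝒢 k) : ι x ∈ 𝒜 k := by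
  rcases lt_or_ge k 0 with hk | hk
  · rw [← h.map_neg k hk]
    exact ⟨x, hx, rfl⟩
  · rw [hneg k hk, Submodule.mem_bot] at hx
    simp [hx]

theorem exists_isPartialProlongation_zero (h𝒢 : IsLieGrading 𝒢)
    (hneg : ∀ k : ℤ, 0 ≤ k → 𝒢 k = ⊥) (hA : IsTransitiveExtension 𝒢 𝒜 ι)
    (hB : IsTransitiveExtension 𝒢 ℬ κ) :
    ∃ f : B →ₗ[ℝ] A, IsPartialProlongation 𝒜 ι ℬ κ 0 f := by
  have hle : ∀ k < 0, ℬ k ≤ LinearMap.range (κ : L →ₗ[ℝ] B) := by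
    intro k hk
    rw [← hB.map_neg k hk]
    exact LinearMap.map_le_range
  let e := LinearEquiv.ofInjective (κ : L →ₗ[ℝ] B) hB.injective
  obtain ⟨f, hf⟩ := hB.grading.isInternal.exists_linearMap (A := A) fun k =>
    if hk : k < 0 then
      (ι : L →ₗ[ℝ] A) ∘ₗ e.symm.toLinearMap ∘ₗ Submodule.inclusion (hle k hk)
    else 0
  have hfneg : ∀ k < 0, ∀ x ∈ 𝒢 k, f (κ x) = ι x := by
    intro k hk x hx
    have := hf k ⟨κ x, hB.map_mem hneg hx⟩
    rw [dif_pos hk] at this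
    rw [this]
    simp only [LinearMap.comp_apply, LinearEquiv.coe_coe, LieHom.coe_toLinearMap]
    congr 1
    rw [LinearEquiv.symm_apply_eq]
    rfl
  have hfι : ∀ x, f (κ x) = ι x := by
    have : f ∘ₗ (κ : L →ₗ[ℝ] B) = (ι : L →ₗ[ℝ] A) := by
      refine h𝒢.isInternal.linearMap_ext fun k x hx => ?_
      rcases lt_or_ge k 0 with hk | hk
      · exact hfneg k hk x hx
      · rw [hneg k hk, Submodule.mem_bot] at hx
        simp [hx]
    exact fun x => LinearMap.congr_fun this x
  refine ⟨f, ⟨fun k b hb => ?_, hfι, fun k hk b hb x => ?_⟩⟩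
  · rcases lt_or_ge k 0 with hk | hk
    · rw [← hB.map_neg k hk] at hb
      obtain ⟨x, hx, rfl⟩ := hb
      exact (hfι x).symm ▸ hA.map_mem hneg hx
    · have := hf k ⟨b, hb⟩
      rw [dif_neg hk.not_gt] at this
      simp [this]
  · rw [← hB.map_neg k hk] at hb
    obtain ⟨y, hy, rfl⟩ := hb
    change f ⁅κ y, κ x⁆ = ⁅f (κ y), ι x⁆
    rw [← LieHom.map_lie, hfι, hfι, LieHom.map_lie]

/-- Every derivation of degree `n` from the negative part to `A` is inner. -/
def InnerDerivationsOfDegree (𝒢 : ℤ → Submodule ℝ L) (𝒜 : ℤ → Submodule ℝ A) (ι : L →ₗ⁅ℝ⁆ A)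
    (n : ℤ) : Prop :=
  ∀ D : L →ₗ[ℝ] A, (∀ i, ∀ x ∈ 𝒢 i, D x ∈ 𝒜 (n + i)) →
    (∀ i j, ∀ x ∈ 𝒢 i, ∀ y ∈ 𝒢 j, D ⁅x, y⁆ = ⁅D x, ι y⁆ + ⁅ι x, D y⁆) →
    ∃ a ∈ 𝒜 n, ∀ x, D x = ⁅a, ι x⁆

theorem IsPartialProlongation.exists_inner {n : ℤ} {f : B →ₗ[ℝ] A}
    (hneg : ∀ k : ℤ, 0 ≤ k → 𝒢 k = ⊥)
    (hB : IsTransitiveExtension 𝒢 ℬ κ) (hH : InnerDerivationsOfDegree 𝒢 𝒜 ι n)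
    (hf : IsPartialProlongation 𝒜 ι ℬ κ n f) {b : B} (hb : b ∈ ℬ n) :
    ∃ a ∈ 𝒜 n, ∀ x, f ⁅b, κ x⁆ = ⁅a, ι x⁆ := by
  let D : L →ₗ[ℝ] A := f ∘ₗ (LieAlgebra.ad ℝ B b : B →ₗ[ℝ] B) ∘ₗ (κ : L →ₗ[ℝ] B)
  have hD : ∀ x, D x = f ⁅b, κ x⁆ := fun x => rfl
  refine hH D (fun i x hx => ?_) (fun i j x hx y hy => ?_)
  · exact hf.mem _ _ (hB.grading.lie_mem _ _ _ hb _ (hB.map_mem hneg hx))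
  · rcases lt_or_ge i 0 with hi | hi
    · rcases lt_or_ge j 0 with hj | hj
      · have hbx := hB.grading.lie_mem _ _ _ hb _ (hB.map_mem hneg hx)
        have hby := hB.grading.lie_mem _ _ _ hb _ (hB.map_mem hneg hy)
        rw [hD, hD, hD, LieHom.map_lie, leibniz_lie b, map_add, hf.lie _ (by omega) _ hbx,
          ← lie_skew (κ x), map_neg, hf.lie _ (by omega) _ hby, lie_skew]
      · rw [hneg j hj, Submodule.mem_bot] at hy
        simp [hy]
    · rw [hneg i hi, Submodule.mem_bot] at hx
      simp [hx]

theorem IsPartialProlongation.exists_succ {n : ℤ} {f : B →ₗ[ℝ] A} (hn : 0 ≤ n)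
    (h𝒢 : IsLieGrading 𝒢) (hneg : ∀ k : ℤ, 0 ≤ k → 𝒢 k = ⊥)
    (hA : IsTransitiveExtension 𝒢 𝒜 ι) (hB : IsTransitiveExtension 𝒢 ℬ κ)
    (hH : InnerDerivationsOfDegree 𝒢 𝒜 ι n) (hf : IsPartialProlongation 𝒜 ι ℬ κ n f) :
    ∃ f' : B →ₗ[ℝ] A, IsPartialProlongation 𝒜 ι ℬ κ (n + 1) f' := by
  have key : ∀ b : ℬ n, ∃ a ∈ 𝒜 n, ∀ x, f ⁅(b : B), κ x⁆ = ⁅a, ι x⁆ :=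
    fun b => hf.exists_inner hneg hB hH b.2
  choose a ha hax using key
  let h : ℬ n →ₗ[ℝ] A :=
    { toFun := a
      map_add' := by
        intro b c
        rw [← sub_eq_zero]
        refine hA.transitive n hn _
          ((𝒜 n).sub_mem (ha _) ((𝒜 n).add_mem (ha _) (ha _))) fun x => ?_
        rw [sub_lie, add_lie, ← hax, ← hax, ← hax]
        simp
      map_smul' := by
        intro c b
        rw [← sub_eq_zero]
        refine hA.transitive n hn _
          ((𝒜 n).sub_mem (ha _) ((𝒜 n).smul_mem _ (ha _))) fun x => ?_
        rw [sub_lie, RingHom.id_apply, smul_lie, ← hax, ← hax]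
        simp }
  obtain ⟨f', hf'⟩ := hB.grading.isInternal.exists_linearMap (A := A) fun k =>
    if hk : k = n then h ∘ₗ Submodule.inclusion (le_of_eq (congrArg ℬ hk))
    else f.domRestrict (ℬ k)
  have hne : ∀ k, k ≠ n → ∀ b ∈ ℬ k, f' b = f b := by
    intro k hk b hb
    have := hf' k ⟨b, hb⟩
    rw [dif_neg hk] at this
    exact this
  have heq : ∀ b : ℬ n, f' b = a b := by
    intro b
    have := hf' n b
    rw [dif_pos rfl] at this
    exact this
  refine ⟨f', ⟨fun k b hb => ?_, fun x => ?_, fun k hk b hb x => ?_⟩⟩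
  · by_cases hkn : k = n
    · subst hkn
      rw [heq ⟨b, hb⟩]
      exact ha _
    · rw [hne k hkn b hb]
      exact hf.mem k b hb
  · have : f' ∘ₗ (κ : L →ₗ[ℝ] B) = (ι : L →ₗ[ℝ] A) := by
      refine h𝒢.isInternal.linearMap_ext fun k x hx => ?_
      rcases lt_or_ge k 0 with hk | hk
      · exact (hne k (by omega) _ (hB.map_mem hneg hx)).trans (hf.comp x)
      · rw [hneg k hk, Submodule.mem_bot] at hx
        simp [hx]
    exact LinearMap.congr_fun this x
  · have : f' ∘ₗ (LieAlgebra.ad ℝ B b : B →ₗ[ℝ] B) ∘ₗ (κ : L →ₗ[ℝ] B) =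
        (LieAlgebra.ad ℝ A (f' b) : A →ₗ[ℝ] A) ∘ₗ (ι : L →ₗ[ℝ] A) := by
      refine h𝒢.isInternal.linearMap_ext fun i x hx => ?_
      rcases lt_or_ge i 0 with hi | hi
      · change f' ⁅b, κ x⁆ = ⁅f' b, ι x⁆
        rw [hne (k + i) (by omega) _ (hB.grading.lie_mem _ _ _ hb _ (hB.map_mem hneg hx))]
        by_cases hkn : k = n
        · subst hkn
          rw [heq ⟨b, hb⟩]
          exact hax ⟨b, hb⟩ x
        · rw [hne k hkn b hb]
          exact hf.lie k (by omega) b hb x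
      · rw [hneg i hi, Submodule.mem_bot] at hx
        simp [hx]
    exact LinearMap.congr_fun this x

theorem exists_isPartialProlongation_top (h𝒢 : IsLieGrading 𝒢)
    (hneg : ∀ k : ℤ, 0 ≤ k → 𝒢 k = ⊥) (hA : IsTransitiveExtension 𝒢 𝒜 ι)
    (hB : IsTransitiveExtension 𝒢 ℬ κ) (N : ℕ) (hN : ∀ k : ℤ, N ≤ k → 𝒜 k = ⊥)
    (hH : ∀ n : ℤ, 0 ≤ n → InnerDerivationsOfDegree 𝒢 𝒜 ι n) :
    ∃ f : B →ₗ[ℝ] A, ∀ n : ℤ, IsPartialProlongation 𝒜 ι ℬ κ n f := by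
  have hind : ∀ n : ℕ, ∃ f : B →ₗ[ℝ] A, IsPartialProlongation 𝒜 ι ℬ κ n f := by
    intro n
    induction n with
    | zero => exact exists_isPartialProlongation_zero h𝒢 hneg hA hB
    | succ n ih =>
      obtain ⟨f, hf⟩ := ih
      exact_mod_cast hf.exists_succ (Int.natCast_nonneg n) h𝒢 hneg hA hB
        (hH n (Int.natCast_nonneg n))
  obtain ⟨f, hf⟩ := hind N
  have hall : ∀ m : ℕ, IsPartialProlongation 𝒜 ι ℬ κ (N + m) f := by
    intro m
    induction m with
    | zero => simpa using hf
    | succ m ih =>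
      refine ⟨hf.mem, hf.comp, fun k hk b hb x => ?_⟩
      rcases lt_or_ge k ((N : ℤ) + m) with hlt | hge
      · exact ih.lie k hlt b hb x
      · have hk' : k = (N : ℤ) + m := by push_cast at hk; omega
        subst hk'
        obtain ⟨a, ha, hax⟩ := ih.exists_inner hneg hB (hH _ (by positivity)) hb
        have h0 : 𝒜 ((N : ℤ) + m) = ⊥ := hN _ (by omega)
        have hfb := hf.mem _ b hb
        rw [h0, Submodule.mem_bot] at ha hfb
        rw [hax, ha, hfb]
  refine ⟨f, fun n => ⟨hf.mem, hf.comp, fun k _ b hb x => ?_⟩⟩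
  exact (hall (k.toNat + 1)).lie k (by push_cast; omega) b hb x

theorem IsTransitiveExtension.isTanakaProlongation (h𝒢 : IsLieGrading 𝒢)
    (hneg : ∀ k : ℤ, 0 ≤ k → 𝒢 k = ⊥) (hA : IsTransitiveExtension 𝒢 𝒜 ι)
    (N : ℕ) (hN : ∀ k : ℤ, N ≤ k → 𝒜 k = ⊥)
    (hH : ∀ n : ℤ, 0 ≤ n → InnerDerivationsOfDegree 𝒢 𝒜 ι n) :
    IsTanakaProlongation 𝒢 𝒜 ι := by
  refine ⟨hA, ?_⟩
  intro B _ _ ℬ κ hB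
  obtain ⟨f, hf⟩ := exists_isPartialProlongation_top h𝒢 hneg hA hB N hN hH
  have hlie : ∀ b : B, ∀ x, f ⁅b, κ x⁆ = ⁅f b, ι x⁆ := by
    intro b x
    have : f ∘ₗ (LieAlgebra.ad ℝ B (κ x) : B →ₗ[ℝ] B) =
        (LieAlgebra.ad ℝ A (ι x) : A →ₗ[ℝ] A) ∘ₗ f := by
      refine hB.grading.isInternal.linearMap_ext fun k b hb => ?_
      change f ⁅κ x, b⁆ = ⁅ι x, f b⁆
      rw [← lie_skew, _root_.map_neg, (hf (k + 1)).lie k (by omega) b hb, lie_skew]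
    have h := LinearMap.congr_fun this b
    change f ⁅κ x, b⁆ = ⁅ι x, f b⁆ at h
    rw [← lie_skew, _root_.map_neg, h, lie_skew]
  have hhom : ∀ n : ℕ, ∀ i j : ℤ, i + j < n → ∀ b ∈ ℬ i, ∀ c ∈ ℬ j,
      f ⁅b, c⁆ = ⁅f b, f c⁆ := by
    have hnegi : ∀ i : ℤ, i < 0 → ∀ b ∈ ℬ i, ∀ c, f ⁅c, b⁆ = ⁅f c, f b⁆ := by
      intro i hi b hb c
      rw [← hB.map_neg i hi] at hb
      obtain ⟨x, hx, rfl⟩ := hb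
      change f ⁅c, κ x⁆ = ⁅f c, f (κ x)⁆
      rw [hlie, (hf 0).comp]
    intro n
    induction n with
    | zero =>
      intro i j hij b hb c hc
      rcases lt_or_ge i 0 with hi | hi
      · rw [← lie_skew, _root_.map_neg, hnegi i hi b hb, lie_skew]
      · exact hnegi j (by push_cast at hij; omega) c hc b
    | succ n ih =>
      intro i j hij b hb c hc
      rcases lt_or_ge i 0 with hi | hi
      · rw [← lie_skew, _root_.map_neg, hnegi i hi b hb, lie_skew]
      rcases lt_or_ge j 0 with hj | hj
      · exact hnegi j hj c hc b
      rw [← sub_eq_zero]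
      refine hA.transitive (i + j) (by omega) _ ((𝒜 _).sub_mem
        ((hf 0).mem _ _ (hB.grading.lie_mem _ _ _ hb _ hc))
        (hA.grading.lie_mem _ _ _ ((hf 0).mem _ _ hb) _ ((hf 0).mem _ _ hc))) fun x => ?_
      have : (LieAlgebra.ad ℝ A (f ⁅b, c⁆ - ⁅f b, f c⁆) : A →ₗ[ℝ] A) ∘ₗ (ι : L →ₗ[ℝ] A) = 0 := by
        refine h𝒢.isInternal.linearMap_ext fun k x hx => ?_
        change ⁅f ⁅b, c⁆ - ⁅f b, f c⁆, ι x⁆ = 0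
        rcases lt_or_ge k 0 with hk | hk
        · have hx' := hB.map_mem hneg hx
          rw [sub_lie, ← hlie, lie_lie, lie_lie, map_sub,
            ih i (j + k) (by push_cast at hij; omega) b hb _ (hB.grading.lie_mem _ _ _ hc _ hx'),
            ih j (i + k) (by push_cast at hij; omega) c hc _ (hB.grading.lie_mem _ _ _ hb _ hx'),
            hlie, hlie, sub_self]
        · rw [hneg k hk, Submodule.mem_bot] at hx
          simp [hx]
      exact LinearMap.congr_fun this x
  let F : B →ₗ⁅ℝ⁆ A :=
    { f with
      map_lie' := by
        intro b c
        change f ⁅b, c⁆ = ⁅f b, f c⁆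
        have h1 : ∀ i, ∀ b ∈ ℬ i, ∀ c, f ⁅b, c⁆ = ⁅f b, f c⁆ := by
          intro i b hb c
          have : f ∘ₗ (LieAlgebra.ad ℝ B b : B →ₗ[ℝ] B) =
              (LieAlgebra.ad ℝ A (f b) : A →ₗ[ℝ] A) ∘ₗ f :=
            hB.grading.isInternal.linearMap_ext fun j c hc =>
              hhom ((i + j).toNat + 1) i j (by push_cast; omega) b hb c hc
          exact LinearMap.congr_fun this c
        have : f ∘ₗ (LieAlgebra.ad ℝ B c : B →ₗ[ℝ] B) =
            (LieAlgebra.ad ℝ A (f c) : A →ₗ[ℝ] A) ∘ₗ f := by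
          refine hB.grading.isInternal.linearMap_ext fun i b hb => ?_
          change f ⁅c, b⁆ = ⁅f c, f b⁆
          rw [← lie_skew, _root_.map_neg, h1 i b hb c, lie_skew]
        have h := LinearMap.congr_fun this b
        change f ⁅c, b⁆ = ⁅f c, f b⁆ at h
        rw [← lie_skew, _root_.map_neg, h, lie_skew] }
  have hF : ∀ b, F b = f b := fun _ => rfl
  refine ⟨F, ?_, ?_, fun x => (hf 0).comp x⟩
  · have hinj : ∀ n : ℕ, ∀ k : ℤ, k < n → ∀ b ∈ ℬ k, f b = 0 → b = 0 := by
      intro n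
      have hnegk : ∀ k : ℤ, k < 0 → ∀ b ∈ ℬ k, f b = 0 → b = 0 := by
        intro k hk b hb hfb
        rw [← hB.map_neg k hk] at hb
        obtain ⟨x, hx, rfl⟩ := hb
        have : ι x = 0 := ((hf 0).comp x).symm.trans hfb
        have hx0 : x = 0 := hA.injective (this.trans (map_zero ι).symm)
        rw [hx0, map_zero]
      induction n with
      | zero => exact fun k hk => hnegk k (by simpa using hk)
      | succ n ih =>
        intro k hk b hb hfb
        rcases lt_or_ge k 0 with hk0 | hk0
        · exact hnegk k hk0 b hb hfb
        refine hB.transitive k hk0 b hb fun x => ?_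
        have : (LieAlgebra.ad ℝ B b : B →ₗ[ℝ] B) ∘ₗ (κ : L →ₗ[ℝ] B) = 0 := by
          refine h𝒢.isInternal.linearMap_ext fun i x hx => ?_
          change ⁅b, κ x⁆ = 0
          rcases lt_or_ge i 0 with hi | hi
          · refine ih (k + i) (by push_cast at hk; omega) _
              (hB.grading.lie_mem _ _ _ hb _ (hB.map_mem hneg hx)) ?_
            rw [hlie, hfb, zero_lie]
          · rw [hneg i hi, Submodule.mem_bot] at hx
            simp [hx]
        exact LinearMap.congr_fun this x
    exact hB.grading.isInternal.injective_of_graded hA.grading.isInternal f (hf 0).mem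
      fun k => hinj (k.toNat + 1) k (by push_cast; omega)
  · rintro k _ ⟨b, hb, rfl⟩
    exact (hf 0).mem k b hb

end Tanaka

/-! ### The Lie algebra `𝔰𝔭(3, ℝ)` in coordinates -/

/-- Real `6 × 6` matrices, with the index set used for `𝔰𝔭(3, ℝ)`. -/
abbrev Mat6 : Type := Matrix (Fin 3 ⊕ Fin 3) (Fin 3 ⊕ Fin 3) ℝ

theorem mem_sp_iff {X : Mat6} : X ∈ LieAlgebra.Symplectic.sp (Fin 3) ℝ ↔
    (∀ i j, X (.inr i) (.inr j) = -X (.inl j) (.inl i)) ∧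
    (∀ i j, X (.inl i) (.inr j) = X (.inl j) (.inr i)) ∧
    ∀ i j, X (.inr i) (.inl j) = X (.inr j) (.inl i) := by
  rw [LieAlgebra.Symplectic.sp, mem_skewAdjointMatricesLieSubalgebra,
    mem_skewAdjointMatricesSubmodule, Matrix.IsSkewAdjoint, Matrix.IsAdjointPair]
  obtain ⟨A, B, C, D, rfl⟩ : ∃ A B C D, X = Matrix.fromBlocks A B C D :=
    ⟨_, _, _, _, (Matrix.fromBlocks_toBlocks X).symm⟩
  simp only [Matrix.J, Matrix.fromBlocks_transpose, Matrix.fromBlocks_neg,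
    Matrix.fromBlocks_multiply, Matrix.fromBlocks_inj, Matrix.mul_zero, Matrix.mul_one,
    Matrix.zero_mul, Matrix.one_mul, zero_add, add_zero, Matrix.mul_neg, Matrix.neg_mul, neg_neg,
    neg_zero]
  simp only [← Matrix.ext_iff, Matrix.fromBlocks_apply₁₁, Matrix.fromBlocks_apply₁₂,
    Matrix.fromBlocks_apply₂₁, Matrix.fromBlocks_apply₂₂, Matrix.neg_apply,
    Matrix.transpose_apply, neg_inj]
  constructor
  · rintro ⟨h1, h2, h3, h4⟩
    exact ⟨fun i j => (h2 i j).symm, fun i j => (h4 i j).symm, fun i j => (h1 i j).symm⟩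
  · rintro ⟨h1, h2, h3⟩
    exact ⟨fun i j => (h3 i j).symm, fun i j => (h1 i j).symm, fun i j => h1 j i,
      fun i j => (h2 i j).symm⟩

theorem LieSp3.inr_inr (X : LieSp3) (i j : Fin 3) :
    (X : Mat6) (.inr i) (.inr j) = -(X : Mat6) (.inl j) (.inl i) := (mem_sp_iff.mp X.2).1 i j

theorem LieSp3.inl_inr (X : LieSp3) (i j : Fin 3) :
    (X : Mat6) (.inl i) (.inr j) = (X : Mat6) (.inl j) (.inr i) := (mem_sp_iff.mp X.2).2.1 i j

theorem LieSp3.inr_inl (X : LieSp3) (i j : Fin 3) :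
    (X : Mat6) (.inr i) (.inl j) = (X : Mat6) (.inr j) (.inl i) := (mem_sp_iff.mp X.2).2.2 i j

theorem LieSp3.coe_lie (X Y : LieSp3) : ((⁅X, Y⁆ : LieSp3) : Mat6) = X * Y - Y * (X : Mat6) := rfl

theorem mongeSymbol.coe_lie (X Y : mongeSymbol) :
    (((⁅X, Y⁆ : mongeSymbol) : LieSp3) : Mat6) =
      ((X : LieSp3) : Mat6) * ((Y : LieSp3) : Mat6) - ((Y : LieSp3) : Mat6) * ((X : LieSp3) : Mat6) :=
  rfl

/-! ### The gradings of `𝔰𝔭(3, ℝ)` and of its negative part -/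

theorem mongeWeight_inr (i : Fin 3) : mongeWeight (.inr i) = -mongeWeight (.inl i) := by
  fin_cases i <;> rfl

theorem mem_mongeGrading {k : ℤ} {X : LieSp3} : X ∈ mongeGrading k ↔
    ∀ i j, mongeWeight i - mongeWeight j ≠ 2 * k → (X : Mat6) i j = 0 := Iff.rfl

theorem mem_mongeSymbol {X : LieSp3} : X ∈ mongeSymbol ↔
    ∀ i j, mongeWeight j ≤ mongeWeight i → (X : Mat6) i j = 0 := Iff.rfl

/-- The projection of `𝔰𝔭(3, ℝ)` onto the component of degree `k`. -/
noncomputable def mongeProj (k : ℤ) : LieSp3 →ₗ[ℝ] LieSp3 where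
  toFun X := ⟨Matrix.of fun i j => if mongeWeight i - mongeWeight j = 2 * k then (X : Mat6) i j else 0, by
    rw [mem_sp_iff]
    refine ⟨fun i j => ?_, fun i j => ?_, fun i j => ?_⟩
    · simp only [Matrix.of_apply, mongeWeight_inr, LieSp3.inr_inr X i j, neg_sub_neg]
      split_ifs <;> simp
    · simp only [Matrix.of_apply, mongeWeight_inr, LieSp3.inl_inr X i j, sub_neg_eq_add,
        add_comm (mongeWeight (.inl i))]
    · simp only [Matrix.of_apply, mongeWeight_inr, LieSp3.inr_inl X i j]
      rw [show -mongeWeight (.inl i) - mongeWeight (.inl j) =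
        -mongeWeight (.inl j) - mongeWeight (.inl i) by ring]⟩
  map_add' X Y := by
    ext i j
    by_cases h : mongeWeight i - mongeWeight j = 2 * k <;> simp [h]
  map_smul' c X := by
    ext i j
    by_cases h : mongeWeight i - mongeWeight j = 2 * k <;> simp [h]

theorem mongeProj_apply (k : ℤ) (X : LieSp3) (i j : Fin 3 ⊕ Fin 3) :
    (mongeProj k X : Mat6) i j =
      if mongeWeight i - mongeWeight j = 2 * k then (X : Mat6) i j else 0 := rfl

theorem mongeProj_mem (k : ℤ) (X : LieSp3) : mongeProj k X ∈ mongeGrading k := by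
  intro i j h
  rw [mongeProj_apply, if_neg h]

theorem mongeProj_self {k : ℤ} {X : LieSp3} (hX : X ∈ mongeGrading k) : mongeProj k X = X := by
  ext i j
  rw [mongeProj_apply]
  split_ifs with h
  · rfl
  · exact (hX i j h).symm

theorem mongeProj_ne {k l : ℤ} (h : k ≠ l) {X : LieSp3} (hX : X ∈ mongeGrading l) :
    mongeProj k X = 0 := by
  ext i j
  rw [mongeProj_apply]
  split_ifs with h'
  · exact hX i j (by omega)
  · rfl

theorem mongeWeight_sub_mem (i j : Fin 3 ⊕ Fin 3) :
    ∃ k ∈ Finset.Icc (-3 : ℤ) 3, mongeWeight i - mongeWeight j = 2 * k := by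
  revert i j
  decide

theorem sum_mongeProj (X : LieSp3) : ∑ k ∈ Finset.Icc (-3 : ℤ) 3, mongeProj k X = X := by
  ext i j
  rw [AddSubmonoidClass.coe_finsetSum, Matrix.sum_apply]
  obtain ⟨k, hk, hij⟩ := mongeWeight_sub_mem i j
  rw [Finset.sum_eq_single k]
  · rw [mongeProj_apply, if_pos hij]
  · intro l _ hl
    rw [mongeProj_apply, if_neg (by omega)]
  · exact fun h => absurd hk h

theorem mongeGrading_mul {k l : ℤ} {X Y : LieSp3} (hX : X ∈ mongeGrading k)
    (hY : Y ∈ mongeGrading l) {i j : Fin 3 ⊕ Fin 3}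
    (hij : mongeWeight i - mongeWeight j ≠ 2 * (k + l)) : ((X : Mat6) * (Y : Mat6)) i j = 0 := by
  rw [Matrix.mul_apply]
  refine Finset.sum_eq_zero fun m _ => ?_
  by_cases h : mongeWeight i - mongeWeight m = 2 * k
  · rw [hY m j (by omega), mul_zero]
  · rw [hX i m h, zero_mul]

theorem isLieGrading_mongeGrading : IsLieGrading mongeGrading where
  isInternal := isInternal_of_projections mongeProj (Finset.Icc (-3) 3) mongeProj_mem
    (fun _ _ => mongeProj_self) (fun _ _ h _ => mongeProj_ne h) sum_mongeProj
  lie_mem k l X hX Y hY := by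
    intro i j hij
    rw [LieSp3.coe_lie, Matrix.sub_apply, mongeGrading_mul hX hY hij,
      mongeGrading_mul hY hX (by rwa [add_comm l k]), sub_zero]

theorem mongeGrading_le_mongeSymbol {k : ℤ} (hk : k < 0) {X : LieSp3} (hX : X ∈ mongeGrading k) :
    X ∈ mongeSymbol := fun i j h => hX i j (by omega)

theorem mem_mongeSymbolGrading {k : ℤ} (hk : k < 0) {X : mongeSymbol} :
    X ∈ mongeSymbolGrading k ↔ (X : LieSp3) ∈ mongeGrading k := by
  rw [mongeSymbolGrading, if_pos hk]
  rfl

theorem mongeSymbolGrading_of_nonneg {k : ℤ} (hk : 0 ≤ k) : mongeSymbolGrading k = ⊥ := by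
  rw [mongeSymbolGrading, if_neg hk.not_gt]

theorem mongeGrading_eq_bot {k : ℤ} (hk : k < -3 ∨ 3 < k) : mongeGrading k = ⊥ := by
  rw [eq_bot_iff]
  intro X hX
  rw [Submodule.mem_bot]
  ext i j
  obtain ⟨l, hl, hij⟩ := mongeWeight_sub_mem i j
  rw [Finset.mem_Icc] at hl
  exact hX i j (by omega)

theorem mongeProj_mongeSymbol {k : ℤ} (X : mongeSymbol) : mongeProj k X ∈ mongeSymbol := by
  intro i j h
  rw [mongeProj_apply, X.2 i j h, ite_self]

/-- The projection of the negative part of `𝔰𝔭(3, ℝ)` onto the component of degree `k`. -/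
noncomputable def mongeSymbolProj (k : ℤ) : mongeSymbol →ₗ[ℝ] mongeSymbol :=
  LinearMap.codRestrict mongeSymbol.toSubmodule (mongeProj k ∘ₗ mongeSymbol.toSubmodule.subtype)
    fun X => mongeProj_mongeSymbol X

theorem coe_mongeSymbolProj (k : ℤ) (X : mongeSymbol) :
    (mongeSymbolProj k X : LieSp3) = mongeProj k X := rfl

theorem isLieGrading_mongeSymbolGrading : IsLieGrading mongeSymbolGrading where
  isInternal := by
    have hproj : ∀ k : ℤ, 0 ≤ k → ∀ X, mongeSymbolProj k X = 0 := by
      intro k hk X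
      ext i j
      rw [coe_mongeSymbolProj, mongeProj_apply]
      split_ifs with h
      · exact X.2 i j (by omega)
      · rfl
    have hmem : ∀ k X, X ∈ mongeSymbolGrading k → (X : LieSp3) ∈ mongeGrading k := by
      intro k X hX
      rcases lt_or_ge k 0 with hk | hk
      · exact (mem_mongeSymbolGrading hk).mp hX
      · rw [mongeSymbolGrading_of_nonneg hk, Submodule.mem_bot] at hX
        rw [hX]
        exact (mongeGrading k).zero_mem
    refine isInternal_of_projections mongeSymbolProj (Finset.Icc (-3) 3) (fun k X => ?_)
      (fun k X hX => ?_) (fun k l h X hX => ?_) fun X => ?_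
    · rcases lt_or_ge k 0 with hk | hk
      · exact (mem_mongeSymbolGrading hk).mpr (mongeProj_mem k X)
      · rw [hproj k hk]
        exact Submodule.zero_mem _
    · exact Subtype.ext (mongeProj_self (hmem k X hX))
    · exact Subtype.ext (mongeProj_ne h (hmem l X hX))
    · apply Subtype.ext
      rw [AddSubmonoidClass.coe_finsetSum]
      exact sum_mongeProj X
  lie_mem k l X hX Y hY := by
    rcases lt_or_ge k 0 with hk | hk
    · rcases lt_or_ge l 0 with hl | hl
      · rw [mem_mongeSymbolGrading (by omega)]
        exact isLieGrading_mongeGrading.lie_mem _ _ _ ((mem_mongeSymbolGrading hk).mp hX) _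
          ((mem_mongeSymbolGrading hl).mp hY)
      · rw [mongeSymbolGrading_of_nonneg hl, Submodule.mem_bot] at hY
        simp [hY]
    · rw [mongeSymbolGrading_of_nonneg hk, Submodule.mem_bot] at hX
      simp [hX]

/-! ### Coordinates on the negative part -/

/-- The element of the negative part of `𝔰𝔭(3, ℝ)` with coordinates
`(t, x₁, x₂, y₁, y₂, z₁₁, z₁₂, z₂₂)`. -/
def symbolMatrix (c : Fin 8 → ℝ) : Mat6 :=
  Matrix.fromBlocks !![0, 0, 0; 0, 0, 0; -c 3, -c 4, 0] 0
    !![c 5, c 6, c 1; c 6, c 7, c 2; c 1, c 2, c 0] !![0, 0, c 3; 0, 0, c 4; 0, 0, 0]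

theorem symbolMatrix_mem_sp (c : Fin 8 → ℝ) :
    symbolMatrix c ∈ LieAlgebra.Symplectic.sp (Fin 3) ℝ := by
  rw [mem_sp_iff]
  simp [symbolMatrix, Fin.forall_fin_succ]

/-- The negative part of `𝔰𝔭(3, ℝ)` is parametrised by `ℝ⁸`. -/
noncomputable def symbolEquiv : EuclideanSpace ℝ (Fin 8) ≃ₗ[ℝ] mongeSymbol where
  toFun c := ⟨⟨symbolMatrix c, symbolMatrix_mem_sp c⟩, by
    rw [mem_mongeSymbol]
    simp [Fin.forall_fin_succ, symbolMatrix, mongeWeight]⟩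
  invFun X := !₂[((X : LieSp3) : Mat6) (.inr 2) (.inl 2), ((X : LieSp3) : Mat6) (.inr 0) (.inl 2),
    ((X : LieSp3) : Mat6) (.inr 1) (.inl 2), -((X : LieSp3) : Mat6) (.inl 2) (.inl 0),
    -((X : LieSp3) : Mat6) (.inl 2) (.inl 1), ((X : LieSp3) : Mat6) (.inr 0) (.inl 0),
    ((X : LieSp3) : Mat6) (.inr 0) (.inl 1), ((X : LieSp3) : Mat6) (.inr 1) (.inl 1)]
  map_add' c d := by
    apply Subtype.ext
    apply Subtype.ext
    rw [← Matrix.ext_iff]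
    simp [Fin.forall_fin_succ, symbolMatrix]
    constructor <;> ring
  map_smul' r c := by
    apply Subtype.ext
    apply Subtype.ext
    rw [← Matrix.ext_iff]
    simp [Fin.forall_fin_succ, symbolMatrix]
  left_inv c := by
    ext i
    fin_cases i <;> simp [symbolMatrix]
  right_inv X := by
    apply Subtype.ext
    apply Subtype.ext
    have h := mem_mongeSymbol.mp X.2
    have h1 := LieSp3.inr_inr X
    have h2 := LieSp3.inr_inl X
    rw [← Matrix.ext_iff]
    simp [Fin.forall_fin_succ, mongeWeight] at h
    simp [Fin.forall_fin_succ, symbolMatrix, h1, h2 1 0, h2 2 0, h2 2 1]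
    simp [h]

/-! ### Derivations of the negative part with values in `𝔰𝔭(3, ℝ)` -/

/-- A general element of `𝔰𝔭(3, ℝ)`. -/
def spMatrix (p : Fin 21 → ℝ) : Mat6 :=
  Matrix.fromBlocks !![p 0, p 1, p 2; p 3, p 4, p 5; p 6, p 7, p 8]
    !![p 9, p 10, p 11; p 10, p 12, p 13; p 11, p 13, p 14]
    !![p 15, p 16, p 17; p 16, p 18, p 19; p 17, p 19, p 20]
    !![-p 0, -p 3, -p 6; -p 1, -p 4, -p 7; -p 2, -p 5, -p 8]

theorem spMatrix_mem_sp (p : Fin 21 → ℝ) :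
    spMatrix p ∈ LieAlgebra.Symplectic.sp (Fin 3) ℝ := by
  rw [mem_sp_iff]
  simp [spMatrix, Fin.forall_fin_succ]

/-- The coordinates of an element of `𝔰𝔭(3, ℝ)`. -/
def spCoord (X : Mat6) : Fin 21 → ℝ :=
  ![X (.inl 0) (.inl 0), X (.inl 0) (.inl 1), X (.inl 0) (.inl 2),
    X (.inl 1) (.inl 0), X (.inl 1) (.inl 1), X (.inl 1) (.inl 2),
    X (.inl 2) (.inl 0), X (.inl 2) (.inl 1), X (.inl 2) (.inl 2),
    X (.inl 0) (.inr 0), X (.inl 0) (.inr 1), X (.inl 0) (.inr 2),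
    X (.inl 1) (.inr 1), X (.inl 1) (.inr 2), X (.inl 2) (.inr 2),
    X (.inr 0) (.inl 0), X (.inr 0) (.inl 1), X (.inr 0) (.inl 2),
    X (.inr 1) (.inl 1), X (.inr 1) (.inl 2), X (.inr 2) (.inl 2)]

theorem LieSp3.eq_spMatrix (X : LieSp3) : (X : Mat6) = spMatrix (spCoord X) := by
  have h1 := LieSp3.inr_inr X
  have h2 := LieSp3.inl_inr X
  have h3 := LieSp3.inr_inl X
  rw [← Matrix.ext_iff]
  simp [Fin.forall_fin_succ, spMatrix, spCoord, h1, h2 1 0, h2 2 0, h2 2 1, h3 1 0, h3 2 0, h3 2 1]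

theorem spCoord_spMatrix (p : Fin 21 → ℝ) : spCoord (spMatrix p) = p := by
  ext i
  fin_cases i <;> rfl

theorem spMatrix_sub (p q : Fin 21 → ℝ) : spMatrix p - spMatrix q = spMatrix (p - q) := by
  rw [← Matrix.ext_iff]
  simp [Fin.forall_fin_succ, spMatrix]
  ring_nf
  simp

theorem spMatrix_eq_zero {p : Fin 21 → ℝ} (h : spMatrix p = 0) : p = 0 := by
  rw [← spCoord_spMatrix p, h]
  ext i
  fin_cases i <;> rfl

/-- The bracket with an element of the negative part in coordinates. -/
def lieSymbol (p : Fin 21 → ℝ) (c : Fin 8 → ℝ) : Fin 21 → ℝ :=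
  ![-(p 2 * c 3) + p 9 * c 5 + p 10 * c 6 + p 11 * c 1,
    -(p 2 * c 4) + p 9 * c 6 + p 10 * c 7 + p 11 * c 2,
    p 9 * c 1 + p 10 * c 2 + p 11 * c 0,
    -(p 5 * c 3) + p 10 * c 5 + p 12 * c 6 + p 13 * c 1,
    -(p 5 * c 4) + p 10 * c 6 + p 12 * c 7 + p 13 * c 2,
    p 10 * c 1 + p 12 * c 2 + p 13 * c 0,
    p 0 * c 3 + p 3 * c 4 - p 8 * c 3 + p 11 * c 5 + p 13 * c 6 + p 14 * c 1,
    p 1 * c 3 + p 4 * c 4 - p 8 * c 4 + p 11 * c 6 + p 13 * c 7 + p 14 * c 2,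
    p 2 * c 3 + p 5 * c 4 + p 11 * c 1 + p 13 * c 2 + p 14 * c 0,
    0,
    0,
    p 9 * c 3 + p 10 * c 4,
    0,
    p 10 * c 3 + p 12 * c 4,
    2 * p 11 * c 3 + 2 * p 13 * c 4,
    -2 * p 0 * c 5 - 2 * p 3 * c 6 - 2 * p 6 * c 1 - 2 * p 17 * c 3,
    -(p 0 * c 6) - p 1 * c 5 - p 3 * c 7 - p 4 * c 6 - p 6 * c 2 - p 7 * c 1 - p 17 * c 4 - p 19 * c 3,
    -(p 0 * c 1) - p 2 * c 5 - p 3 * c 2 - p 5 * c 6 - p 6 * c 0 - p 8 * c 1 - p 20 * c 3,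
    -2 * p 1 * c 6 - 2 * p 4 * c 7 - 2 * p 7 * c 2 - 2 * p 19 * c 4,
    -(p 1 * c 1) - p 2 * c 6 - p 4 * c 2 - p 5 * c 7 - p 7 * c 0 - p 8 * c 2 - p 20 * c 4,
    -2 * p 2 * c 1 - 2 * p 5 * c 2 - 2 * p 8 * c 0]

theorem lieSymbol_apply (p : Fin 21 → ℝ) (c : Fin 8 → ℝ) :
    lieSymbol p c 0 = -(p 2 * c 3) + p 9 * c 5 + p 10 * c 6 + p 11 * c 1 ∧
    lieSymbol p c 1 = -(p 2 * c 4) + p 9 * c 6 + p 10 * c 7 + p 11 * c 2 ∧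
    lieSymbol p c 2 = p 9 * c 1 + p 10 * c 2 + p 11 * c 0 ∧
    lieSymbol p c 3 = -(p 5 * c 3) + p 10 * c 5 + p 12 * c 6 + p 13 * c 1 ∧
    lieSymbol p c 4 = -(p 5 * c 4) + p 10 * c 6 + p 12 * c 7 + p 13 * c 2 ∧
    lieSymbol p c 5 = p 10 * c 1 + p 12 * c 2 + p 13 * c 0 ∧
    lieSymbol p c 6 = p 0 * c 3 + p 3 * c 4 - p 8 * c 3 + p 11 * c 5 + p 13 * c 6 + p 14 * c 1 ∧
    lieSymbol p c 7 = p 1 * c 3 + p 4 * c 4 - p 8 * c 4 + p 11 * c 6 + p 13 * c 7 + p 14 * c 2 ∧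
    lieSymbol p c 8 = p 2 * c 3 + p 5 * c 4 + p 11 * c 1 + p 13 * c 2 + p 14 * c 0 ∧
    lieSymbol p c 9 = 0 ∧
    lieSymbol p c 10 = 0 ∧
    lieSymbol p c 11 = p 9 * c 3 + p 10 * c 4 ∧
    lieSymbol p c 12 = 0 ∧
    lieSymbol p c 13 = p 10 * c 3 + p 12 * c 4 ∧
    lieSymbol p c 14 = 2 * p 11 * c 3 + 2 * p 13 * c 4 ∧
    lieSymbol p c 15 = -2 * p 0 * c 5 - 2 * p 3 * c 6 - 2 * p 6 * c 1 - 2 * p 17 * c 3 ∧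
    lieSymbol p c 16 = -(p 0 * c 6) - p 1 * c 5 - p 3 * c 7 - p 4 * c 6 - p 6 * c 2 - p 7 * c 1 - p 17 * c 4 - p 19 * c 3 ∧
    lieSymbol p c 17 = -(p 0 * c 1) - p 2 * c 5 - p 3 * c 2 - p 5 * c 6 - p 6 * c 0 - p 8 * c 1 - p 20 * c 3 ∧
    lieSymbol p c 18 = -2 * p 1 * c 6 - 2 * p 4 * c 7 - 2 * p 7 * c 2 - 2 * p 19 * c 4 ∧
    lieSymbol p c 19 = -(p 1 * c 1) - p 2 * c 6 - p 4 * c 2 - p 5 * c 7 - p 7 * c 0 - p 8 * c 2 - p 20 * c 4 ∧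
    lieSymbol p c 20 = -2 * p 2 * c 1 - 2 * p 5 * c 2 - 2 * p 8 * c 0 :=
  ⟨rfl, rfl, rfl, rfl, rfl, rfl, rfl, rfl, rfl, rfl, rfl, rfl, rfl, rfl, rfl, rfl, rfl, rfl, rfl, rfl, rfl⟩

theorem spCoord_apply (X : Mat6) :
    spCoord X 0 = X (.inl 0) (.inl 0) ∧
    spCoord X 1 = X (.inl 0) (.inl 1) ∧
    spCoord X 2 = X (.inl 0) (.inl 2) ∧
    spCoord X 3 = X (.inl 1) (.inl 0) ∧
    spCoord X 4 = X (.inl 1) (.inl 1) ∧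
    spCoord X 5 = X (.inl 1) (.inl 2) ∧
    spCoord X 6 = X (.inl 2) (.inl 0) ∧
    spCoord X 7 = X (.inl 2) (.inl 1) ∧
    spCoord X 8 = X (.inl 2) (.inl 2) ∧
    spCoord X 9 = X (.inl 0) (.inr 0) ∧
    spCoord X 10 = X (.inl 0) (.inr 1) ∧
    spCoord X 11 = X (.inl 0) (.inr 2) ∧
    spCoord X 12 = X (.inl 1) (.inr 1) ∧
    spCoord X 13 = X (.inl 1) (.inr 2) ∧
    spCoord X 14 = X (.inl 2) (.inr 2) ∧
    spCoord X 15 = X (.inr 0) (.inl 0) ∧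
    spCoord X 16 = X (.inr 0) (.inl 1) ∧
    spCoord X 17 = X (.inr 0) (.inl 2) ∧
    spCoord X 18 = X (.inr 1) (.inl 1) ∧
    spCoord X 19 = X (.inr 1) (.inl 2) ∧
    spCoord X 20 = X (.inr 2) (.inl 2) :=
  ⟨rfl, rfl, rfl, rfl, rfl, rfl, rfl, rfl, rfl, rfl, rfl, rfl, rfl, rfl, rfl, rfl, rfl, rfl, rfl, rfl, rfl⟩

theorem funext_fin21 {f g : Fin 21 → ℝ} (h : (f 0 = g 0 ∧ f 1 = g 1 ∧ f 2 = g 2 ∧ f 3 = g 3 ∧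
    f 4 = g 4 ∧ f 5 = g 5 ∧ f 6 = g 6 ∧ f 7 = g 7 ∧ f 8 = g 8 ∧ f 9 = g 9 ∧ f 10 = g 10 ∧
    f 11 = g 11 ∧ f 12 = g 12 ∧ f 13 = g 13 ∧ f 14 = g 14 ∧ f 15 = g 15 ∧ f 16 = g 16 ∧
    f 17 = g 17 ∧ f 18 = g 18 ∧ f 19 = g 19 ∧ f 20 = g 20)) : f = g := by
  funext i
  fin_cases i <;> simp only [Fin.reduceFinMk, Fin.zero_eta, Fin.mk_one, h]

theorem spMatrix_lie_symbolMatrix (p : Fin 21 → ℝ) (c : Fin 8 → ℝ) :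
    ⁅spMatrix p, symbolMatrix c⁆ = spMatrix (lieSymbol p c) := by
  have h := LieSp3.eq_spMatrix ⁅(⟨spMatrix p, spMatrix_mem_sp p⟩ : LieSp3),
    (⟨symbolMatrix c, symbolMatrix_mem_sp c⟩ : LieSp3)⁆
  rw [LieSp3.coe_lie] at h
  rw [Ring.lie_def, h]
  congr 1
  refine funext_fin21 ?_
  simp only [spCoord_apply, lieSymbol_apply, Matrix.sub_apply, Matrix.mul_apply,
    Fintype.sum_sum_type, Fin.sum_univ_three, spMatrix, symbolMatrix, Matrix.fromBlocks_apply₁₁,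
    Matrix.fromBlocks_apply₁₂, Matrix.fromBlocks_apply₂₁, Matrix.fromBlocks_apply₂₂,
    Matrix.of_apply, Matrix.cons_val, Matrix.zero_apply]
  refine ⟨?_, ?_, ?_, ?_, ?_, ?_, ?_, ?_, ?_, ?_, ?_, ?_, ?_, ?_, ?_, ?_, ?_, ?_, ?_, ?_, ?_⟩ <;> ring

/-! ### The negative part in coordinates -/

/-- The degrees, up to sign, of the coordinates `(t, x₁, x₂, y₁, y₂, z₁₁, z₁₂, z₂₂)`. -/
def symbolDegree : Fin 8 → ℕ := ![1, 2, 2, 1, 1, 3, 3, 3]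

/-- The bracket of the negative part in coordinates. -/
def symbolBracket (c d : Fin 8 → ℝ) : Fin 8 → ℝ :=
  ![0, c 3 * d 0 - c 0 * d 3, c 4 * d 0 - c 0 * d 4, 0, 0, 2 * (c 3 * d 1 - c 1 * d 3),
    c 3 * d 2 + c 4 * d 1 - c 1 * d 4 - c 2 * d 3, 2 * (c 4 * d 2 - c 2 * d 4)]

/-- The element of the negative part with the given coordinates. -/
noncomputable def symbolElt (c : Fin 8 → ℝ) : mongeSymbol := symbolEquiv (WithLp.toLp 2 c)

theorem coe_symbolElt (c : Fin 8 → ℝ) : ((symbolElt c : LieSp3) : Mat6) = symbolMatrix c := rfl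

theorem symbolElt_lie (c d : Fin 8 → ℝ) :
    ⁅symbolElt c, symbolElt d⁆ = symbolElt (symbolBracket c d) := by
  apply Subtype.ext
  apply Subtype.ext
  rw [mongeSymbol.coe_lie]
  simp only [coe_symbolElt, symbolMatrix, symbolBracket, Matrix.fromBlocks_multiply, sub_eq_add_neg,
    Matrix.fromBlocks_neg, Matrix.fromBlocks_add, Matrix.fromBlocks_inj]
  refine ⟨?_, ?_, ?_, ?_⟩
  · simp
    funext i
    fin_cases i <;> rfl
  · simp
  · simp
    refine ⟨⟨?_, ?_, ?_⟩, ⟨?_, ?_, ?_⟩, ?_, ?_⟩ <;> ring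
  · simp
    funext i
    fin_cases i <;> rfl

theorem symbolElt_mem_iff {k : ℕ} (hk : 1 ≤ k) (c : Fin 8 → ℝ) :
    symbolElt c ∈ mongeSymbolGrading (-(k : ℤ)) ↔ ∀ i, symbolDegree i ≠ k → c i = 0 := by
  rw [mem_mongeSymbolGrading (by omega), mem_mongeGrading, coe_symbolElt]
  have h1 : (-2 = -(2 * (k : ℤ))) ↔ 1 = k := by omega
  have h2 : (-4 = -(2 * (k : ℤ))) ↔ 2 = k := by omega
  have h3 : (-6 = -(2 * (k : ℤ))) ↔ 3 = k := by omega
  simp [Fin.forall_fin_succ, symbolMatrix, mongeWeight, symbolDegree, h1, h2, h3]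
  tauto

theorem symbolElt_add (c d : Fin 8 → ℝ) : symbolElt (c + d) = symbolElt c + symbolElt d := by
  rw [symbolElt, WithLp.toLp_add, map_add]
  rfl

theorem symbolElt_smul (r : ℝ) (c : Fin 8 → ℝ) : symbolElt (r • c) = r • symbolElt c := by
  rw [symbolElt, WithLp.toLp_smul, map_smul]
  rfl

theorem exists_symbolElt (x : mongeSymbol) : ∃ c, x = symbolElt c :=
  ⟨(symbolEquiv.symm x).ofLp, (symbolEquiv.apply_symm_apply x).symm⟩

/-- The linear maps on the negative part are determined by their values on the coordinate basis. -/
theorem mongeSymbol_linearMap_ext {A : Type*} [AddCommGroup A] [Module ℝ A]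
    {f g : mongeSymbol →ₗ[ℝ] A}
    (h : f (symbolElt ![1, 0, 0, 0, 0, 0, 0, 0]) = g (symbolElt ![1, 0, 0, 0, 0, 0, 0, 0]) ∧
      f (symbolElt ![0, 1, 0, 0, 0, 0, 0, 0]) = g (symbolElt ![0, 1, 0, 0, 0, 0, 0, 0]) ∧
      f (symbolElt ![0, 0, 1, 0, 0, 0, 0, 0]) = g (symbolElt ![0, 0, 1, 0, 0, 0, 0, 0]) ∧
      f (symbolElt ![0, 0, 0, 1, 0, 0, 0, 0]) = g (symbolElt ![0, 0, 0, 1, 0, 0, 0, 0]) ∧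
      f (symbolElt ![0, 0, 0, 0, 1, 0, 0, 0]) = g (symbolElt ![0, 0, 0, 0, 1, 0, 0, 0]) ∧
      f (symbolElt ![0, 0, 0, 0, 0, 2, 0, 0]) = g (symbolElt ![0, 0, 0, 0, 0, 2, 0, 0]) ∧
      f (symbolElt ![0, 0, 0, 0, 0, 0, 1, 0]) = g (symbolElt ![0, 0, 0, 0, 0, 0, 1, 0]) ∧
      f (symbolElt ![0, 0, 0, 0, 0, 0, 0, 2]) = g (symbolElt ![0, 0, 0, 0, 0, 0, 0, 2])) :
    f = g := by
  obtain ⟨h0, h1, h2, h3, h4, h5, h6, h7⟩ := h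
  ext x
  obtain ⟨c, rfl⟩ := exists_symbolElt x
  have hc : c = c 0 • ![1, 0, 0, 0, 0, 0, 0, 0] + c 1 • ![0, 1, 0, 0, 0, 0, 0, 0] +
      c 2 • ![0, 0, 1, 0, 0, 0, 0, 0] + c 3 • ![0, 0, 0, 1, 0, 0, 0, 0] +
      c 4 • ![0, 0, 0, 0, 1, 0, 0, 0] + (c 5 / 2) • ![0, 0, 0, 0, 0, 2, 0, 0] +
      c 6 • ![0, 0, 0, 0, 0, 0, 1, 0] + (c 7 / 2) • ![0, 0, 0, 0, 0, 0, 0, 2] := by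
    funext i
    fin_cases i <;> simp
  rw [hc]
  simp only [symbolElt_add, symbolElt_smul, map_add, map_smul, h0, h1, h2, h3, h4, h5, h6, h7]

/-! ### Derivations of the negative part with values in `𝔰𝔭(3, ℝ)` -/

section Derivations

variable {n : ℤ} {D : mongeSymbol →ₗ[ℝ] LieSp3}

theorem derivation_coord
    (hD : ∀ i j, ∀ x ∈ mongeSymbolGrading i, ∀ y ∈ mongeSymbolGrading j,
      D ⁅x, y⁆ = ⁅D x, mongeSymbol.incl y⁆ + ⁅mongeSymbol.incl x, D y⁆)
    (k l : ℕ) (hk : 1 ≤ k) (hl : 1 ≤ l) (c d e : Fin 8 → ℝ)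
    (hc : ∀ i, symbolDegree i ≠ k → c i = 0) (hd : ∀ i, symbolDegree i ≠ l → d i = 0)
    (he : symbolBracket c d = e) :
    spCoord (D (symbolElt e)) =
      lieSymbol (spCoord (D (symbolElt c))) d - lieSymbol (spCoord (D (symbolElt d))) c := by
  rw [← he, ← symbolElt_lie, hD _ _ _ ((symbolElt_mem_iff hk c).mpr hc) _
    ((symbolElt_mem_iff hl d).mpr hd), ← lie_skew (mongeSymbol.incl (symbolElt c)),
    ← sub_eq_add_neg]
  have key : ∀ (X : LieSp3) (c : Fin 8 → ℝ),
      (⁅X, mongeSymbol.incl (symbolElt c)⁆ : LieSp3) =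
        (spMatrix (lieSymbol (spCoord X) c) : Mat6) := by
    intro X c
    rw [← spMatrix_lie_symbolMatrix, ← LieSp3.eq_spMatrix]
    rfl
  rw [AddSubgroupClass.coe_sub, key, key, spMatrix_sub, spCoord_spMatrix]

theorem derivation_eq_inner_of_generators
    (hdeg : ∀ i, ∀ x ∈ mongeSymbolGrading i, D x ∈ mongeGrading (n + i)) (hn : 0 ≤ n)
    (hD : ∀ i j, ∀ x ∈ mongeSymbolGrading i, ∀ y ∈ mongeSymbolGrading j,
      D ⁅x, y⁆ = ⁅D x, mongeSymbol.incl y⁆ + ⁅mongeSymbol.incl x, D y⁆) :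
    ∃ a : Fin 21 → ℝ,
      spCoord (D (symbolElt ![1, 0, 0, 0, 0, 0, 0, 0])) = lieSymbol a ![1, 0, 0, 0, 0, 0, 0, 0] ∧
      spCoord (D (symbolElt ![0, 0, 0, 1, 0, 0, 0, 0])) = lieSymbol a ![0, 0, 0, 1, 0, 0, 0, 0] ∧
      spCoord (D (symbolElt ![0, 0, 0, 0, 1, 0, 0, 0])) =
        lieSymbol a ![0, 0, 0, 0, 1, 0, 0, 0] := by
  have hbr : ∀ c d : Fin 8 → ℝ, symbolBracket c d = symbolBracket c d := fun _ _ => rfl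
  set p := spCoord (D (symbolElt ![1, 0, 0, 0, 0, 0, 0, 0])) with hp
  set q := spCoord (D (symbolElt ![0, 0, 0, 1, 0, 0, 0, 0])) with hq
  set r := spCoord (D (symbolElt ![0, 0, 0, 0, 1, 0, 0, 0])) with hr
  have hzero : spCoord (D (symbolElt ![0, 0, 0, 0, 0, 0, 0, 0])) = 0 := by
    have : symbolElt ![0, 0, 0, 0, 0, 0, 0, 0] = 0 := by
      rw [← zero_smul ℝ (symbolElt ![0, 0, 0, 0, 0, 0, 0, 0]), ← symbolElt_smul]
      congr 1
      simp
    rw [this, map_zero]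
    funext i
    fin_cases i <;> rfl
  have hlow : ∀ c : Fin 8 → ℝ, (∀ i, symbolDegree i ≠ 1 → c i = 0) →
      ∀ i j, mongeWeight i - mongeWeight j < -2 → (D (symbolElt c) : Mat6) i j = 0 :=
    fun c hc i j hij => hdeg _ _ ((symbolElt_mem_iff le_rfl c).mpr hc) i j (by push_cast; omega)
  have hlow' : ∀ c : Fin 8 → ℝ, (∀ i, symbolDegree i ≠ 1 → c i = 0) →
      spCoord (D (symbolElt c)) 15 = 0 ∧ spCoord (D (symbolElt c)) 16 = 0 ∧
      spCoord (D (symbolElt c)) 17 = 0 ∧ spCoord (D (symbolElt c)) 18 = 0 ∧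
      spCoord (D (symbolElt c)) 19 = 0 := by
    intro c hc
    refine ⟨?_, ?_, ?_, ?_, ?_⟩ <;>
      exact hlow c hc _ _ (by decide)
  obtain ⟨p15, p16, p17, p18, p19⟩ := hlow' ![1, 0, 0, 0, 0, 0, 0, 0]
    (by simp [Fin.forall_fin_succ, symbolDegree])
  obtain ⟨q15, q16, q17, q18, q19⟩ := hlow' ![0, 0, 0, 1, 0, 0, 0, 0]
    (by simp [Fin.forall_fin_succ, symbolDegree])
  obtain ⟨r15, r16, r17, r18, r19⟩ := hlow' ![0, 0, 0, 0, 1, 0, 0, 0]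
    (by simp [Fin.forall_fin_succ, symbolDegree])
  rw [← hp] at p15 p16 p17 p18 p19
  rw [← hq] at q15 q16 q17 q18 q19
  rw [← hr] at r15 r16 r17 r18 r19
  have hX1 := derivation_coord hD 1 1 (by norm_num) (by norm_num) ![0, 0, 0, 1, 0, 0, 0, 0]
    ![1, 0, 0, 0, 0, 0, 0, 0] ![0, 1, 0, 0, 0, 0, 0, 0]
    (by simp [Fin.forall_fin_succ, symbolDegree]) (by simp [Fin.forall_fin_succ, symbolDegree])
    (by simp [symbolBracket])
  have hX2 := derivation_coord hD 1 1 (by norm_num) (by norm_num) ![0, 0, 0, 0, 1, 0, 0, 0]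
    ![1, 0, 0, 0, 0, 0, 0, 0] ![0, 0, 1, 0, 0, 0, 0, 0]
    (by simp [Fin.forall_fin_succ, symbolDegree]) (by simp [Fin.forall_fin_succ, symbolDegree])
    (by simp [symbolBracket])
  have hZ11 := derivation_coord hD 1 2 (by norm_num) (by norm_num) ![0, 0, 0, 1, 0, 0, 0, 0]
    ![0, 1, 0, 0, 0, 0, 0, 0] ![0, 0, 0, 0, 0, 2, 0, 0]
    (by simp [Fin.forall_fin_succ, symbolDegree]) (by simp [Fin.forall_fin_succ, symbolDegree])
    (by simp [symbolBracket])
  have hZ12 := derivation_coord hD 1 2 (by norm_num) (by norm_num) ![0, 0, 0, 1, 0, 0, 0, 0]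
    ![0, 0, 1, 0, 0, 0, 0, 0] ![0, 0, 0, 0, 0, 0, 1, 0]
    (by simp [Fin.forall_fin_succ, symbolDegree]) (by simp [Fin.forall_fin_succ, symbolDegree])
    (by simp [symbolBracket])
  have hZ22 := derivation_coord hD 1 2 (by norm_num) (by norm_num) ![0, 0, 0, 0, 1, 0, 0, 0]
    ![0, 0, 1, 0, 0, 0, 0, 0] ![0, 0, 0, 0, 0, 0, 0, 2]
    (by simp [Fin.forall_fin_succ, symbolDegree]) (by simp [Fin.forall_fin_succ, symbolDegree])
    (by simp [symbolBracket])
  have ha := derivation_coord hD 1 1 (by norm_num) (by norm_num) ![0, 0, 0, 1, 0, 0, 0, 0]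
    ![0, 0, 0, 0, 1, 0, 0, 0] ![0, 0, 0, 0, 0, 0, 0, 0]
    (by simp [Fin.forall_fin_succ, symbolDegree]) (by simp [Fin.forall_fin_succ, symbolDegree])
    (by simp [symbolBracket])
  have hb := derivation_coord hD 1 2 (by norm_num) (by norm_num) ![1, 0, 0, 0, 0, 0, 0, 0]
    ![0, 1, 0, 0, 0, 0, 0, 0] ![0, 0, 0, 0, 0, 0, 0, 0]
    (by simp [Fin.forall_fin_succ, symbolDegree]) (by simp [Fin.forall_fin_succ, symbolDegree])
    (by simp [symbolBracket])
  have hc := derivation_coord hD 1 2 (by norm_num) (by norm_num) ![1, 0, 0, 0, 0, 0, 0, 0]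
    ![0, 0, 1, 0, 0, 0, 0, 0] ![0, 0, 0, 0, 0, 0, 0, 0]
    (by simp [Fin.forall_fin_succ, symbolDegree]) (by simp [Fin.forall_fin_succ, symbolDegree])
    (by simp [symbolBracket])
  have he := derivation_coord hD 1 3 (by norm_num) (by norm_num) ![0, 0, 0, 1, 0, 0, 0, 0]
    ![0, 0, 0, 0, 0, 2, 0, 0] ![0, 0, 0, 0, 0, 0, 0, 0]
    (by simp [Fin.forall_fin_succ, symbolDegree]) (by simp [Fin.forall_fin_succ, symbolDegree])
    (by simp [symbolBracket])
  have hf := derivation_coord hD 1 3 (by norm_num) (by norm_num) ![0, 0, 0, 1, 0, 0, 0, 0]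
    ![0, 0, 0, 0, 0, 0, 1, 0] ![0, 0, 0, 0, 0, 0, 0, 0]
    (by simp [Fin.forall_fin_succ, symbolDegree]) (by simp [Fin.forall_fin_succ, symbolDegree])
    (by simp [symbolBracket])
  have hg := derivation_coord hD 1 3 (by norm_num) (by norm_num) ![0, 0, 0, 0, 1, 0, 0, 0]
    ![0, 0, 0, 0, 0, 2, 0, 0] ![0, 0, 0, 0, 0, 0, 0, 0]
    (by simp [Fin.forall_fin_succ, symbolDegree]) (by simp [Fin.forall_fin_succ, symbolDegree])
    (by simp [symbolBracket])
  have hh := derivation_coord hD 1 3 (by norm_num) (by norm_num) ![0, 0, 0, 1, 0, 0, 0, 0]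
    ![0, 0, 0, 0, 0, 0, 0, 2] ![0, 0, 0, 0, 0, 0, 0, 0]
    (by simp [Fin.forall_fin_succ, symbolDegree]) (by simp [Fin.forall_fin_succ, symbolDegree])
    (by simp [symbolBracket])
  rw [← hp, ← hq] at hX1
  rw [← hp, ← hr] at hX2
  rw [← hq, hX1] at hZ11
  rw [← hq, hX2] at hZ12
  rw [← hr, hX2] at hZ22
  rw [hzero, ← hq, ← hr] at ha
  rw [hzero, ← hp, hX1] at hb
  rw [hzero, ← hp, hX2] at hc
  rw [hzero, ← hq, hZ11] at he
  rw [hzero, ← hq, hZ12] at hf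
  rw [hzero, ← hr, hZ11] at hg
  rw [hzero, ← hq, hZ22] at hh
  clear_value p q r
  clear hX1 hX2 hZ11 hZ12 hZ22 hzero hlow hlow' hbr hdeg hD
  have a1 := congrFun ha 1
  have a4 := congrFun ha 4
  have a19 := congrFun ha 19
  have a7 := congrFun ha 7
  have a0 := congrFun ha 0
  have a3 := congrFun ha 3
  have a14 := congrFun ha 14
  have a17 := congrFun ha 17
  clear ha
  simp [lieSymbol_apply, p15, p16, p17, p18, p19, q15, q16, q17, q18, q19, r15, r16, r17, r18, r19] at a1 a4 a19 a7 a0 a3 a14 a17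
  have b17 := congrFun hb 17
  have b19 := congrFun hb 19
  have b15 := congrFun hb 15
  have b16 := congrFun hb 16
  have b2 := congrFun hb 2
  have b5 := congrFun hb 5
  have b0 := congrFun hb 0
  have b3 := congrFun hb 3
  have b6 := congrFun hb 6
  have b20 := congrFun hb 20
  clear hb
  simp [lieSymbol_apply, p15, p16, p17, p18, p19, q15, q16, q17, q18, q19, r15, r16, r17, r18, r19] at b17 b19 b15 b16 b2 b5 b0 b3 b6 b20
  have c17 := congrFun hc 17
  have c19 := congrFun hc 19
  have c5 := congrFun hc 5
  have c20 := congrFun hc 20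
  clear hc
  simp [lieSymbol_apply, p15, p16, p17, p18, p19, q15, q16, q17, q18, q19, r15, r16, r17, r18, r19] at c17 c19 c5 c20
  have e16 := congrFun he 16
  have e15 := congrFun he 15
  have e0 := congrFun he 0
  have e3 := congrFun he 3
  clear he
  simp [lieSymbol_apply, p15, p16, p17, p18, p19, q15, q16, q17, q18, q19, r15, r16, r17, r18, r19] at e16 e15 e0 e3
  have f3 := congrFun hf 3
  have f15 := congrFun hf 15
  clear hf
  simp [lieSymbol_apply, p15, p16, p17, p18, p19, q15, q16, q17, q18, q19, r15, r16, r17, r18, r19] at f3 f15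
  have g15 := congrFun hg 15
  have g0 := congrFun hg 0
  have g3 := congrFun hg 3
  clear hg
  simp [lieSymbol_apply, p15, p16, p17, p18, p19, q15, q16, q17, q18, q19, r15, r16, r17, r18, r19] at g15 g0 g3
  have h18 := congrFun hh 18
  have h15 := congrFun hh 15
  have h16 := congrFun hh 16
  have h3 := congrFun hh 3
  clear hh
  simp [lieSymbol_apply, p15, p16, p17, p18, p19, q15, q16, q17, q18, q19, r15, r16, r17, r18, r19] at h18 h15 h16 h3
  refine ⟨![q 6 - p 20 / 2, q 7, -q 0, r 6, r 7 - p 20 / 2, -q 3, 0, 0, -p 20 / 2,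
    q 11, q 13, p 2, r 13, p 5, p 8, 0, 0, 0, 0, 0, 0], ?_, ?_, ?_⟩
  all_goals
    refine funext_fin21 ?_
    simp [lieSymbol_apply, p15, p16, p17, p18, p19, q15, q16, q17, q18, q19, r15, r16, r17, r18, r19]
    and_intros <;> linarith

theorem mongeProj_lie {n k : ℤ} (a : LieSp3) {x : LieSp3} (hx : x ∈ mongeGrading k) :
    mongeProj (n + k) ⁅a, x⁆ = ⁅mongeProj n a, x⁆ := by
  have h : ∀ l, mongeProj (n + k) ⁅mongeProj l a, x⁆ = if l = n then ⁅mongeProj n a, x⁆ else 0 := by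
    intro l
    have hl := isLieGrading_mongeGrading.lie_mem l k _ (mongeProj_mem l a) x hx
    split_ifs with h
    · subst h
      exact mongeProj_self hl
    · exact mongeProj_ne (by omega) hl
  conv_lhs => rw [← sum_mongeProj a, sum_lie, map_sum]
  simp only [h, Finset.sum_ite_eq']
  split_ifs with hn
  · rfl
  · rw [Finset.mem_Icc] at hn
    have := mongeProj_mem n a
    rw [mongeGrading_eq_bot (by omega), Submodule.mem_bot] at this
    rw [this, zero_lie]

theorem LieSp3.lie_symbolElt_eq {a X : LieSp3} {c : Fin 8 → ℝ}
    (h : spCoord X = lieSymbol (spCoord a) c) : X = ⁅a, mongeSymbol.incl (symbolElt c)⁆ := by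
  apply Subtype.ext
  rw [X.eq_spMatrix, h, ← spMatrix_lie_symbolMatrix, ← LieSp3.eq_spMatrix]
  rfl

/-- The derivations of nonnegative degree from the negative part to `𝔰𝔭(3, ℝ)` are inner. -/
theorem innerDerivationsOfDegree_mongeGrading (hn : 0 ≤ n) :
    InnerDerivationsOfDegree mongeSymbolGrading mongeGrading mongeSymbol.incl n := by
  intro D hdeg hD
  obtain ⟨a, hT, hY1, hY2⟩ := derivation_eq_inner_of_generators hdeg hn hD
  set a' : LieSp3 := ⟨spMatrix a, spMatrix_mem_sp a⟩ with ha'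
  have hcoord : spCoord (a' : Mat6) = a := spCoord_spMatrix a
  rw [← hcoord] at hT hY1 hY2
  replace hT := LieSp3.lie_symbolElt_eq hT
  replace hY1 := LieSp3.lie_symbolElt_eq hY1
  replace hY2 := LieSp3.lie_symbolElt_eq hY2
  have hbr : ∀ (k l : ℕ), 1 ≤ k → 1 ≤ l → ∀ c d e : Fin 8 → ℝ,
      (∀ i, symbolDegree i ≠ k → c i = 0) → (∀ i, symbolDegree i ≠ l → d i = 0) →
      symbolBracket c d = e →
      D (symbolElt c) = ⁅a', mongeSymbol.incl (symbolElt c)⁆ →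
      D (symbolElt d) = ⁅a', mongeSymbol.incl (symbolElt d)⁆ →
      D (symbolElt e) = ⁅a', mongeSymbol.incl (symbolElt e)⁆ := by
    intro k l hk hl c d e hc hd he h1 h2
    rw [← he, ← symbolElt_lie, hD _ _ _ ((symbolElt_mem_iff hk c).mpr hc) _
      ((symbolElt_mem_iff hl d).mpr hd), h1, h2, LieHom.map_lie, leibniz_lie a']
  have hX1 := hbr 1 1 (by norm_num) (by norm_num) ![0, 0, 0, 1, 0, 0, 0, 0]
    ![1, 0, 0, 0, 0, 0, 0, 0] ![0, 1, 0, 0, 0, 0, 0, 0]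
    (by simp [Fin.forall_fin_succ, symbolDegree]) (by simp [Fin.forall_fin_succ, symbolDegree])
    (by simp [symbolBracket]) hY1 hT
  have hX2 := hbr 1 1 (by norm_num) (by norm_num) ![0, 0, 0, 0, 1, 0, 0, 0]
    ![1, 0, 0, 0, 0, 0, 0, 0] ![0, 0, 1, 0, 0, 0, 0, 0]
    (by simp [Fin.forall_fin_succ, symbolDegree]) (by simp [Fin.forall_fin_succ, symbolDegree])
    (by simp [symbolBracket]) hY2 hT
  have hZ11 := hbr 1 2 (by norm_num) (by norm_num) ![0, 0, 0, 1, 0, 0, 0, 0]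
    ![0, 1, 0, 0, 0, 0, 0, 0] ![0, 0, 0, 0, 0, 2, 0, 0]
    (by simp [Fin.forall_fin_succ, symbolDegree]) (by simp [Fin.forall_fin_succ, symbolDegree])
    (by simp [symbolBracket]) hY1 hX1
  have hZ12 := hbr 1 2 (by norm_num) (by norm_num) ![0, 0, 0, 1, 0, 0, 0, 0]
    ![0, 0, 1, 0, 0, 0, 0, 0] ![0, 0, 0, 0, 0, 0, 1, 0]
    (by simp [Fin.forall_fin_succ, symbolDegree]) (by simp [Fin.forall_fin_succ, symbolDegree])
    (by simp [symbolBracket]) hY1 hX2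
  have hZ22 := hbr 1 2 (by norm_num) (by norm_num) ![0, 0, 0, 0, 1, 0, 0, 0]
    ![0, 0, 1, 0, 0, 0, 0, 0] ![0, 0, 0, 0, 0, 0, 0, 2]
    (by simp [Fin.forall_fin_succ, symbolDegree]) (by simp [Fin.forall_fin_succ, symbolDegree])
    (by simp [symbolBracket]) hY2 hX2
  have hall : D = (LieAlgebra.ad ℝ LieSp3 a' : LieSp3 →ₗ[ℝ] LieSp3) ∘ₗ
      (mongeSymbol.incl : mongeSymbol →ₗ[ℝ] LieSp3) :=
    mongeSymbol_linearMap_ext ⟨hT, hX1, hX2, hY1, hY2, hZ11, hZ12, hZ22⟩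
  refine ⟨mongeProj n a', mongeProj_mem n a', fun x => ?_⟩
  have hproj : D = (LieAlgebra.ad ℝ LieSp3 (mongeProj n a') : LieSp3 →ₗ[ℝ] LieSp3) ∘ₗ
      (mongeSymbol.incl : mongeSymbol →ₗ[ℝ] LieSp3) := by
    refine isLieGrading_mongeSymbolGrading.isInternal.linearMap_ext fun k x hx => ?_
    rcases lt_or_ge k 0 with hk | hk
    · have h1 := hdeg k x hx
      have h2 : mongeProj (n + k) (D x) = D x := mongeProj_self h1
      rw [← h2, hall]
      exact mongeProj_lie a' ((mem_mongeSymbolGrading hk).mp hx)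
    · rw [mongeSymbolGrading_of_nonneg hk, Submodule.mem_bot] at hx
      simp [hx]
  exact LinearMap.congr_fun hproj x

end Derivations

theorem isTransitiveExtension_mongeGrading :
    IsTransitiveExtension mongeSymbolGrading mongeGrading mongeSymbol.incl where
  grading := isLieGrading_mongeGrading
  injective := Subtype.val_injective
  map_neg k hk := by
    ext X
    constructor
    · rintro ⟨x, hx, rfl⟩
      exact (mem_mongeSymbolGrading hk).mp hx
    · intro hX
      exact ⟨⟨X, mongeGrading_le_mongeSymbol hk hX⟩, (mem_mongeSymbolGrading hk).mpr hX, rfl⟩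
  transitive k hk a ha h := by
    have hlow : ∀ i j, mongeWeight i - mongeWeight j < 0 → (a : Mat6) i j = 0 :=
      fun i j hij => ha i j (by omega)
    have key : ∀ c : Fin 8 → ℝ, lieSymbol (spCoord a) c = 0 := by
      intro c
      apply spMatrix_eq_zero
      rw [← spMatrix_lie_symbolMatrix, ← LieSp3.eq_spMatrix]
      exact congrArg Subtype.val (h (symbolElt c))
    have h0 : spCoord (a : Mat6) 6 = 0 ∧ spCoord (a : Mat6) 7 = 0 ∧ spCoord (a : Mat6) 15 = 0 ∧
        spCoord (a : Mat6) 16 = 0 ∧ spCoord (a : Mat6) 17 = 0 ∧ spCoord (a : Mat6) 18 = 0 ∧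
        spCoord (a : Mat6) 19 = 0 ∧ spCoord (a : Mat6) 20 = 0 := by
      refine ⟨?_, ?_, ?_, ?_, ?_, ?_, ?_, ?_⟩ <;> exact hlow _ _ (by decide)
    have hT := key ![1, 0, 0, 0, 0, 0, 0, 0]
    have hY1 := key ![0, 0, 0, 1, 0, 0, 0, 0]
    have hY2 := key ![0, 0, 0, 0, 1, 0, 0, 0]
    have ha0 : spCoord (a : Mat6) = 0 := by
      generalize spCoord (a : Mat6) = p at h0 hT hY1 hY2
      have t2 := congrFun hT 2
      have t5 := congrFun hT 5
      have t8 := congrFun hT 8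
      have t20 := congrFun hT 20
      have y0 := congrFun hY1 0
      have y3 := congrFun hY1 3
      have y6 := congrFun hY1 6
      have y7 := congrFun hY1 7
      have y11 := congrFun hY1 11
      have y13 := congrFun hY1 13
      have z6 := congrFun hY2 6
      have z7 := congrFun hY2 7
      have z13 := congrFun hY2 13
      simp [lieSymbol_apply] at t2 t5 t8 t20 y0 y3 y6 y7 y11 y13 z6 z7 z13
      refine funext_fin21 ?_
      simp only [Pi.zero_apply]
      obtain ⟨h6, h7, h15, h16, h17, h18, h19, h20⟩ := h0
      and_intros <;> linarith
    apply Subtype.ext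
    rw [LieSp3.eq_spMatrix a, ha0]
    rw [← Matrix.ext_iff]
    simp [Fin.forall_fin_succ, spMatrix]

/-- The Tanaka prolongation of the negative part of the Monge gradation is `𝔰𝔭(3, ℝ)`. -/
theorem isTanakaProlongation_mongeGrading :
    IsTanakaProlongation mongeSymbolGrading mongeGrading mongeSymbol.incl :=
  isTransitiveExtension_mongeGrading.isTanakaProlongation isLieGrading_mongeSymbolGrading
    (fun _ hk => mongeSymbolGrading_of_nonneg hk) 4
    (fun _ hk => mongeGrading_eq_bot (by push_cast at hk; omega))
    fun _ hn => innerDerivationsOfDegree_mongeGrading hn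

/-! ### Simplicity of `𝔰𝔭(3, ℝ)` -/

theorem mem_sp_iff_transpose_mul {X : Mat6} : X ∈ LieAlgebra.Symplectic.sp (Fin 3) ℝ ↔
    Xᵀ * Matrix.J (Fin 3) ℝ = -(Matrix.J (Fin 3) ℝ * X) := by
  rw [LieAlgebra.Symplectic.sp, mem_skewAdjointMatricesLieSubalgebra,
    mem_skewAdjointMatricesSubmodule, Matrix.IsSkewAdjoint, Matrix.IsAdjointPair, Matrix.mul_neg]

theorem vecMul_J (u : Fin 3 ⊕ Fin 3 → ℝ) :
    u ᵥ* Matrix.J (Fin 3) ℝ = -(Matrix.J (Fin 3) ℝ *ᵥ u) := by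
  rw [← Matrix.mulVec_transpose, Matrix.J_transpose, Matrix.neg_mulVec]

/-- The element `u vᵀ J + v uᵀ J` of `𝔰𝔭(3, ℝ)`. -/
def symElt (u v : Fin 3 ⊕ Fin 3 → ℝ) : LieSp3 :=
  ⟨Matrix.vecMulVec u (v ᵥ* Matrix.J (Fin 3) ℝ) + Matrix.vecMulVec v (u ᵥ* Matrix.J (Fin 3) ℝ), by
    rw [mem_sp_iff_transpose_mul, Matrix.transpose_add, Matrix.transpose_vecMulVec,
      Matrix.transpose_vecMulVec, add_mul, mul_add, Matrix.vecMulVec_mul, Matrix.vecMulVec_mul,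
      Matrix.mul_vecMulVec, Matrix.mul_vecMulVec, vecMul_J u, vecMul_J v, Matrix.neg_vecMulVec,
      Matrix.neg_vecMulVec, add_comm (Matrix.vecMulVec _ _), neg_add]⟩

theorem coe_symElt (u v : Fin 3 ⊕ Fin 3 → ℝ) : (symElt u v : Mat6) =
    Matrix.vecMulVec u (v ᵥ* Matrix.J (Fin 3) ℝ) + Matrix.vecMulVec v (u ᵥ* Matrix.J (Fin 3) ℝ) :=
  rfl

/-- The standard symplectic form on `ℝ⁶`. -/
def sympForm (u v : Fin 3 ⊕ Fin 3 → ℝ) : ℝ := (u ᵥ* Matrix.J (Fin 3) ℝ) ⬝ᵥ v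

theorem sympForm_self (u : Fin 3 ⊕ Fin 3 → ℝ) : sympForm u u = 0 := by
  have h : sympForm u u = -sympForm u u := by
    conv_lhs => rw [sympForm, vecMul_J, neg_dotProduct, dotProduct_comm, Matrix.dotProduct_mulVec]
    rfl
  linarith

theorem symElt_mulVec (u v w : Fin 3 ⊕ Fin 3 → ℝ) :
    (symElt u v : Mat6) *ᵥ w = sympForm v w • u + sympForm u w • v := by
  rw [coe_symElt, Matrix.add_mulVec, Matrix.vecMulVec_mulVec, Matrix.vecMulVec_mulVec]
  simp [sympForm]

theorem lie_symElt (X : LieSp3) (u v : Fin 3 ⊕ Fin 3 → ℝ) :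
    ⁅X, symElt u v⁆ = symElt ((X : Mat6) *ᵥ u) v + symElt u ((X : Mat6) *ᵥ v) := by
  have h : ∀ w : Fin 3 ⊕ Fin 3 → ℝ,
      (w ᵥ* Matrix.J (Fin 3) ℝ) ᵥ* (X : Mat6) = -(((X : Mat6) *ᵥ w) ᵥ* Matrix.J (Fin 3) ℝ) := by
    intro w
    have hX : Matrix.J (Fin 3) ℝ * (X : Mat6) = -((X : Mat6)ᵀ * Matrix.J (Fin 3) ℝ) := by
      rw [mem_sp_iff_transpose_mul.mp X.2, neg_neg]
    rw [Matrix.vecMul_vecMul, hX, Matrix.vecMul_neg, ← Matrix.vecMul_vecMul,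
      Matrix.vecMul_transpose]
  apply Subtype.ext
  rw [LieSp3.coe_lie, AddMemClass.coe_add, coe_symElt, coe_symElt, coe_symElt, mul_add, add_mul,
    Matrix.mul_vecMulVec, Matrix.mul_vecMulVec, Matrix.vecMulVec_mul, Matrix.vecMulVec_mul, h, h,
    Matrix.vecMulVec_neg, Matrix.vecMulVec_neg]
  abel

theorem symElt_comm (u v : Fin 3 ⊕ Fin 3 → ℝ) : symElt u v = symElt v u :=
  Subtype.ext (add_comm _ _)

theorem symElt_add_left (u v w : Fin 3 ⊕ Fin 3 → ℝ) :
    symElt (u + v) w = symElt u w + symElt v w := by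
  apply Subtype.ext
  rw [AddMemClass.coe_add, coe_symElt, coe_symElt, coe_symElt, Matrix.add_vecMulVec,
    Matrix.add_vecMul, Matrix.vecMulVec_add]
  abel

theorem symElt_smul_left (r : ℝ) (u w : Fin 3 ⊕ Fin 3 → ℝ) :
    symElt (r • u) w = r • symElt u w := by
  apply Subtype.ext
  rw [SetLike.val_smul, coe_symElt, coe_symElt, Matrix.smul_vecMulVec,
    Matrix.smul_vecMul, Matrix.vecMulVec_smul, smul_add]

theorem symElt_add_right (u v w : Fin 3 ⊕ Fin 3 → ℝ) :
    symElt w (u + v) = symElt w u + symElt w v := by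
  rw [symElt_comm, symElt_add_left, symElt_comm u, symElt_comm v]

theorem symElt_smul_right (r : ℝ) (u w : Fin 3 ⊕ Fin 3 → ℝ) :
    symElt w (r • u) = r • symElt w u := by
  rw [symElt_comm, symElt_smul_left, symElt_comm u]

theorem symElt_zero_left (w : Fin 3 ⊕ Fin 3 → ℝ) : symElt 0 w = 0 := by
  rw [← zero_smul ℝ (0 : Fin 3 ⊕ Fin 3 → ℝ), symElt_smul_left, zero_smul]

/-- The elements `u vᵀ J + v uᵀ J` span `𝔰𝔭(3, ℝ)`. -/
theorem LieSp3.eq_sum_symElt (X : LieSp3) : X = (-(1 / 2 : ℝ)) • ∑ i, ∑ j,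
    ((X : Mat6) * Matrix.J (Fin 3) ℝ) i j • symElt (Pi.single i 1) (Pi.single j 1) := by
  have hsymm : ∀ i j, ((X : Mat6) * Matrix.J (Fin 3) ℝ) i j =
      ((X : Mat6) * Matrix.J (Fin 3) ℝ) j i := by
    have h1 := mem_sp_iff_transpose_mul.mp X.2
    have h2 : ((X : Mat6) * Matrix.J (Fin 3) ℝ)ᵀ = (X : Mat6) * Matrix.J (Fin 3) ℝ := by
      have h3 := congrArg (fun M => Matrix.J (Fin 3) ℝ * M * Matrix.J (Fin 3) ℝ) h1
      simp only [Matrix.mul_assoc, Matrix.J_squared, Matrix.mul_neg, Matrix.neg_mul,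
        Matrix.mul_one] at h3
      rw [← Matrix.mul_assoc (Matrix.J (Fin 3) ℝ) (Matrix.J (Fin 3) ℝ), Matrix.J_squared,
        Matrix.neg_mul, Matrix.one_mul, neg_neg] at h3
      rw [Matrix.transpose_mul, Matrix.J_transpose, Matrix.neg_mul, h3]
    intro i j
    conv_lhs => rw [← h2]
    rfl
  have hX : (X : Mat6) = -(((X : Mat6) * Matrix.J (Fin 3) ℝ) * Matrix.J (Fin 3) ℝ) := by
    rw [Matrix.mul_assoc, Matrix.J_squared, Matrix.mul_neg, Matrix.mul_one, neg_neg]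
  set S := (X : Mat6) * Matrix.J (Fin 3) ℝ with hS
  have key : ∀ T : Mat6, (∀ i j, T i j = T j i) →
      (∑ i, ∑ j, T i j • (symElt (Pi.single i 1) (Pi.single j 1) : Mat6)) =
        (2 : ℝ) • (T * Matrix.J (Fin 3) ℝ) := by
    intro T hT
    have h1 : ∀ i j : Fin 3 ⊕ Fin 3, (symElt (Pi.single i 1) (Pi.single j 1) : Mat6) =
        (Matrix.single i j 1 + Matrix.single j i 1) * Matrix.J (Fin 3) ℝ := by
      intro i j
      rw [coe_symElt, ← Matrix.vecMulVec_mul, ← Matrix.vecMulVec_mul, ← add_mul,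
        ← Matrix.single_eq_single_vecMulVec_single, ← Matrix.single_eq_single_vecMulVec_single]
    simp only [h1, ← smul_mul_assoc, smul_add, ← Finset.sum_mul, Finset.sum_add_distrib]
    rw [two_smul]
    congr 2
    · conv_rhs => rw [Matrix.matrix_eq_sum_single T]
      simp [Matrix.smul_single]
    · conv_rhs => rw [Matrix.matrix_eq_sum_single T]
      rw [Finset.sum_comm]
      simp [Matrix.smul_single, hT]
  apply Subtype.ext
  rw [SetLike.val_smul, AddSubmonoidClass.coe_finsetSum]
  simp only [AddSubmonoidClass.coe_finsetSum, SetLike.val_smul]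
  rw [key S hsymm, smul_smul]
  conv_lhs => rw [hX]
  norm_num

theorem LieSp3.ideal_eq_top {I : LieIdeal ℝ LieSp3} {u : Fin 3 ⊕ Fin 3 → ℝ} (hu : u ≠ 0)
    (hI : symElt u u ∈ I) : I = ⊤ := by
  have h1 : ∀ v, sympForm v u ≠ 0 → symElt v v ∈ I := by
    intro v hv
    have h2 : symElt v u ∈ I := by
      have h := lie_mem_right ℝ LieSp3 I (symElt v v) _ hI
      rw [lie_symElt, symElt_mulVec, symElt_comm u, ← add_smul, symElt_smul_left, ← add_smul] at h
      exact (I.toSubmodule.smul_mem_iff (by intro h0; apply hv; linarith)).mp h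
    have h := lie_mem_right ℝ LieSp3 I (symElt v v) _ h2
    rw [lie_symElt, symElt_mulVec, symElt_mulVec, sympForm_self, zero_smul, zero_add,
      symElt_zero_left, zero_add, ← add_smul, symElt_smul_right] at h
    exact (I.toSubmodule.smul_mem_iff (by intro h0; apply hv; linarith)).mp h
  obtain ⟨w, hw⟩ : ∃ w, sympForm w u ≠ 0 := by
    refine ⟨Matrix.J (Fin 3) ℝ *ᵥ u, fun h => hu ?_⟩
    rw [sympForm, vecMul_J, Matrix.mulVec_mulVec, Matrix.J_squared, Matrix.neg_mulVec,
      Matrix.one_mulVec, neg_neg] at h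
    exact dotProduct_self_eq_zero.mp h
  have hadd : ∀ v w : Fin 3 ⊕ Fin 3 → ℝ, sympForm (v + w) u = sympForm v u + sympForm w u := by
    intro v w
    rw [sympForm, Matrix.add_vecMul, add_dotProduct]
    rfl
  have h2 : ∀ v, symElt v v ∈ I := by
    intro v
    by_cases hv : sympForm v u = 0
    · have e1 := h1 (v + w) (by rw [hadd, hv, zero_add]; exact hw)
      have e2 := h1 (v + (-1 : ℝ) • w) (by
        rw [hadd, hv, zero_add, sympForm, Matrix.smul_vecMul, smul_dotProduct]
        exact smul_ne_zero (by norm_num) hw)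
      have e3 := h1 w hw
      have e4 : (2 : ℝ) • symElt v v ∈ I := by
        have : (2 : ℝ) • symElt v v = symElt (v + w) (v + w) +
            symElt (v + (-1 : ℝ) • w) (v + (-1 : ℝ) • w) - (2 : ℝ) • symElt w w := by
          simp only [symElt_add_left, symElt_add_right, symElt_smul_left, symElt_smul_right]
          module
        rw [this]
        exact I.sub_mem (I.add_mem e1 e2) (I.smul_mem _ e3)
      exact (I.toSubmodule.smul_mem_iff (by norm_num)).mp e4
    · exact h1 v hv
  have h3 : ∀ v w, symElt v w ∈ I := by
    intro v w
    have : symElt v w = (1 / 2 : ℝ) • (symElt (v + w) (v + w) - symElt v v - symElt w w) := by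
      simp only [symElt_add_left, symElt_add_right, symElt_comm w v]
      module
    rw [this]
    exact I.smul_mem _ (I.sub_mem (I.sub_mem (h2 _) (h2 _)) (h2 _))
  rw [eq_top_iff]
  intro X _
  rw [LieSp3.eq_sum_symElt X]
  exact I.smul_mem _ (I.toSubmodule.sum_mem fun i _ => I.toSubmodule.sum_mem fun j _ =>
    I.smul_mem _ (h3 _ _))

instance LieSp3.isSimple : LieAlgebra.IsSimple ℝ LieSp3 where
  non_abelian h := by
    have h1 := h.trivial (symElt (Pi.single (.inl 0) 1) (Pi.single (.inl 0) 1))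
      (symElt (Pi.single (.inr 0) 1) (Pi.single (.inr 0) 1))
    have h2 := congrFun (congrFun (congrArg (fun X : LieSp3 => (X : Mat6)) h1) (.inl 0)) (.inl 0)
    rw [lie_symElt, symElt_mulVec] at h2
    simp [coe_symElt, Matrix.vecMulVec, sympForm, Matrix.J, Matrix.vecMul, dotProduct,
      Matrix.one_apply, Pi.single_apply, Fin.sum_univ_three] at h2
  eq_bot_or_eq_top I := by
    by_cases hI : I = ⊥
    · exact Or.inl hI
    right
    obtain ⟨X, hXI, hX⟩ := (Submodule.ne_bot_iff I.toSubmodule).mp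
      fun h => hI (LieSubmodule.toSubmodule_eq_bot I |>.mp h)
    have hex : ∃ u, sympForm ((X : Mat6) *ᵥ u) u ≠ 0 := by
      by_contra! hcon
      apply hX
      have hform : ∀ u v, sympForm ((X : Mat6) *ᵥ u) v = sympForm ((X : Mat6) *ᵥ v) u := by
        intro u v
        have hJ := mem_sp_iff_transpose_mul.mp X.2
        rw [sympForm, ← Matrix.vecMul_transpose, Matrix.vecMul_vecMul, hJ,
          Matrix.vecMul_neg, ← Matrix.vecMul_vecMul, neg_dotProduct, ← Matrix.dotProduct_mulVec,
          vecMul_J, neg_dotProduct, neg_neg, dotProduct_comm, Matrix.dotProduct_mulVec]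
        rfl
      have hzero : ∀ u v, sympForm ((X : Mat6) *ᵥ u) v = 0 := by
        intro u v
        have h := hcon (u + v)
        simp only [sympForm, Matrix.mulVec_add, Matrix.add_vecMul, add_dotProduct,
          dotProduct_add] at h
        have h1 := hcon u
        have h2 := hcon v
        have h3 := hform u v
        simp only [sympForm] at h1 h2 h3 ⊢
        linarith
      have hXu : ∀ u, (X : Mat6) *ᵥ u = 0 := by
        intro u
        have h := hzero u (((X : Mat6) *ᵥ u) ᵥ* Matrix.J (Fin 3) ℝ)
        rw [sympForm, dotProduct_self_eq_zero, vecMul_J, neg_eq_zero] at h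
        have h' := congrArg (fun v => Matrix.J (Fin 3) ℝ *ᵥ v) h
        simp only [Matrix.mulVec_mulVec, ← Matrix.mul_assoc, Matrix.J_squared, Matrix.neg_mul,
          Matrix.one_mul, Matrix.neg_mulVec, Matrix.mulVec_zero, neg_eq_zero] at h'
        exact h'
      apply Subtype.ext
      exact Matrix.ext_of_mulVec_single fun i => by rw [hXu]; exact (Matrix.zero_mulVec _).symm
    obtain ⟨u, hu⟩ := hex
    have hu0 : u ≠ 0 := by
      rintro rfl
      apply hu
      simp [sympForm]
    refine LieSp3.ideal_eq_top hu0 ?_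
    have h1 : symElt ((X : Mat6) *ᵥ u) u ∈ I := by
      have h := lie_mem_left ℝ LieSp3 I X (symElt u u) hXI
      rw [lie_symElt, symElt_comm u, ← two_smul ℝ] at h
      exact (I.toSubmodule.smul_mem_iff (by norm_num)).mp h
    have h2 := lie_mem_left ℝ LieSp3 I _ (symElt u u) h1
    rw [lie_symElt, symElt_mulVec, sympForm_self, zero_smul, zero_add, symElt_comm u, ← two_smul ℝ,
      symElt_smul_left, smul_smul] at h2
    exact (I.toSubmodule.smul_mem_iff (mul_ne_zero two_ne_zero hu)).mp h2

/-! ### Vector fields in charts -/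

section ChartFields

open VectorField

variable {E : Type*} [NormedAddCommGroup E] [NormedSpace ℝ E]
  {M : Type*} [TopologicalSpace M] [ChartedSpace E M] {e : OpenPartialHomeomorph M E}

theorem mdifferentiable_of_mem_maximalAtlas (he : e ∈ IsManifold.maximalAtlas 𝓘(ℝ, E) ∞ M) :
    e.MDifferentiable 𝓘(ℝ, E) 𝓘(ℝ, E) :=
  ⟨(contMDiffOn_of_mem_maximalAtlas he).mdifferentiableOn (by simp),
    (contMDiffOn_symm_of_mem_maximalAtlas he).mdifferentiableOn (by simp)⟩

theorem coe_chart_mfderiv (he : e.MDifferentiable 𝓘(ℝ, E) 𝓘(ℝ, E)) {x : M} (hx : x ∈ e.source) :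
    (he.mfderiv hx : TangentSpace 𝓘(ℝ, E) x →L[ℝ] TangentSpace 𝓘(ℝ, E) (e x)) =
      mfderiv 𝓘(ℝ, E) 𝓘(ℝ, E) e x := rfl

theorem isInvertible_mfderiv_chart (he : e.MDifferentiable 𝓘(ℝ, E) 𝓘(ℝ, E)) {x : M}
    (hx : x ∈ e.source) : (mfderiv 𝓘(ℝ, E) 𝓘(ℝ, E) e x).IsInvertible := by
  rw [← coe_chart_mfderiv he hx]
  exact ContinuousLinearMap.isInvertible_equiv

theorem isInvertible_mfderiv_chart_symm (he : e.MDifferentiable 𝓘(ℝ, E) 𝓘(ℝ, E)) {a : E}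
    (ha : a ∈ e.target) : (mfderiv 𝓘(ℝ, E) 𝓘(ℝ, E) e.symm a).IsInvertible :=
  ⟨he.symm.mfderiv (x := a) ha, rfl⟩

/-- The expression of a vector field in a chart. -/
theorem mpullback_chart_symm (he : e.MDifferentiable 𝓘(ℝ, E) 𝓘(ℝ, E)) {a : E} (ha : a ∈ e.target)
    (X : ∀ x : M, TangentSpace 𝓘(ℝ, E) x) :
    mpullback 𝓘(ℝ, E) 𝓘(ℝ, E) e.symm X a = mfderiv 𝓘(ℝ, E) 𝓘(ℝ, E) e (e.symm a) (X (e.symm a)) := by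
  rw [mpullback_apply]
  obtain ⟨f, hf⟩ := isInvertible_mfderiv_chart_symm he ha
  rw [← hf, ContinuousLinearMap.inverse_equiv]
  have h := he.comp_symm_deriv ha
  rw [← hf] at h
  have h' := congrArg (fun l => l (f.symm (X (e.symm a)))) h
  simp only [ContinuousLinearMap.comp_apply, ContinuousLinearEquiv.coe_coe,
    ContinuousLinearEquiv.apply_symm_apply, ContinuousLinearMap.id_apply] at h'
  exact h'.symm

theorem mfderiv_mpullback_chart (he : e.MDifferentiable 𝓘(ℝ, E) 𝓘(ℝ, E)) {x : M}
    (hx : x ∈ e.source) (v : E → E) :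
    mfderiv 𝓘(ℝ, E) 𝓘(ℝ, E) e x (mpullback 𝓘(ℝ, E) 𝓘(ℝ, E) e v x) = v (e x) := by
  rw [← coe_chart_mfderiv he hx]
  refine (congrArg (fun l : TangentSpace 𝓘(ℝ, E) (e x) →L[ℝ] TangentSpace 𝓘(ℝ, E) x =>
    he.mfderiv hx (l (v (e x)))) (ContinuousLinearMap.inverse_equiv (he.mfderiv hx))).trans ?_
  exact (he.mfderiv hx).apply_symm_apply _

variable [CompleteSpace E] [IsManifold 𝓘(ℝ, E) ∞ M]

theorem contDiffAt_mpullback_chart_symm (he : e ∈ IsManifold.maximalAtlas 𝓘(ℝ, E) ∞ M) {x : M}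
    (hx : x ∈ e.source) {X : ∀ x : M, TangentSpace 𝓘(ℝ, E) x}
    (hX : ContMDiffAt 𝓘(ℝ, E) 𝓘(ℝ, E).tangent ∞ (fun y => (⟨y, X y⟩ : TangentBundle 𝓘(ℝ, E) M)) x) :
    ContDiffAt ℝ ∞ (fun a => (mpullback 𝓘(ℝ, E) 𝓘(ℝ, E) e.symm X a : E)) (e x) := by
  have : IsManifold 𝓘(ℝ, E) 1 M := .of_le (n := ∞) (by simp)
  rw [← contMDiffAt_vectorSpace_iff_contDiffAt]
  refine ContMDiffAt.mpullback_vectorField_preimage (m := ∞) (n := ∞) ?_ ?_ ?_ le_rfl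
  · rw [e.left_inv hx]
    exact hX
  · exact contMDiffAt_symm_of_mem_maximalAtlas he (e.map_source hx)
  · exact isInvertible_mfderiv_chart_symm (mdifferentiable_of_mem_maximalAtlas he)
      (e.map_source hx)

theorem contMDiffOn_mpullback_chart (he : e ∈ IsManifold.maximalAtlas 𝓘(ℝ, E) ∞ M)
    {v : E → E} (hv : ContDiff ℝ ∞ v) :
    ContMDiffOn 𝓘(ℝ, E) 𝓘(ℝ, E).tangent ∞ (fun y =>
      (⟨y, mpullback 𝓘(ℝ, E) 𝓘(ℝ, E) e v y⟩ : TangentBundle 𝓘(ℝ, E) M)) e.source := by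
  have : IsManifold 𝓘(ℝ, E) 1 M := .of_le (n := ∞) (by simp)
  intro x hx
  refine (ContMDiffAt.mpullback_vectorField_preimage (m := ∞) (n := ∞) ?_ ?_ ?_ le_rfl).contMDiffWithinAt
  · exact contMDiffAt_vectorSpace_iff_contDiffAt.mpr hv.contDiffAt
  · exact contMDiffAt_of_mem_maximalAtlas he hx
  · exact isInvertible_mfderiv_chart (mdifferentiable_of_mem_maximalAtlas he) hx

/-- The Lie bracket of vector fields is computed in charts. -/
theorem mfderiv_mlieBracket_chart (he : e ∈ IsManifold.maximalAtlas 𝓘(ℝ, E) ∞ M) {x : M}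
    (hx : x ∈ e.source) {X Y : ∀ x : M, TangentSpace 𝓘(ℝ, E) x}
    (hX : ContMDiffAt 𝓘(ℝ, E) 𝓘(ℝ, E).tangent ∞ (fun y => (⟨y, X y⟩ : TangentBundle 𝓘(ℝ, E) M)) x)
    (hY : ContMDiffAt 𝓘(ℝ, E) 𝓘(ℝ, E).tangent ∞ (fun y => (⟨y, Y y⟩ : TangentBundle 𝓘(ℝ, E) M)) x) :
    mfderiv 𝓘(ℝ, E) 𝓘(ℝ, E) e x (mlieBracket 𝓘(ℝ, E) X Y x) =
      lieBracket ℝ (fun a => (mpullback 𝓘(ℝ, E) 𝓘(ℝ, E) e.symm X a : E))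
        (fun a => (mpullback 𝓘(ℝ, E) 𝓘(ℝ, E) e.symm Y a : E)) (e x) := by
  have h2 : minSmoothness ℝ 2 ≤ (∞ : ℕ∞ω) := by
    rw [minSmoothness_of_isRCLikeNormedField]
    exact ENat.LEInfty.out
  have : IsManifold 𝓘(ℝ, E) (minSmoothness ℝ 2) M := .of_le (n := ∞) h2
  have hd := mdifferentiable_of_mem_maximalAtlas he
  have hxt := e.map_source hx
  have h := mpullback_mlieBracket (I := 𝓘(ℝ, E)) (I' := 𝓘(ℝ, E)) (f := e.symm) (V := X) (W := Y)
    (x₀ := e x) (n := ∞) (by rw [e.left_inv hx]; exact hX.mdifferentiableAt (by simp))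
    (by rw [e.left_inv hx]; exact hY.mdifferentiableAt (by simp))
    (contMDiffAt_symm_of_mem_maximalAtlas he hxt) h2
  have hE : ∀ V W : E → E, mlieBracket 𝓘(ℝ, E) V W = lieBracket ℝ V W := fun V W => by
    rw [← lieBracketWithin_univ]
    exact mlieBracketWithin_eq_lieBracketWithin (s := univ)
  rw [mpullback_chart_symm hd hxt] at h
  refine Eq.trans ?_ (h.trans (congrFun (hE _ _) (e x)))
  rw [e.left_inv hx]

end ChartFields

/-! ### The flat Monge distribution -/

/-- The coframe `dt, dxᵢ - yᵢ dt, dyᵢ, dzᵢⱼ - yᵢ dxⱼ - yⱼ dxᵢ + yᵢyⱼ dt`. -/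
def flatCoframe (a v : EuclideanSpace ℝ (Fin 8)) : Fin 8 → ℝ :=
  ![v 0, v 1 - a 3 * v 0, v 2 - a 4 * v 0, v 3, v 4,
    v 5 - 2 * (a 3 * v 1) + a 3 * a 3 * v 0,
    v 6 - a 3 * v 2 - a 4 * v 1 + a 3 * a 4 * v 0,
    v 7 - 2 * (a 4 * v 2) + a 4 * a 4 * v 0]

/-- The vector with given components with respect to the flat coframe. -/
noncomputable def flatFrame (a : EuclideanSpace ℝ (Fin 8)) (c : Fin 8 → ℝ) :
    EuclideanSpace ℝ (Fin 8) :=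
  !₂[c 0, c 1 + a 3 * c 0, c 2 + a 4 * c 0, c 3, c 4,
    c 5 + 2 * (a 3 * c 1) + a 3 * a 3 * c 0,
    c 6 + a 3 * c 2 + a 4 * c 1 + a 3 * a 4 * c 0,
    c 7 + 2 * (a 4 * c 2) + a 4 * a 4 * c 0]

/-- The flat coframe at a point. -/
noncomputable def flatCoframeEquiv (a : EuclideanSpace ℝ (Fin 8)) :
    EuclideanSpace ℝ (Fin 8) ≃ₗ[ℝ] (Fin 8 → ℝ) where
  toFun := flatCoframe a
  invFun := flatFrame a
  map_add' v w := by
    ext i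
    fin_cases i <;> simp [flatCoframe] <;> ring
  map_smul' r v := by
    ext i
    fin_cases i <;> simp [flatCoframe] <;> ring
  left_inv v := by
    ext i
    fin_cases i <;> simp [flatCoframe, flatFrame] <;> ring
  right_inv c := by
    ext i
    fin_cases i <;> simp [flatCoframe, flatFrame] <;> ring

theorem flatCoframe_flatFrame (a : EuclideanSpace ℝ (Fin 8)) (c : Fin 8 → ℝ) :
    flatCoframe a (flatFrame a c) = c := (flatCoframeEquiv a).right_inv c

theorem contDiff_flatFrame (c : Fin 8 → ℝ) : ContDiff ℝ ∞ fun a => flatFrame a c := by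
  rw [contDiff_euclidean]
  intro i
  fin_cases i <;> simp [flatFrame] <;> fun_prop

/-- The filtration by the degree of the coordinates. -/
def symbolFiltration (k : ℕ) : Submodule ℝ (Fin 8 → ℝ) where
  carrier := {c | ∀ i, k < symbolDegree i → c i = 0}
  add_mem' hc hd i h := by simp [hc i h, hd i h]
  zero_mem' := by simp
  smul_mem' r c hc i h := by simp [hc i h]

theorem mem_symbolFiltration {k : ℕ} {c : Fin 8 → ℝ} :
    c ∈ symbolFiltration k ↔ ∀ i, k < symbolDegree i → c i = 0 := Iff.rfl

theorem mem_flatMonge {a v : EuclideanSpace ℝ (Fin 8)} :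
    v ∈ flatMonge a ↔ flatCoframe a v ∈ symbolFiltration 1 := by
  rw [flatMonge, Submodule.mem_span_triple, mem_symbolFiltration]
  constructor
  · rintro ⟨r, s, t, rfl⟩ i
    fin_cases i <;> simp [symbolDegree, flatCoframe] <;> ring
  · intro h
    refine ⟨v 0, v 3, v 4, ?_⟩
    simp [Fin.forall_fin_succ, symbolDegree, flatCoframe] at h
    obtain ⟨h1, h2, h5, h6, h7⟩ := h
    ext i
    fin_cases i <;> simp
    · linear_combination -h1
    · linear_combination -h2
    · linear_combination -h5 - 2 * a 3 * h1
    · linear_combination -h6 - a 3 * h2 - a 4 * h1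
    · linear_combination -h7 - 2 * a 4 * h2

theorem fderiv_flatCoframe {X : EuclideanSpace ℝ (Fin 8) → EuclideanSpace ℝ (Fin 8)}
    {a : EuclideanSpace ℝ (Fin 8)} (hX : DifferentiableAt ℝ X a) (w : EuclideanSpace ℝ (Fin 8))
    (i : Fin 8) :
    fderiv ℝ (fun b => flatCoframe b (X b) i) a w = flatCoframe a (fderiv ℝ X a w) i +
      (![0, -(w 3 * X a 0), -(w 4 * X a 0), 0, 0,
        2 * w 3 * (a 3 * X a 0 - X a 1),
        w 3 * (a 4 * X a 0 - X a 2) + w 4 * (a 3 * X a 0 - X a 1),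
        2 * w 4 * (a 4 * X a 0 - X a 2)] : Fin 8 → ℝ) i := by
  have hx : ∀ j, HasFDerivAt (fun b => X b j) ((EuclideanSpace.proj j).comp (fderiv ℝ X a)) a :=
    fun j => (EuclideanSpace.proj (𝕜 := ℝ) j).hasFDerivAt.comp a hX.hasFDerivAt
  have hb : ∀ j, HasFDerivAt (fun b : EuclideanSpace ℝ (Fin 8) => b j)
      (EuclideanSpace.proj j : EuclideanSpace ℝ (Fin 8) →L[ℝ] ℝ) a :=
    fun j => (EuclideanSpace.proj j : EuclideanSpace ℝ (Fin 8) →L[ℝ] ℝ).hasFDerivAt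
  have h1 : ∀ j k, HasFDerivAt (fun b => X b j - b k * X b 0) _ a :=
    fun j k => (hx j).sub ((hb k).mul (hx 0))
  have h2 : ∀ j k l, HasFDerivAt (fun b => X b j - 2 * (b k * X b l) + b k * b k * X b 0) _ a :=
    fun j k l => ((hx j).sub (((hb k).mul (hx l)).const_mul 2)).add (((hb k).mul (hb k)).mul (hx 0))
  have h3 : HasFDerivAt
      (fun b => X b 6 - b 3 * X b 2 - b 4 * X b 1 + b 3 * b 4 * X b 0) _ a :=
    (((hx 6).sub ((hb 3).mul (hx 2))).sub ((hb 4).mul (hx 1))).add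
      (((hb 3).mul (hb 4)).mul (hx 0))
  fin_cases i
  · refine (congrArg (fun l => l w) (hx 0).fderiv).trans ?_
    simp [flatCoframe]
  · refine (congrArg (fun l => l w) (h1 1 3).fderiv).trans ?_
    simp [flatCoframe]
    ring
  · refine (congrArg (fun l => l w) (h1 2 4).fderiv).trans ?_
    simp [flatCoframe]
    ring
  · refine (congrArg (fun l => l w) (hx 3).fderiv).trans ?_
    simp [flatCoframe]
  · refine (congrArg (fun l => l w) (hx 4).fderiv).trans ?_
    simp [flatCoframe]
  · refine (congrArg (fun l => l w) (h2 5 3 1).fderiv).trans ?_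
    simp [flatCoframe]
    ring
  · refine (congrArg (fun l => l w) h3.fderiv).trans ?_
    simp [flatCoframe]
    ring
  · refine (congrArg (fun l => l w) (h2 7 4 2).fderiv).trans ?_
    simp [flatCoframe]
    ring

/-- The Maurer-Cartan equation of the flat coframe. -/
theorem flatCoframe_lieBracket {X Y : EuclideanSpace ℝ (Fin 8) → EuclideanSpace ℝ (Fin 8)}
    {a : EuclideanSpace ℝ (Fin 8)} (hX : DifferentiableAt ℝ X a) (hY : DifferentiableAt ℝ Y a)
    (i : Fin 8) :
    flatCoframe a (VectorField.lieBracket ℝ X Y a) i =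
      fderiv ℝ (fun b => flatCoframe b (Y b) i) a (X a) -
      fderiv ℝ (fun b => flatCoframe b (X b) i) a (Y a) +
      symbolBracket (flatCoframe a (X a)) (flatCoframe a (Y a)) i := by
  rw [fderiv_flatCoframe hX, fderiv_flatCoframe hY, VectorField.lieBracket]
  fin_cases i <;> simp [flatCoframe, symbolBracket] <;> ring

theorem symbolDegree_le (i : Fin 8) : symbolDegree i ≤ 3 := by
  fin_cases i <;> simp [symbolDegree]

theorem one_le_symbolDegree (i : Fin 8) : 1 ≤ symbolDegree i := by
  fin_cases i <;> simp [symbolDegree]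

theorem symbolBracket_mem {i j : ℕ} {c d : Fin 8 → ℝ} (hc : c ∈ symbolFiltration i)
    (hd : d ∈ symbolFiltration j) : symbolBracket c d ∈ symbolFiltration (i + j) := by
  intro m hm
  have h3 := symbolDegree_le m
  have hi : i < 3 := by omega
  have hj : j < 3 := by omega
  rw [mem_symbolFiltration] at hc hd
  simp only [Fin.forall_fin_succ, symbolDegree] at hc hd
  revert hm
  interval_cases i <;> interval_cases j <;> simp at hc hd <;>
    fin_cases m <;> simp [symbolDegree, symbolBracket, hc, hd]

/-- The component of a given degree. -/
def symbolPart (k : ℕ) : (Fin 8 → ℝ) →ₗ[ℝ] (Fin 8 → ℝ) where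
  toFun c i := if symbolDegree i = k then c i else 0
  map_add' c d := by
    ext i
    by_cases h : symbolDegree i = k <;> simp [h]
  map_smul' r c := by
    ext i
    by_cases h : symbolDegree i = k <;> simp [h]

theorem symbolPart_apply (k : ℕ) (c : Fin 8 → ℝ) (i : Fin 8) :
    symbolPart k c i = if symbolDegree i = k then c i else 0 := rfl

theorem symbolPart_eq_zero {k : ℕ} (hk : 3 < k) (c : Fin 8 → ℝ) : symbolPart k c = 0 := by
  ext i
  rw [symbolPart_apply, if_neg ((symbolDegree_le i).trans_lt hk).ne]
  rfl

theorem symbolPart_symbolBracket {i j : ℕ} (hi : 1 ≤ i) (hj : 1 ≤ j) {c d : Fin 8 → ℝ}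
    (hc : c ∈ symbolFiltration i) (hd : d ∈ symbolFiltration j) :
    symbolPart (i + j) (symbolBracket c d) =
      symbolBracket (symbolPart i c) (symbolPart j d) := by
  rcases lt_or_ge 3 i with hi3 | hi3
  · rw [symbolPart_eq_zero hi3, symbolPart_eq_zero (by omega)]
    ext m
    fin_cases m <;> simp [symbolBracket]
  rcases lt_or_ge 3 j with hj3 | hj3
  · rw [symbolPart_eq_zero hj3, symbolPart_eq_zero (by omega)]
    ext m
    fin_cases m <;> simp [symbolBracket]
  rw [mem_symbolFiltration] at hc hd
  simp only [Fin.forall_fin_succ, symbolDegree] at hc hd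
  ext m
  interval_cases i <;> interval_cases j <;> simp at hc hd <;>
    fin_cases m <;> simp [symbolDegree, symbolBracket, symbolPart_apply, hc, hd]

theorem symbolFiltration_mono {k l : ℕ} (h : k ≤ l) : symbolFiltration k ≤ symbolFiltration l :=
  fun _ hc i hi => hc i (h.trans_lt hi)

theorem symbolFiltration_zero : symbolFiltration 0 = ⊥ := by
  rw [eq_bot_iff]
  intro c hc
  ext i
  exact hc i (one_le_symbolDegree i)

theorem symbolFiltration_three : symbolFiltration 3 = ⊤ := by
  rw [eq_top_iff]
  exact fun c _ i hi => absurd hi (symbolDegree_le i).not_gt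

theorem symbolFiltration_succ_le (k : ℕ) : symbolFiltration (k + 2) ≤ symbolFiltration (k + 1) ⊔
    Submodule.span ℝ {z | ∃ c ∈ symbolFiltration 1, ∃ d ∈ symbolFiltration (k + 1),
      z = symbolBracket c d} := by
  intro c hc
  rw [mem_symbolFiltration] at hc
  simp only [Fin.forall_fin_succ, symbolDegree] at hc
  rcases k with _ | _ | k
  · simp at hc
    have h : c = ![c 0, 0, 0, c 3, c 4, 0, 0, 0] +
        symbolBracket ![0, 0, 0, c 1, c 2, 0, 0, 0] ![1, 0, 0, 0, 0, 0, 0, 0] := by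
      ext i
      fin_cases i <;> simp [symbolBracket, hc]
    rw [h]
    refine Submodule.add_mem_sup ?_ (Submodule.subset_span ⟨_, ?_, _, ?_, rfl⟩) <;>
      simp [mem_symbolFiltration, Fin.forall_fin_succ, symbolDegree]
  · simp at hc
    have h : c = ![c 0, c 1, c 2, c 3, c 4, 0, 0, 0] +
        (symbolBracket ![0, 0, 0, 1, 0, 0, 0, 0] ![0, c 5 / 2, c 6, 0, 0, 0, 0, 0] +
          symbolBracket ![0, 0, 0, 0, 1, 0, 0, 0] ![0, 0, c 7 / 2, 0, 0, 0, 0, 0]) := by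
      ext i
      fin_cases i <;> simp [symbolBracket] <;> ring
    rw [h]
    refine Submodule.add_mem_sup ?_ (Submodule.add_mem _ (Submodule.subset_span ⟨_, ?_, _, ?_, rfl⟩)
      (Submodule.subset_span ⟨_, ?_, _, ?_, rfl⟩)) <;>
      simp [mem_symbolFiltration, Fin.forall_fin_succ, symbolDegree]
  · refine Submodule.mem_sup_left (symbolFiltration_mono (k := 3) (by omega) ?_)
    rw [symbolFiltration_three]
    exact Submodule.mem_top

/-! ### Distributions that are flat Monge in a chart -/

section FlatChart

open VectorField

variable {M : Type*} [TopologicalSpace M] [ChartedSpace (EuclideanSpace ℝ (Fin 8)) M]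
  {e : OpenPartialHomeomorph M (EuclideanSpace ℝ (Fin 8))}

/-- The pullback of the flat coframe by a chart. -/
noncomputable def chartCoframe (e : OpenPartialHomeomorph M (EuclideanSpace ℝ (Fin 8))) (x : M) :
    TangentSpace (𝓡 8) x →ₗ[ℝ] (Fin 8 → ℝ) :=
  (flatCoframeEquiv (e x)).toLinearMap ∘ₗ (mfderiv (𝓡 8) (𝓡 8) e x).toLinearMap

theorem chartCoframe_apply (x : M) (v : TangentSpace (𝓡 8) x) :
    chartCoframe e x v = flatCoframe (e x) (mfderiv (𝓡 8) (𝓡 8) e x v) := rfl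

/-- The vector field with constant components with respect to the coframe. -/
noncomputable def chartFrame (e : OpenPartialHomeomorph M (EuclideanSpace ℝ (Fin 8)))
    (c : Fin 8 → ℝ) (x : M) : TangentSpace (𝓡 8) x :=
  mpullback (𝓡 8) (𝓡 8) e (fun a => flatFrame a c) x

theorem chartCoframe_chartFrame (he : e.MDifferentiable (𝓡 8) (𝓡 8)) {x : M} (hx : x ∈ e.source)
    (c : Fin 8 → ℝ) : chartCoframe e x (chartFrame e c x) = c := by
  rw [chartCoframe_apply, chartFrame, mfderiv_mpullback_chart he hx]
  exact flatCoframe_flatFrame _ _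

theorem chartCoframe_injective (he : e.MDifferentiable (𝓡 8) (𝓡 8)) {x : M} (hx : x ∈ e.source) :
    Injective (chartCoframe e x) :=
  (flatCoframeEquiv (e x)).injective.comp (he.mfderiv_injective hx)

variable [IsManifold (𝓡 8) ∞ M]

/-- In a direction in which the components of two vector fields are locally constant, the component
of their Lie bracket is that of the bracket of the symbol algebra. -/
theorem chartCoframe_mlieBracket (he : e ∈ IsManifold.maximalAtlas (𝓡 8) ∞ M) {x : M}
    (hx : x ∈ e.source) {X Y : ∀ x : M, TangentSpace (𝓡 8) x}
    (hX : ContMDiffAt (𝓡 8) (𝓡 8).tangent ∞ (fun y => (⟨y, X y⟩ : TangentBundle (𝓡 8) M)) x)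
    (hY : ContMDiffAt (𝓡 8) (𝓡 8).tangent ∞ (fun y => (⟨y, Y y⟩ : TangentBundle (𝓡 8) M)) x)
    {m : Fin 8} {r s : ℝ} (hXm : ∀ᶠ y in nhds x, chartCoframe e y (X y) m = r)
    (hYm : ∀ᶠ y in nhds x, chartCoframe e y (Y y) m = s) :
    chartCoframe e x (mlieBracket (𝓡 8) X Y x) m =
      symbolBracket (chartCoframe e x (X x)) (chartCoframe e x (Y x)) m := by
  have hd := mdifferentiable_of_mem_maximalAtlas he
  have hval : ∀ Z : ∀ x : M, TangentSpace (𝓡 8) x, ∀ a ∈ e.target,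
      flatCoframe a (mpullback (𝓡 8) (𝓡 8) e.symm Z a) =
        chartCoframe e (e.symm a) (Z (e.symm a)) := by
    intro Z a ha
    rw [mpullback_chart_symm hd ha, chartCoframe_apply, e.right_inv ha]
  have hconst : ∀ (Z : ∀ x : M, TangentSpace (𝓡 8) x) (r : ℝ),
      (∀ᶠ y in nhds x, chartCoframe e y (Z y) m = r) →
      fderiv ℝ (fun b => flatCoframe b (mpullback (𝓡 8) (𝓡 8) e.symm Z b) m) (e x) = 0 := by
    intro Z r hZ
    have h1 : (fun b => flatCoframe b (mpullback (𝓡 8) (𝓡 8) e.symm Z b) m)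
        =ᶠ[nhds (e x)] fun _ => r := by
      have h2 := (e.tendsto_symm hx).eventually hZ
      filter_upwards [h2, e.open_target.mem_nhds (e.map_source hx)] with b hb hbt
      rw [hval Z b hbt, hb]
    rw [h1.fderiv_eq, fderiv_fun_const]
    rfl
  rw [chartCoframe_apply, mfderiv_mlieBracket_chart he hx hX hY, flatCoframe_lieBracket
    ((contDiffAt_mpullback_chart_symm he hx hX).differentiableAt (by simp))
    ((contDiffAt_mpullback_chart_symm he hx hY).differentiableAt (by simp)),
    hconst X r hXm, hconst Y s hYm, hval X _ (e.map_source hx), hval Y _ (e.map_source hx),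
    e.left_inv hx]
  exact (congrArg (· + _) (sub_self (0 : ℝ))).trans (zero_add _)

theorem contMDiffAt_chartFrame (he : e ∈ IsManifold.maximalAtlas (𝓡 8) ∞ M) (c : Fin 8 → ℝ) :
    ContMDiffOn (𝓡 8) (𝓡 8).tangent ∞
      (fun y => (⟨y, chartFrame e c y⟩ : TangentBundle (𝓡 8) M)) e.source :=
  contMDiffOn_mpullback_chart he (contDiff_flatFrame c)

variable {D : TangentDistribution (𝓡 8) M}

theorem TangentDistribution.isLocalSection_chartFrame
    (he : e ∈ IsManifold.maximalAtlas (𝓡 8) ∞ M) {S : Submodule ℝ (Fin 8 → ℝ)}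
    (hD : ∀ y ∈ e.source, D y = S.comap (chartCoframe e y)) {x : M} (hx : x ∈ e.source)
    {c : Fin 8 → ℝ} (hc : c ∈ S) : D.IsLocalSection x (chartFrame e c) := by
  refine ⟨e.source, e.open_source, hx, contMDiffAt_chartFrame he c, fun y hy => ?_⟩
  rw [hD y hy, Submodule.mem_comap,
    chartCoframe_chartFrame (mdifferentiable_of_mem_maximalAtlas he) hy]
  exact hc

theorem TangentDistribution.IsLocalSection.contMDiffAt {x : M}
    {X : ∀ x : M, TangentSpace (𝓡 8) x} (hX : D.IsLocalSection x X) :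
    ContMDiffAt (𝓡 8) (𝓡 8).tangent ∞ (fun y => (⟨y, X y⟩ : TangentBundle (𝓡 8) M)) x := by
  obtain ⟨U, hU, hxU, hX, -⟩ := hX
  exact hX.contMDiffAt (hU.mem_nhds hxU)

theorem TangentDistribution.IsLocalSection.eventually_chartCoframe {k : ℕ}
    (hD : ∀ y ∈ e.source, D y = (symbolFiltration k).comap (chartCoframe e y)) {x : M}
    (hx : x ∈ e.source) {X : ∀ x : M, TangentSpace (𝓡 8) x} (hX : D.IsLocalSection x X) {m : Fin 8}
    (hm : k < symbolDegree m) : ∀ᶠ y in nhds x, chartCoframe e y (X y) m = 0 := by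
  obtain ⟨U, hU, hxU, -, hX⟩ := hX
  filter_upwards [hU.mem_nhds hxU, e.open_source.mem_nhds hx] with y hyU hy
  have h := hX y hyU
  rw [hD y hy, Submodule.mem_comap] at h
  exact h m hm

theorem chartCoframe_mlieBracket_of_isLocalSection
    (he : e ∈ IsManifold.maximalAtlas (𝓡 8) ∞ M) {D' : TangentDistribution (𝓡 8) M} {i j : ℕ}
    (hD : ∀ y ∈ e.source, D y = (symbolFiltration i).comap (chartCoframe e y))
    (hD' : ∀ y ∈ e.source, D' y = (symbolFiltration j).comap (chartCoframe e y)) {x : M}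
    (hx : x ∈ e.source) {X Y : ∀ x : M, TangentSpace (𝓡 8) x} (hX : D.IsLocalSection x X)
    (hY : D'.IsLocalSection x Y) {m : Fin 8} (hi : i < symbolDegree m) (hj : j < symbolDegree m) :
    chartCoframe e x (mlieBracket (𝓡 8) X Y x) m =
      symbolBracket (chartCoframe e x (X x)) (chartCoframe e x (Y x)) m :=
  chartCoframe_mlieBracket he hx hX.contMDiffAt hY.contMDiffAt
    (hX.eventually_chartCoframe hD hx hi) (hY.eventually_chartCoframe hD' hx hj)

/-- The bracket of local sections in the filtration. -/
theorem chartCoframe_mlieBracket_mem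
    (he : e ∈ IsManifold.maximalAtlas (𝓡 8) ∞ M) {D' : TangentDistribution (𝓡 8) M} {i j : ℕ}
    (hi : 1 ≤ i) (hj : 1 ≤ j)
    (hD : ∀ y ∈ e.source, D y = (symbolFiltration i).comap (chartCoframe e y))
    (hD' : ∀ y ∈ e.source, D' y = (symbolFiltration j).comap (chartCoframe e y)) {x : M}
    (hx : x ∈ e.source) {X Y : ∀ x : M, TangentSpace (𝓡 8) x} (hX : D.IsLocalSection x X)
    (hY : D'.IsLocalSection x Y) :
    chartCoframe e x (mlieBracket (𝓡 8) X Y x) ∈ symbolFiltration (i + j) ∧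
    symbolPart (i + j) (chartCoframe e x (mlieBracket (𝓡 8) X Y x)) =
      symbolBracket (symbolPart i (chartCoframe e x (X x)))
        (symbolPart j (chartCoframe e x (Y x))) := by
  have hXx := hX.mem
  have hYx := hY.mem
  rw [hD x hx, Submodule.mem_comap] at hXx
  rw [hD' x hx, Submodule.mem_comap] at hYx
  constructor
  · intro m hm
    rw [chartCoframe_mlieBracket_of_isLocalSection he hD hD' hx hX hY (by omega) (by omega)]
    exact symbolBracket_mem hXx hYx m hm
  · rw [← symbolPart_symbolBracket hi hj hXx hYx]
    ext m
    rw [symbolPart_apply, symbolPart_apply]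
    split_ifs with hm
    · exact chartCoframe_mlieBracket_of_isLocalSection he hD hD' hx hX hY (by omega) (by omega)
    · rfl

/-- The weak derived flag of a distribution that is flat Monge in a chart. -/
theorem TangentDistribution.derived_eq (he : e ∈ IsManifold.maximalAtlas (𝓡 8) ∞ M)
    (hD : ∀ y ∈ e.source, D y = (symbolFiltration 1).comap (chartCoframe e y)) (k : ℕ) :
    ∀ x ∈ e.source, D.derived k x = (symbolFiltration k).comap (chartCoframe e x) := by
  have hd := mdifferentiable_of_mem_maximalAtlas he
  induction k using Nat.twoStepInduction with
  | zero =>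
    intro x hx
    rw [symbolFiltration_zero, Submodule.comap_bot,
      LinearMap.ker_eq_bot.mpr (chartCoframe_injective hd hx)]
    rfl
  | one => exact hD
  | more k _ ih =>
    intro x hx
    change D.derived (k + 1) x ⊔ _ = _
    apply le_antisymm
    · rw [ih x hx]
      refine sup_le (Submodule.comap_mono (symbolFiltration_mono (by omega)))
        (Submodule.span_le.mpr ?_)
      rintro v ⟨X, Y, hX, hY, rfl⟩
      have h := (chartCoframe_mlieBracket_mem he le_rfl (by omega) hD ih hx hX hY).1
      rw [show 1 + (k + 1) = k + 2 by omega] at h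
      exact h
    · intro v hv
      have h := symbolFiltration_succ_le k hv
      have hmap : (symbolFiltration (k + 1) ⊔
          Submodule.span ℝ {z | ∃ c ∈ symbolFiltration 1, ∃ d ∈ symbolFiltration (k + 1),
            z = symbolBracket c d}) ≤ (D.derived (k + 1) x ⊔
          Submodule.span ℝ {v | ∃ X Y : ∀ x : M, TangentSpace (𝓡 8) x,
            IsLocalSection D x X ∧ IsLocalSection (derived D (k + 1)) x Y ∧
            v = VectorField.mlieBracket (𝓡 8) X Y x}).map (chartCoframe e x) := by
        refine sup_le (fun c hc => ?_) (Submodule.span_le.mpr ?_)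
        · refine ⟨chartFrame e c x, Submodule.mem_sup_left ?_, chartCoframe_chartFrame hd hx c⟩
          rw [ih x hx, Submodule.mem_comap, chartCoframe_chartFrame hd hx]
          exact hc
        · rintro z ⟨c, hc, d, hd', rfl⟩
          refine ⟨_, Submodule.mem_sup_right (Submodule.subset_span ⟨chartFrame e c,
            chartFrame e d, isLocalSection_chartFrame he hD hx hc,
            isLocalSection_chartFrame he ih hx hd', rfl⟩), ?_⟩
          ext m
          have hcst : ∀ c : Fin 8 → ℝ, ∀ᶠ y in nhds x, chartCoframe e y (chartFrame e c y) m = c m := by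
            intro c
            filter_upwards [e.open_source.mem_nhds hx] with y hy
            rw [chartCoframe_chartFrame hd hy]
          have hsm : ∀ c : Fin 8 → ℝ, ContMDiffAt (𝓡 8) (𝓡 8).tangent ∞
              (fun y => (⟨y, chartFrame e c y⟩ : TangentBundle (𝓡 8) M)) x := fun c =>
            (contMDiffAt_chartFrame he c).contMDiffAt (e.open_source.mem_nhds hx)
          rw [chartCoframe_mlieBracket he hx (hsm c) (hsm d) (hcst c) (hcst d),
            chartCoframe_chartFrame hd hx, chartCoframe_chartFrame hd hx]
      obtain ⟨w, hw, hwv⟩ := hmap h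
      rwa [← chartCoframe_injective hd hx hwv]

theorem symbolElt_injective : Injective symbolElt :=
  symbolEquiv.injective.comp (WithLp.toLp_injective 2)

/-- The symbol algebra of a distribution that is flat Monge in a chart. -/
theorem TangentDistribution.hasSymbolAt_of_chart (he : e ∈ IsManifold.maximalAtlas (𝓡 8) ∞ M)
    (hD : ∀ y ∈ e.source, D y = (symbolFiltration 1).comap (chartCoframe e y)) {x : M}
    (hx : x ∈ e.source) : D.HasSymbolAt x mongeSymbolGrading := by
  have hd := mdifferentiable_of_mem_maximalAtlas he
  have hder := derived_eq he hD
  let elt : (Fin 8 → ℝ) →ₗ[ℝ] mongeSymbol :=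
    { toFun := symbolElt
      map_add' := symbolElt_add
      map_smul' := symbolElt_smul }
  refine ⟨fun k => elt ∘ₗ symbolPart k ∘ₗ chartCoframe e x ∘ₗ (D.derived k x).subtype,
    fun k hk => ?_, fun k v => ?_, fun i j hi hj X Y hX hY => ?_⟩
  · ext z
    obtain ⟨c, rfl⟩ := exists_symbolElt z
    rw [symbolElt_mem_iff hk]
    constructor
    · rintro ⟨v, hv⟩ i hi
      rw [← symbolElt_injective hv]
      exact if_neg hi
    · intro hc
      refine ⟨⟨chartFrame e c x, ?_⟩, congrArg symbolElt ?_⟩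
      · rw [hder k x hx, Submodule.mem_comap, chartCoframe_chartFrame hd hx]
        exact fun i hi => hc i hi.ne'
      · change symbolPart k (chartCoframe e x (chartFrame e c x)) = c
        rw [chartCoframe_chartFrame hd hx]
        ext i
        rw [symbolPart_apply]
        split_ifs with hi
        · rfl
        · exact (hc i hi).symm
  · have hv := (hder _ x hx).le v.2
    rw [hder k x hx, Submodule.mem_comap]
    constructor
    · intro h i hi
      have h0 : symbolPart (k + 1) (chartCoframe e x v) = 0 :=
        symbolElt_injective (h.trans (map_zero elt).symm)
      rcases (Nat.succ_le_of_lt hi).eq_or_lt with hi' | hi'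
      · exact (if_pos hi'.symm).symm.trans (congrFun h0 i)
      · exact hv i hi'
    · intro h
      refine (congrArg elt (?_ : symbolPart (k + 1) (chartCoframe e x v) = 0)).trans (map_zero elt)
      ext i
      rw [symbolPart_apply]
      split_ifs with hi
      · exact h i (by omega)
      · rfl
  · obtain ⟨h1, h2⟩ := chartCoframe_mlieBracket_mem he hi hj (hder i) (hder j) hx hX hY
    refine ⟨?_, ?_⟩
    · rw [hder _ x hx]
      exact h1
    · exact (congrArg symbolElt h2).trans (symbolElt_lie _ _).symm

/-- A distribution that is flat Monge in a chart is smooth of rank three there. -/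
theorem TangentDistribution.exists_frame_of_chart (he : e ∈ IsManifold.maximalAtlas (𝓡 8) ∞ M)
    (hD : ∀ y ∈ e.source, D y = (symbolFiltration 1).comap (chartCoframe e y)) :
    ∃ V : Fin 3 → ∀ x : M, TangentSpace (𝓡 8) x, (∀ i, D.IsSectionOn e.source (V i)) ∧
      ∀ y ∈ e.source, LinearIndependent ℝ (fun i => V i y) ∧
        Submodule.span ℝ (Set.range fun i => V i y) = D y := by
  have hd := mdifferentiable_of_mem_maximalAtlas he
  let b : Fin 3 → Fin 8 → ℝ := ![Pi.single 0 1, Pi.single 3 1, Pi.single 4 1]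
  have hb : ∀ i, b i ∈ symbolFiltration 1 := by
    intro i m
    fin_cases i <;> fin_cases m <;> simp [b, symbolDegree, Pi.single_apply]
  have hli : LinearIndependent ℝ b := by
    rw [Fintype.linearIndependent_iff]
    intro g hg i
    have h0 := congrFun hg 0
    have h3 := congrFun hg 3
    have h4 := congrFun hg 4
    simp [b, Fin.sum_univ_three, Pi.single_apply] at h0 h3 h4
    fin_cases i
    exacts [h0, h3, h4]
  have hspan : ∀ c ∈ symbolFiltration 1, c = ∑ i, ![c 0, c 3, c 4] i • b i := by
    intro c hc
    rw [mem_symbolFiltration] at hc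
    simp [Fin.forall_fin_succ, symbolDegree] at hc
    ext m
    fin_cases m <;> simp [b, Fin.sum_univ_three, Pi.single_apply, hc]
  refine ⟨fun i => chartFrame e (b i), fun i => ⟨contMDiffAt_chartFrame he _, fun y hy => ?_⟩,
    fun y hy => ⟨?_, ?_⟩⟩
  · rw [hD y hy, Submodule.mem_comap, chartCoframe_chartFrame hd hy]
    exact hb i
  · refine LinearIndependent.of_comp (chartCoframe e y) ?_
    convert hli using 1
    ext1 i
    exact chartCoframe_chartFrame hd hy _
  · apply le_antisymm
    · rw [Submodule.span_le, range_subset_iff]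
      intro i
      rw [SetLike.mem_coe, hD y hy, Submodule.mem_comap, chartCoframe_chartFrame hd hy]
      exact hb i
    · intro v hv
      rw [hD y hy, Submodule.mem_comap] at hv
      have h : v = ∑ i, ![chartCoframe e y v 0, chartCoframe e y v 3, chartCoframe e y v 4] i •
          chartFrame e (b i) y := by
        apply chartCoframe_injective hd hy
        rw [map_sum]
        simp only [map_smul, chartCoframe_chartFrame hd hy]
        exact hspan _ hv
      rw [h]
      exact Submodule.sum_mem _ fun i _ =>
        Submodule.smul_mem _ _ (Submodule.subset_span ⟨i, rfl⟩)

end FlatChart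

/-- The coordinate basis of the negative part. -/
noncomputable def symbolBasis : Module.Basis (Fin 8) ℝ mongeSymbol :=
  (Pi.basisFun ℝ (Fin 8)).map ((WithLp.linearEquiv 2 ℝ (Fin 8 → ℝ)).symm.trans symbolEquiv)

theorem symbolElt_mem_span {c : Fin 8 → ℝ} {s : Finset (Fin 8)} :
    symbolElt c ∈ Submodule.span ℝ (symbolBasis '' s) ↔ ∀ i, i ∉ s → c i = 0 := by
  have h : ∀ i, symbolBasis.repr (symbolElt c) i = c i := by
    intro i
    have : symbolElt c = ((WithLp.linearEquiv 2 ℝ (Fin 8 → ℝ)).symm.trans symbolEquiv) c := rfl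
    rw [this, symbolBasis, Module.Basis.map_repr, LinearEquiv.trans_apply,
      LinearEquiv.symm_apply_apply]
    exact Pi.basisFun_repr ℝ (Fin 8) c i
  rw [Module.Basis.mem_span_image]
  constructor
  · intro hs i hi
    by_contra hc
    exact hi (hs (Finsupp.mem_support_iff.mpr ((h i).trans_ne hc)))
  · intro hs i hi
    by_contra hc
    exact Finsupp.mem_support_iff.mp hi ((h i).trans (hs i hc))

theorem finrank_span_symbolBasis (s : Finset (Fin 8)) :
    Module.finrank ℝ (Submodule.span ℝ (symbolBasis '' s)) = s.card := by
  have h := finrank_span_eq_card (symbolBasis.linearIndependent.comp (Subtype.val : s → Fin 8)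
    Subtype.val_injective)
  rw [range_comp, Subtype.range_coe_subtype] at h
  simpa using h

theorem mongeSymbolGrading_neg_one :
    mongeSymbolGrading (-1) = Submodule.span ℝ (symbolBasis '' ({0, 3, 4} : Finset (Fin 8))) := by
  ext z
  obtain ⟨c, rfl⟩ := exists_symbolElt z
  rw [symbolElt_mem_span]
  refine (symbolElt_mem_iff le_rfl c).trans (forall_congr' fun i => ?_)
  fin_cases i <;> simp [symbolDegree]

section FlatMonge

variable {M : Type*} [TopologicalSpace M] [ChartedSpace (EuclideanSpace ℝ (Fin 8)) M]
  [IsManifold (𝓡 8) ∞ M] {D : TangentDistribution (𝓡 8) M}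

theorem TangentDistribution.IsFlatMonge.exists_chart (hD : D.IsFlatMonge) (x : M) :
    ∃ e ∈ IsManifold.maximalAtlas (𝓡 8) ∞ M, x ∈ e.source ∧
      ∀ y ∈ e.source, D y = (symbolFiltration 1).comap (chartCoframe e y) := by
  obtain ⟨e, he, hx, h⟩ := hD x
  refine ⟨e, he, hx, fun y hy => ?_⟩
  ext v
  rw [Submodule.mem_comap, chartCoframe_apply]
  refine Iff.trans ?_ mem_flatMonge
  rw [← h y hy]
  constructor
  · exact fun hv => ⟨v, hv, rfl⟩
  · rintro ⟨w, hw, hwv⟩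
    rwa [← (mdifferentiable_of_mem_maximalAtlas he).mfderiv_injective hy hwv]

theorem TangentDistribution.IsFlatMonge.isSmoothOfRank (hD : D.IsFlatMonge) :
    D.IsSmoothOfRank 3 := by
  intro x
  obtain ⟨e, he, hx, h⟩ := hD.exists_chart x
  exact ⟨e.source, e.open_source, hx, exists_frame_of_chart he h⟩

theorem TangentDistribution.IsFlatMonge.hasSymbolAt (hD : D.IsFlatMonge) (x : M) :
    D.HasSymbolAt x mongeSymbolGrading := by
  obtain ⟨e, he, hx, h⟩ := hD.exists_chart x
  exact hasSymbolAt_of_chart he h hx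

theorem TangentDistribution.IsFlatMonge.isBracketGenerating (hD : D.IsFlatMonge) :
    D.IsBracketGenerating := by
  refine ⟨3, fun x => ?_⟩
  obtain ⟨e, he, hx, h⟩ := hD.exists_chart x
  rw [derived_eq he h 3 x hx, symbolFiltration_three, Submodule.comap_top]

theorem finrank_mongeSymbol : Module.finrank ℝ mongeSymbol = 8 := by
  rw [← symbolEquiv.finrank_eq, finrank_euclideanSpace_fin]

theorem TangentDistribution.IsFlatMonge.isMonge (hD : D.IsFlatMonge) : D.IsMonge := by
  refine ⟨hD.isBracketGenerating, mongeSymbol, inferInstance, inferInstance, mongeSymbolGrading, 3,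
    isLieGrading_mongeSymbolGrading, by norm_num, ?_, ?_, hD.hasSymbolAt,
    Module.Finite.equiv symbolEquiv, ?_, ?_, LieSp3, inferInstance, inferInstance, mongeGrading,
    mongeSymbol.incl, isTanakaProlongation_mongeGrading, inferInstance⟩
  · intro h
    have hz : symbolElt (Pi.single 5 1) = 0 := by
      rw [← Submodule.mem_bot ℝ, ← h, symbolElt_mem_iff (by norm_num)]
      intro i hi
      rw [Pi.single_apply, if_neg]
      rintro rfl
      exact hi rfl
    have h0 := congrFun (symbolElt_injective (hz.trans (map_zero symbolEquiv).symm)) 5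
    simp at h0
  · rintro k (hk | hk)
    · rw [eq_bot_iff]
      intro z hz
      have h0 := (mem_mongeSymbolGrading (by omega)).mp hz
      rw [mongeGrading_eq_bot (Or.inl (by omega)), Submodule.mem_bot] at h0
      exact Subtype.ext h0
    · exact mongeSymbolGrading_of_nonneg hk
  · rw [finrank_mongeSymbol, finrank_euclideanSpace_fin]
  · have hle : Submodule.span ℝ (symbolBasis '' ({3, 4} : Finset (Fin 8))) ≤
        mongeSymbolGrading (-1) := by
      rw [mongeSymbolGrading_neg_one]
      exact Submodule.span_mono (image_mono (by simp))
    refine ⟨_, hle, ?_, ?_, le_antisymm (Submodule.span_le.mpr ?_) ?_⟩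
    · intro z hz w hw
      obtain ⟨c, rfl⟩ := exists_symbolElt z
      obtain ⟨d, rfl⟩ := exists_symbolElt w
      rw [symbolElt_mem_span] at hz hw
      simp [Fin.forall_fin_succ] at hz hw
      rw [symbolElt_lie, (by ext m; fin_cases m <;> simp [symbolBracket, hz, hw] :
        symbolBracket c d = 0)]
      exact map_zero symbolEquiv
    · rw [mongeSymbolGrading_neg_one, finrank_span_symbolBasis, finrank_span_symbolBasis]
      rfl
    · rintro z ⟨x, hx, y, hy, rfl⟩
      exact isLieGrading_mongeSymbolGrading.lie_mem (-1) (-1) x hx y (hle hy)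
    · intro z hz
      obtain ⟨c, rfl⟩ := exists_symbolElt z
      have hc := (symbolElt_mem_iff one_le_two c).mp hz
      simp [Fin.forall_fin_succ, symbolDegree] at hc
      refine Submodule.subset_span ⟨symbolElt (Pi.single 0 1), ?_,
        symbolElt ![0, 0, 0, -c 1, -c 2, 0, 0, 0], ?_, ?_⟩
      · refine (symbolElt_mem_iff le_rfl _).mpr ?_
        simp [Fin.forall_fin_succ, symbolDegree]
      · rw [symbolElt_mem_span]
        simp [Fin.forall_fin_succ]
      · rw [symbolElt_lie]
        congr 1
        ext m
        fin_cases m <;> simp [symbolBracket, hc]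

end FlatMonge

/-! ### Smooth structures on embedded subspaces of a vector space -/

section EmbeddedAtlas

variable {E : Type*} [NormedAddCommGroup E] [NormedSpace ℝ E]
  {V : Type*} [NormedAddCommGroup V] [NormedSpace ℝ V] {X : Type*} [TopologicalSpace X]

/-- A chart that is, as well as its inverse, given by smooth maps in the ambient vector space. -/
def IsEmbeddedChart (j : X → V) (e : OpenPartialHomeomorph X E) : Prop :=
  (∃ Ψ : V → E, ∀ x ∈ e.source, ContDiffAt ℝ ∞ Ψ (j x) ∧ e x = Ψ (j x)) ∧
    ∃ Φ : E → V, ∀ a ∈ e.target, ContDiffAt ℝ ∞ Φ a ∧ j (e.symm a) = Φ a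

/-- An embedding in a vector space for which all charts are given by smooth ambient maps. -/
structure IsEmbeddedAtlas [ChartedSpace E X] (j : X → V) : Prop where
  isInducing : Topology.IsInducing j
  isEmbeddedChart : ∀ e ∈ atlas E X, IsEmbeddedChart j e

/-- The chart given by ambient maps `Ψ` and `Φ`. -/
def embeddedChart {j : X → V} (hj : Topology.IsInducing j) (S : Set X) (T : Set E) (Ψ : V → E)
    (Φ : E → V) (σ : E → X) (hS : IsOpen S) (hT : IsOpen T)
    (hΨ : ∀ x ∈ S, ContDiffAt ℝ ∞ Ψ (j x)) (hΦ : ∀ a ∈ T, ContDiffAt ℝ ∞ Φ a)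
    (hσ : ∀ a ∈ T, j (σ a) = Φ a) (hST : ∀ x ∈ S, Ψ (j x) ∈ T) (hTS : ∀ a ∈ T, σ a ∈ S)
    (hleft : ∀ x ∈ S, σ (Ψ (j x)) = x) (hright : ∀ a ∈ T, Ψ (Φ a) = a) :
    OpenPartialHomeomorph X E where
  toFun x := Ψ (j x)
  invFun := σ
  source := S
  target := T
  map_source' := hST
  map_target' := hTS
  left_inv' := hleft
  right_inv' a ha := by rw [hσ a ha, hright a ha]
  open_source := hS
  open_target := hT
  continuousOn_toFun x hx :=
    ((hΨ x hx).continuousAt.comp hj.continuous.continuousAt).continuousWithinAt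
  continuousOn_invFun := by
    rw [hj.continuousOn_iff]
    intro a ha
    exact ((hΦ a ha).continuousAt.continuousWithinAt).congr (fun b hb => hσ b hb) (hσ a ha)

theorem isEmbeddedChart_embeddedChart {j : X → V} (hj : Topology.IsInducing j) (S : Set X)
    (T : Set E) (Ψ : V → E) (Φ : E → V) (σ : E → X) (hS : IsOpen S) (hT : IsOpen T)
    (hΨ : ∀ x ∈ S, ContDiffAt ℝ ∞ Ψ (j x)) (hΦ : ∀ a ∈ T, ContDiffAt ℝ ∞ Φ a)
    (hσ : ∀ a ∈ T, j (σ a) = Φ a) (hST : ∀ x ∈ S, Ψ (j x) ∈ T) (hTS : ∀ a ∈ T, σ a ∈ S)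
    (hleft : ∀ x ∈ S, σ (Ψ (j x)) = x) (hright : ∀ a ∈ T, Ψ (Φ a) = a) :
    IsEmbeddedChart j (embeddedChart hj S T Ψ Φ σ hS hT hΨ hΦ hσ hST hTS hleft hright) :=
  ⟨⟨Ψ, fun x hx => ⟨hΨ x hx, rfl⟩⟩, ⟨Φ, fun a ha => ⟨hΦ a ha, hσ a ha⟩⟩⟩

namespace IsEmbeddedAtlas

variable [ChartedSpace E X] {j : X → V}

theorem isManifold (h : IsEmbeddedAtlas (E := E) j) : IsManifold 𝓘(ℝ, E) ∞ X := by
  refine isManifold_of_contDiffOn _ _ _ fun e e' he he' => ?_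
  obtain ⟨-, Φ, hΦ⟩ := h.isEmbeddedChart e he
  obtain ⟨⟨Ψ, hΨ⟩, -⟩ := h.isEmbeddedChart e' he'
  intro a ha
  simp only [modelWithCornersSelf_coe, modelWithCornersSelf_coe_symm, preimage_id_eq, id_eq,
    range_id, inter_univ, OpenPartialHomeomorph.trans_source, OpenPartialHomeomorph.symm_source,
    mem_inter_iff, mem_preimage] at ha
  obtain ⟨ha1, ha2⟩ := ha
  refine ContDiffAt.contDiffWithinAt ?_
  have h1 : ContDiffAt ℝ ∞ (fun b => Ψ (Φ b)) a := by
    refine ContDiffAt.comp (g := Ψ) (f := Φ) a ?_ (hΦ a ha1).1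
    rw [← (hΦ a ha1).2]
    exact (hΨ _ ha2).1
  refine h1.congr_of_eventuallyEq ?_
  have ho : IsOpen (e.target ∩ e.symm ⁻¹' e'.source) := e.isOpen_inter_preimage_symm e'.open_source
  filter_upwards [ho.mem_nhds ⟨ha1, ha2⟩] with b hb
  exact ((hΨ _ hb.2).2).trans (congrArg Ψ (hΦ b hb.1).2)

theorem contMDiff (h : IsEmbeddedAtlas (E := E) j) : ContMDiff 𝓘(ℝ, E) 𝓘(ℝ, V) ∞ j := by
  have := h.isManifold
  intro x
  obtain ⟨-, Φ, hΦ⟩ := h.isEmbeddedChart _ (chart_mem_atlas E x)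
  have hx := mem_chart_source E x
  have h1 : ContMDiffAt 𝓘(ℝ, E) 𝓘(ℝ, V) ∞ (Φ ∘ chartAt E x) x :=
    (hΦ _ (mem_chart_target E x)).1.contMDiffAt.comp x
      (contMDiffAt_of_mem_maximalAtlas (IsManifold.chart_mem_maximalAtlas x) hx)
  refine h1.congr_of_eventuallyEq ?_
  filter_upwards [(chartAt E x).open_source.mem_nhds hx] with y hy
  rw [comp_apply, ← (hΦ _ ((chartAt E x).map_source hy)).2, (chartAt E x).left_inv hy]

theorem injective_mfderiv (h : IsEmbeddedAtlas (E := E) j) (x : X) :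
    Injective (mfderiv 𝓘(ℝ, E) 𝓘(ℝ, V) j x) := by
  have := h.isManifold
  obtain ⟨⟨Ψ, hΨ⟩, -⟩ := h.isEmbeddedChart _ (chart_mem_atlas E x)
  have hx := mem_chart_source E x
  have he := mdifferentiable_of_mem_maximalAtlas
    (IsManifold.chart_mem_maximalAtlas (I := 𝓘(ℝ, E)) (n := ∞) x)
  have h1 : (chartAt E x : X → E) =ᶠ[nhds x] Ψ ∘ j := by
    filter_upwards [(chartAt E x).open_source.mem_nhds hx] with y hy
    exact (hΨ y hy).2
  have h2 : mfderiv 𝓘(ℝ, E) 𝓘(ℝ, E) (Ψ ∘ j) x =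
      (mfderiv 𝓘(ℝ, V) 𝓘(ℝ, E) Ψ (j x)).comp (mfderiv 𝓘(ℝ, E) 𝓘(ℝ, V) j x) :=
    mfderiv_comp x ((hΨ x hx).1.contMDiffAt.mdifferentiableAt (by simp))
      (h.contMDiff.mdifferentiableAt (by simp))
  have h3 := he.mfderiv_injective hx
  rw [h1.mfderiv_eq] at h3
  intro v w hvw
  apply h3
  rw [h2]
  exact congrArg (mfderiv 𝓘(ℝ, V) 𝓘(ℝ, E) Ψ (j x)) hvw

theorem contMDiffAt_of_comp (h : IsEmbeddedAtlas (E := E) j) {EY : Type*} [NormedAddCommGroup EY]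
    [NormedSpace ℝ EY] {HY : Type*} [TopologicalSpace HY] {IY : ModelWithCorners ℝ EY HY}
    {Y : Type*} [TopologicalSpace Y] [ChartedSpace HY Y] {f : Y → X} {y : Y}
    (hf : ContMDiffAt IY 𝓘(ℝ, V) ∞ (fun y => j (f y)) y) : ContMDiffAt IY 𝓘(ℝ, E) ∞ f y := by
  have := h.isManifold
  have hc : ContinuousAt f y := h.isInducing.continuousAt_iff.mpr hf.continuousAt
  rw [contMDiffAt_iff_target]
  refine ⟨hc, ?_⟩
  obtain ⟨⟨Ψ, hΨ⟩, -⟩ := h.isEmbeddedChart _ (chart_mem_atlas E (f y))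
  have hx := mem_chart_source E (f y)
  have h1 : ContMDiffAt IY 𝓘(ℝ, E) ∞ (Ψ ∘ fun y => j (f y)) y :=
    ContMDiffAt.comp (g := Ψ) (I' := 𝓘(ℝ, V)) y (hΨ _ hx).1.contMDiffAt hf
  refine h1.congr_of_eventuallyEq ?_
  filter_upwards [hc.eventually ((chartAt E (f y)).open_source.mem_nhds hx)] with z hz
  exact (hΨ _ hz).2

end IsEmbeddedAtlas

end EmbeddedAtlas

/-! ### Smooth matrix-valued maps -/

section MatSmooth

variable {EY : Type*} [NormedAddCommGroup EY]
  [NormedSpace ℝ EY] {HY : Type*} [TopologicalSpace HY] {IY : ModelWithCorners ℝ EY HY}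
  {Y : Type*} [TopologicalSpace Y] [ChartedSpace HY Y] {y : Y}
  {l m n : Type*} [Fintype l] [Fintype m] [Fintype n]

/-- A matrix-valued map with smooth entries. -/
def MatSmoothAt (IY : ModelWithCorners ℝ EY HY) (f : Y → Matrix m n ℝ) (y : Y) : Prop :=
  ∀ i j, ContMDiffAt IY 𝓘(ℝ, ℝ) ∞ (fun z => f z i j) y

theorem contMDiffAt_iff_matSmoothAt {f : Y → m → n → ℝ} :
    ContMDiffAt IY 𝓘(ℝ, m → n → ℝ) ∞ f y ↔ MatSmoothAt IY (fun z => Matrix.of (f z)) y := by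
  rw [contMDiffAt_pi_space]
  exact forall_congr' fun i => contMDiffAt_pi_space

namespace MatSmoothAt

theorem const (A : Matrix m n ℝ) : MatSmoothAt IY (fun _ => A) y := fun _ _ => contMDiffAt_const

theorem add {f g : Y → Matrix m n ℝ} (hf : MatSmoothAt IY f y) (hg : MatSmoothAt IY g y) :
    MatSmoothAt IY (fun z => f z + g z) y := fun i j => (hf i j).add (hg i j)

theorem sub {f g : Y → Matrix m n ℝ} (hf : MatSmoothAt IY f y) (hg : MatSmoothAt IY g y) :
    MatSmoothAt IY (fun z => f z - g z) y := fun i j => (hf i j).sub (hg i j)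

theorem transpose {f : Y → Matrix m n ℝ} (hf : MatSmoothAt IY f y) :
    MatSmoothAt IY (fun z => (f z)ᵀ) y := fun i j => hf j i

theorem mul {f : Y → Matrix l m ℝ} {g : Y → Matrix m n ℝ} (hf : MatSmoothAt IY f y)
    (hg : MatSmoothAt IY g y) : MatSmoothAt IY (fun z => f z * g z) y := by
  intro i j
  simp only [Matrix.mul_apply]
  exact contMDiffAt_finsetSum fun k _ => (hf i k).mul (hg k j)

variable [DecidableEq n]

theorem det {f : Y → Matrix n n ℝ} (hf : MatSmoothAt IY f y) :
    ContMDiffAt IY 𝓘(ℝ, ℝ) ∞ (fun z => (f z).det) y := by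
  simp only [Matrix.det_apply']
  exact contMDiffAt_finsetSum fun σ _ =>
    contMDiffAt_const.mul (contMDiffAt_finsetProd fun i _ => hf (σ i) i)

theorem inv {f : Y → Matrix n n ℝ} (hf : MatSmoothAt IY f y) (hdet : (f y).det ≠ 0) :
    MatSmoothAt IY (fun z => (f z)⁻¹) y := by
  intro i j
  simp only [Matrix.inv_def, Ring.inverse_eq_inv', Matrix.smul_apply, smul_eq_mul,
    Matrix.adjugate_apply]
  refine (hf.det.inv₀ hdet).mul (MatSmoothAt.det fun a b => ?_)
  by_cases ha : a = j
  · subst ha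
    simp only [Matrix.updateRow_self]
    exact contMDiffAt_const
  · simp only [Matrix.updateRow_ne ha]
    exact hf a b

end MatSmoothAt

end MatSmooth

/-! ### Matrix groups with Cayley charts -/

/-- The Cayley transform `(A - 1) (A + 1)⁻¹`. -/
noncomputable def cayley (A : Mat6) : Mat6 := (A - 1) * (A + 1)⁻¹

/-- The inverse Cayley transform `(1 + X) (1 - X)⁻¹`. -/
noncomputable def cayleyInv (X : Mat6) : Mat6 := (1 + X) * (1 - X)⁻¹

theorem one_sub_cayley {A : Mat6} (hA : (A + 1).det ≠ 0) :
    1 - cayley A = (2 : ℝ) • (A + 1)⁻¹ := by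
  have h : (A + 1) * (A + 1)⁻¹ = 1 := Matrix.mul_nonsing_inv _ hA.isUnit
  conv_lhs => rw [← h, cayley, ← sub_mul]
  rw [show A + 1 - (A - 1) = (2 : ℝ) • (1 : Mat6) by module, smul_mul_assoc, one_mul]

theorem det_one_sub_cayley {A : Mat6} (hA : (A + 1).det ≠ 0) : (1 - cayley A).det ≠ 0 := by
  rw [one_sub_cayley hA, Matrix.det_smul, Matrix.det_nonsing_inv, Ring.inverse_eq_inv']
  exact mul_ne_zero (by norm_num) (inv_ne_zero hA)

theorem cayleyInv_cayley {A : Mat6} (hA : (A + 1).det ≠ 0) : cayleyInv (cayley A) = A := by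
  have h : (A + 1) * (A + 1)⁻¹ = 1 := Matrix.mul_nonsing_inv _ hA.isUnit
  have h1 : 1 + cayley A = A * (1 - cayley A) := by
    rw [one_sub_cayley hA]
    conv_lhs => rw [← h, cayley, ← add_mul]
    rw [show A + 1 + (A - 1) = (2 : ℝ) • A by module, smul_mul_assoc, mul_smul_comm]
  rw [cayleyInv, h1, mul_assoc, Matrix.mul_nonsing_inv _ (det_one_sub_cayley hA).isUnit, mul_one]

theorem cayleyInv_add_one {X : Mat6} (hX : (1 - X).det ≠ 0) :
    cayleyInv X + 1 = (2 : ℝ) • (1 - X)⁻¹ := by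
  have h : (1 - X) * (1 - X)⁻¹ = 1 := Matrix.mul_nonsing_inv _ hX.isUnit
  conv_lhs => rw [← h, cayleyInv, ← add_mul]
  rw [show 1 + X + (1 - X) = (2 : ℝ) • (1 : Mat6) by module, smul_mul_assoc, one_mul]

theorem det_cayleyInv_add_one {X : Mat6} (hX : (1 - X).det ≠ 0) : (cayleyInv X + 1).det ≠ 0 := by
  rw [cayleyInv_add_one hX, Matrix.det_smul, Matrix.det_nonsing_inv, Ring.inverse_eq_inv']
  exact mul_ne_zero (by norm_num) (inv_ne_zero hX)

theorem cayley_cayleyInv {X : Mat6} (hX : (1 - X).det ≠ 0) : cayley (cayleyInv X) = X := by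
  have h : (1 - X) * (1 - X)⁻¹ = 1 := Matrix.mul_nonsing_inv _ hX.isUnit
  have h1 : cayleyInv X - 1 = X * (cayleyInv X + 1) := by
    rw [cayleyInv_add_one hX]
    conv_lhs => rw [← h, cayleyInv, ← sub_mul]
    rw [show 1 + X - (1 - X) = (2 : ℝ) • X by module, smul_mul_assoc, mul_smul_comm]
  rw [cayley, h1, mul_assoc, Matrix.mul_nonsing_inv _ (det_cayleyInv_add_one hX).isUnit, mul_one]

/-- The entries of a matrix. -/
def matEntries (A : Mat6) : Fin 3 ⊕ Fin 3 → Fin 3 ⊕ Fin 3 → ℝ := fun i j => A i j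

theorem of_matEntries (A : Mat6) : Matrix.of (matEntries A) = A := rfl

/-- A group of matrices that is parametrized near the identity by the Cayley transform of a vector
space. -/
structure IsCayleyGroup {H : Type*} [Group H] [TopologicalSpace H] {E : Type*}
    [NormedAddCommGroup E] [NormedSpace ℝ E] (j : H →* Mat6) (ι : E →ₗ[ℝ] Mat6)
    (ρ : Mat6 →ₗ[ℝ] E) : Prop where
  isInducing : Topology.IsInducing fun h => matEntries (j h)
  injective : Injective j
  left_inv : ∀ a, ρ (ι a) = a
  cayley_mem : ∀ h, (j h + 1).det ≠ 0 → ι (ρ (cayley (j h))) = cayley (j h)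
  exists_eq : ∀ a, (1 - ι a).det ≠ 0 → ∃ h, j h = cayleyInv (ι a)

namespace IsCayleyGroup

variable {H : Type*} [Group H] [TopologicalSpace H] {E : Type*}
    [NormedAddCommGroup E] [NormedSpace ℝ E] [FiniteDimensional ℝ E] {j : H →* Mat6}
    {ι : E →ₗ[ℝ] Mat6} {ρ : Mat6 →ₗ[ℝ] E}

theorem matSmoothAt_linearMap (ι : E →ₗ[ℝ] Mat6) (a : E) : MatSmoothAt 𝓘(ℝ, E) (fun a => ι a) a := by
  intro i k
  let φ : E →ₗ[ℝ] ℝ := (LinearMap.proj k ∘ₗ LinearMap.proj (R := ℝ) (φ := fun _ => Fin 3 ⊕ Fin 3 → ℝ) i) ∘ₗ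
    (Matrix.ofLinearEquiv ℝ).symm.toLinearMap ∘ₗ ι
  exact (LinearMap.toContinuousLinearMap φ).contDiff.contDiffAt.contMDiffAt

theorem contDiffAt_comp_linearMap (ρ : Mat6 →ₗ[ℝ] E)
    {f : (Fin 3 ⊕ Fin 3 → Fin 3 ⊕ Fin 3 → ℝ) → Mat6} {v : Fin 3 ⊕ Fin 3 → Fin 3 ⊕ Fin 3 → ℝ}
    (hf : MatSmoothAt 𝓘(ℝ, Fin 3 ⊕ Fin 3 → Fin 3 ⊕ Fin 3 → ℝ) f v) :
    ContDiffAt ℝ ∞ (fun v => ρ (f v)) v := by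
  let φ : (Fin 3 ⊕ Fin 3 → Fin 3 ⊕ Fin 3 → ℝ) →ₗ[ℝ] E := ρ ∘ₗ (Matrix.ofLinearEquiv ℝ).toLinearMap
  have h1 : ContDiffAt ℝ ∞ (fun v => matEntries (f v)) v :=
    (contMDiffAt_iff_matSmoothAt (f := fun v => matEntries (f v)).mpr hf).contDiffAt
  exact (LinearMap.toContinuousLinearMap φ).contDiff.contDiffAt.comp v h1

theorem matSmoothAt_of (v : Fin 3 ⊕ Fin 3 → Fin 3 ⊕ Fin 3 → ℝ) :
    MatSmoothAt 𝓘(ℝ, Fin 3 ⊕ Fin 3 → Fin 3 ⊕ Fin 3 → ℝ) (fun v => Matrix.of v) v :=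
  contMDiffAt_iff_matSmoothAt.mp contMDiffAt_id

variable (h : IsCayleyGroup j ι ρ)

open Classical in
/-- The Cayley chart around an element of the group. -/
noncomputable def chart (h₀ : H) : OpenPartialHomeomorph H E :=
  embeddedChart (j := fun h => matEntries (j h)) h.isInducing {x | (j (h₀⁻¹ * x) + 1).det ≠ 0}
    {a | (1 - ι a).det ≠ 0}
    (fun v => ρ (cayley (j h₀⁻¹ * Matrix.of v))) (fun a => matEntries (j h₀ * cayleyInv (ι a)))
    (fun a => h₀ * if ha : (1 - ι a).det ≠ 0 then (h.exists_eq a ha).choose else 1)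
    (by
      have h1 : Continuous fun v : Fin 3 ⊕ Fin 3 → Fin 3 ⊕ Fin 3 → ℝ =>
          (j h₀⁻¹ * Matrix.of v + 1).det := by
        rw [continuous_iff_continuousAt]
        exact fun v => (((MatSmoothAt.const _).mul (matSmoothAt_of v)).add (.const 1)).det.continuousAt
      have h2 : Continuous fun x => (j (h₀⁻¹ * x) + 1).det := by
        have h3 := h1.comp h.isInducing.continuous
        simp only [comp_def, of_matEntries] at h3
        simpa only [map_mul] using h3
      exact isOpen_ne_fun h2 continuous_const)
    (by
      have h1 : Continuous fun a : E => (1 - ι a).det := by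
        rw [continuous_iff_continuousAt]
        exact fun a => ((MatSmoothAt.const 1).sub (matSmoothAt_linearMap ι a)).det.continuousAt
      exact isOpen_compl_singleton.preimage h1)
    (by
      intro x hx
      rw [mem_ofPred_eq, map_mul] at hx
      have h1 := (MatSmoothAt.const (IY := 𝓘(ℝ, Fin 3 ⊕ Fin 3 → Fin 3 ⊕ Fin 3 → ℝ)) (j h₀⁻¹)).mul
        (matSmoothAt_of (matEntries (j x)))
      exact contDiffAt_comp_linearMap ρ ((h1.sub (.const 1)).mul ((h1.add (.const 1)).inv hx)))
    (by
      intro a ha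
      have h1 := matSmoothAt_linearMap ι a
      exact (contMDiffAt_iff_matSmoothAt (f := fun a => matEntries (j h₀ * cayleyInv (ι a)))).mpr
        ((MatSmoothAt.const _).mul (((MatSmoothAt.const 1).add h1).mul
          (((MatSmoothAt.const 1).sub h1).inv ha))) |>.contDiffAt)
    (by
      intro a ha
      change (1 - ι a).det ≠ 0 at ha
      rw [dif_pos ha, map_mul, (h.exists_eq a ha).choose_spec])
    (by
      intro x hx
      rw [mem_ofPred_eq] at hx ⊢
      rw [of_matEntries, ← map_mul, h.cayley_mem _ hx]
      exact det_one_sub_cayley hx)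
    (by
      intro a ha
      change (1 - ι a).det ≠ 0 at ha
      rw [mem_ofPred_eq, dif_pos ha, inv_mul_cancel_left, (h.exists_eq a ha).choose_spec]
      exact det_cayleyInv_add_one ha)
    (by
      intro x hx
      rw [mem_ofPred_eq] at hx
      have h1 : (1 - ι (ρ (cayley (j h₀⁻¹ * Matrix.of (matEntries (j x)))))).det ≠ 0 := by
        rw [of_matEntries, ← map_mul, h.cayley_mem _ hx]
        exact det_one_sub_cayley hx
      rw [dif_pos h1, ← eq_inv_mul_iff_mul_eq]
      apply h.injective
      rw [(h.exists_eq _ h1).choose_spec, of_matEntries, ← map_mul, h.cayley_mem _ hx,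
        cayleyInv_cayley hx])
    (by
      intro a ha
      rw [of_matEntries, ← mul_assoc, ← map_mul, inv_mul_cancel, map_one, one_mul,
        cayley_cayleyInv ha, h.left_inv])

theorem isEmbeddedChart_chart (h₀ : H) :
    IsEmbeddedChart (fun h => matEntries (j h)) (h.chart h₀) :=
  isEmbeddedChart_embeddedChart _ _ _ _ _ _ _ _ _ _ _ _ _ _ _

theorem mem_chart_source (h₀ : H) : h₀ ∈ (h.chart h₀).source := by
  change (j (h₀⁻¹ * h₀) + 1).det ≠ 0
  rw [inv_mul_cancel, map_one, ← two_smul ℝ (1 : Mat6), Matrix.det_smul, Matrix.det_one]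
  norm_num

/-- The charted space structure of a group of matrices given by the Cayley transform. -/
@[reducible]
noncomputable def chartedSpace : ChartedSpace E H where
  atlas := range h.chart
  chartAt := h.chart
  mem_chart_source := h.mem_chart_source
  chart_mem_atlas := mem_range_self

theorem isEmbeddedAtlas :
    letI := h.chartedSpace
    IsEmbeddedAtlas (E := E) (fun h => matEntries (j h)) := by
  let _ := h.chartedSpace
  refine ⟨h.isInducing, ?_⟩
  rintro e ⟨h₀, rfl⟩
  exact h.isEmbeddedChart_chart h₀

theorem lieGroup : letI := h.chartedSpace
    LieGroup 𝓘(ℝ, E) ∞ H := by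
  let _ := h.chartedSpace
  have hE := h.isEmbeddedAtlas
  have := hE.isManifold
  have hj : ∀ x, MatSmoothAt 𝓘(ℝ, E) (fun h => j h) x := fun x =>
    contMDiffAt_iff_matSmoothAt.mp (hE.contMDiff x)
  have hinv : ∀ x, j x⁻¹ = (j x)⁻¹ := fun x => by
    refine (Matrix.inv_eq_left_inv ?_).symm
    rw [← map_mul, inv_mul_cancel, map_one]
  have hdet : ∀ x, (j x).det ≠ 0 := fun x => by
    refine left_ne_zero_of_mul (b := (j x⁻¹).det) ?_
    rw [← Matrix.det_mul, ← map_mul, mul_inv_cancel, map_one, Matrix.det_one]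
    exact one_ne_zero
  exact
    { contMDiff_mul := by
        intro p
        apply hE.contMDiffAt_of_comp
        rw [contMDiffAt_iff_matSmoothAt]
        simp only [map_mul, of_matEntries]
        exact MatSmoothAt.mul (fun i k => (hj p.1 i k).comp p contMDiffAt_fst)
          (fun i k => (hj p.2 i k).comp p contMDiffAt_snd)
      contMDiff_inv := by
        intro x
        apply hE.contMDiffAt_of_comp
        rw [contMDiffAt_iff_matSmoothAt]
        simp only [hinv, of_matEntries]
        exact (hj x).inv (hdet x) }

end IsCayleyGroup

/-! ### The symplectic group and the stabilizer of the flag as Lie groups -/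

theorem cayley_mem_sp {A : Mat6} (hA : A ∈ Matrix.symplecticGroup (Fin 3) ℝ)
    (h : (A + 1).det ≠ 0) : cayley A ∈ LieAlgebra.Symplectic.sp (Fin 3) ℝ := by
  have hJ := SymplecticGroup.mem_iff'.mp hA
  have h1 : (A + 1) * (A + 1)⁻¹ = 1 := Matrix.mul_nonsing_inv _ h.isUnit
  have h2 : ((A + 1)⁻¹)ᵀ * (Aᵀ + 1) = 1 := by
    have := congrArg Matrix.transpose h1
    rwa [Matrix.transpose_mul, Matrix.transpose_add, Matrix.transpose_one] at this
  have h3 : (Aᵀ - 1) * Matrix.J (Fin 3) ℝ * (A + 1) =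
      -((Aᵀ + 1) * Matrix.J (Fin 3) ℝ * (A - 1)) := by
    simp only [sub_mul, add_mul, mul_add, mul_sub, hJ, one_mul, mul_one]
    abel
  rw [mem_sp_iff_transpose_mul, cayley, Matrix.transpose_mul, Matrix.transpose_sub,
    Matrix.transpose_one]
  calc ((A + 1)⁻¹)ᵀ * (Aᵀ - 1) * Matrix.J (Fin 3) ℝ
      = ((A + 1)⁻¹)ᵀ * ((Aᵀ - 1) * Matrix.J (Fin 3) ℝ * (A + 1)) * (A + 1)⁻¹ := by
        simp only [mul_assoc, h1, mul_one]
    _ = -((((A + 1)⁻¹)ᵀ * (Aᵀ + 1)) * Matrix.J (Fin 3) ℝ * (A - 1) * (A + 1)⁻¹) := by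
        rw [h3]
        simp only [mul_neg, neg_mul, mul_assoc]
    _ = -(Matrix.J (Fin 3) ℝ * ((A - 1) * (A + 1)⁻¹)) := by
        rw [h2, one_mul, mul_assoc]

theorem cayleyInv_mem_symplecticGroup {X : Mat6} (hX : X ∈ LieAlgebra.Symplectic.sp (Fin 3) ℝ)
    (h : (1 - X).det ≠ 0) : cayleyInv X ∈ Matrix.symplecticGroup (Fin 3) ℝ := by
  have hJ := mem_sp_iff_transpose_mul.mp hX
  have h1 : (1 - X) * (1 - X)⁻¹ = 1 := Matrix.mul_nonsing_inv _ h.isUnit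
  have h2 : ((1 - X)⁻¹)ᵀ * (1 - Xᵀ) = 1 := by
    have := congrArg Matrix.transpose h1
    rwa [Matrix.transpose_mul, Matrix.transpose_sub, Matrix.transpose_one] at this
  have h3 : (1 + Xᵀ) * Matrix.J (Fin 3) ℝ * (1 + X) =
      (1 - Xᵀ) * Matrix.J (Fin 3) ℝ * (1 - X) := by
    simp only [sub_mul, add_mul, mul_add, mul_sub, hJ, one_mul, mul_one, neg_mul]
    abel
  rw [SymplecticGroup.mem_iff', cayleyInv, Matrix.transpose_mul, Matrix.transpose_add,
    Matrix.transpose_one]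
  calc ((1 - X)⁻¹)ᵀ * (1 + Xᵀ) * Matrix.J (Fin 3) ℝ * ((1 + X) * (1 - X)⁻¹)
      = ((1 - X)⁻¹)ᵀ * ((1 + Xᵀ) * Matrix.J (Fin 3) ℝ * (1 + X)) * (1 - X)⁻¹ := by
        simp only [mul_assoc]
    _ = (((1 - X)⁻¹)ᵀ * (1 - Xᵀ)) * Matrix.J (Fin 3) ℝ * ((1 - X) * (1 - X)⁻¹) := by
        rw [h3]
        simp only [mul_assoc]
    _ = Matrix.J (Fin 3) ℝ := by rw [h1, h2, one_mul, mul_one]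

/-- The matrices that are block triangular with respect to the weights. -/
def IsMongeTriangular (M : Mat6) : Prop := M.BlockTriangular fun i => -mongeWeight i

theorem isMongeTriangular_iff {M : Mat6} :
    IsMongeTriangular M ↔ ∀ i j, mongeWeight i < mongeWeight j → M i j = 0 := by
  rw [IsMongeTriangular, Matrix.BlockTriangular]
  simp only [neg_lt_neg_iff]

theorem IsMongeTriangular.mul {M N : Mat6} (hM : IsMongeTriangular M) (hN : IsMongeTriangular N) :
    IsMongeTriangular (M * N) := Matrix.BlockTriangular.mul hM hN

theorem IsMongeTriangular.inv {M : Mat6} (hM : IsMongeTriangular M) (h : M.det ≠ 0) :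
    IsMongeTriangular M⁻¹ := by
  have := M.invertibleOfIsUnitDet h.isUnit
  exact Matrix.blockTriangular_inv_of_blockTriangular hM

theorem isMongeTriangular_one : IsMongeTriangular 1 := Matrix.blockTriangular_one

theorem IsMongeTriangular.cayley {M : Mat6} (hM : IsMongeTriangular M) (h : (M + 1).det ≠ 0) :
    IsMongeTriangular (cayley M) :=
  IsMongeTriangular.mul (Matrix.BlockTriangular.sub hM isMongeTriangular_one)
    (IsMongeTriangular.inv (Matrix.BlockTriangular.add hM isMongeTriangular_one) h)

theorem IsMongeTriangular.cayleyInv {M : Mat6} (hM : IsMongeTriangular M)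
    (h : (1 - M).det ≠ 0) : IsMongeTriangular (cayleyInv M) :=
  IsMongeTriangular.mul (Matrix.BlockTriangular.add isMongeTriangular_one hM)
    (IsMongeTriangular.inv (Matrix.BlockTriangular.sub isMongeTriangular_one hM) h)

theorem Sp3.coe_det_ne_zero (g : Sp3) : (g : Mat6).det ≠ 0 :=
  (SymplecticGroup.symplectic_det g.2).ne_zero

theorem Sp3.mem_stab {N : Submodule ℝ (Fin 3 ⊕ Fin 3 → ℝ)} {g : Sp3} :
    g ∈ Sp3.stab N ↔ N.map (Matrix.toLin' (g : Mat6)) = N := Iff.rfl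

theorem Sp3.map_le_of_mem_stab {N : Submodule ℝ (Fin 3 ⊕ Fin 3 → ℝ)} {g : Sp3}
    (h : g ∈ Sp3.stab N) {v : Fin 3 ⊕ Fin 3 → ℝ} (hv : v ∈ N) : (g : Mat6) *ᵥ v ∈ N := by
  rw [← Sp3.mem_stab.mp h]
  exact ⟨v, hv, Matrix.toLin'_apply _ _⟩

theorem mem_flagN1 {v : Fin 3 ⊕ Fin 3 → ℝ} : v ∈ flagN1 ↔ ∀ i, mongeWeight i < 3 → v i = 0 := by
  rw [flagN1, Submodule.mem_span_pair]
  constructor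
  · rintro ⟨a, b, rfl⟩
    simp [Fin.forall_fin_succ, mongeWeight]
  · intro h
    refine ⟨v (.inl 0), v (.inl 1), ?_⟩
    simp [Fin.forall_fin_succ, mongeWeight] at h
    ext i
    rcases i with i | i <;> fin_cases i <;> simp [h]

theorem mem_flagN2 {v : Fin 3 ⊕ Fin 3 → ℝ} : v ∈ flagN2 ↔ ∀ i, mongeWeight i < 1 → v i = 0 := by
  rw [flagN2, Submodule.mem_span_triple]
  constructor
  · rintro ⟨a, b, c, rfl⟩
    simp [Fin.forall_fin_succ, mongeWeight]
  · intro h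
    refine ⟨v (.inl 0), v (.inl 1), v (.inl 2), ?_⟩
    simp [Fin.forall_fin_succ, mongeWeight] at h
    ext i
    rcases i with i | i <;> fin_cases i <;> simp [h]

theorem Sp3.mem_stab_of_map_le {N : Submodule ℝ (Fin 3 ⊕ Fin 3 → ℝ)} {g : Sp3}
    (h : ∀ v ∈ N, (g : Mat6) *ᵥ v ∈ N) : g ∈ Sp3.stab N := by
  have hinj : Injective (Matrix.toLin' (g : Mat6)) :=
    Matrix.mulVec_injective_iff_isUnit.mpr
      ((Matrix.isUnit_iff_isUnit_det _).mpr g.coe_det_ne_zero.isUnit)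
  refine Submodule.eq_of_le_of_finrank_eq ?_
    (Submodule.equivMapOfInjective _ hinj N).finrank_eq.symm
  rintro _ ⟨v, hv, rfl⟩
  rw [Matrix.toLin'_apply]
  exact h v hv

theorem mem_flagStabilizer_of_pos {g : Sp3}
    (h : ∀ i j, 0 < mongeWeight j → mongeWeight i < mongeWeight j → (g : Mat6) i j = 0) :
    g ∈ flagStabilizer := by
  have key : ∀ r : ℤ, 0 < r → ∀ v : Fin 3 ⊕ Fin 3 → ℝ,
      (∀ i, mongeWeight i < r → v i = 0) → ∀ i, mongeWeight i < r → ((g : Mat6) *ᵥ v) i = 0 := by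
    intro r hr v hv i hi
    rw [Matrix.mulVec, dotProduct]
    refine Finset.sum_eq_zero fun k _ => ?_
    rcases lt_or_ge (mongeWeight k) r with hk | hk
    · rw [hv k hk, mul_zero]
    · rw [h i k (by omega) (by omega), zero_mul]
  exact ⟨Sp3.mem_stab_of_map_le fun v hv => mem_flagN1.mpr (key 3 (by norm_num) v (mem_flagN1.mp hv)),
    Sp3.mem_stab_of_map_le fun v hv => mem_flagN2.mpr (key 1 (by norm_num) v (mem_flagN2.mp hv))⟩

theorem Sp3.inv_apply (g : Sp3) (i j : Fin 3) :
    ((g⁻¹ : Sp3) : Mat6) (.inl i) (.inl j) = (g : Mat6) (.inr j) (.inr i) := by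
  rw [SymplecticGroup.coe_inv, Matrix.J]
  conv_lhs => rw [← Matrix.fromBlocks_toBlocks (g : Mat6)]
  rw [Matrix.fromBlocks_neg, Matrix.fromBlocks_transpose, Matrix.fromBlocks_multiply,
    Matrix.fromBlocks_multiply]
  simp [Matrix.toBlocks₂₂]

theorem mongeWeight_inl_pos (i : Fin 3) : 0 < mongeWeight (.inl i) := by
  revert i
  decide

theorem mem_flagStabilizer {g : Sp3} : g ∈ flagStabilizer ↔ IsMongeTriangular (g : Mat6) := by
  constructor
  · rintro ⟨h1, h2⟩
    have hN1 : ∀ h ∈ Sp3.stab flagN1, ∀ i j, mongeWeight j = 3 → mongeWeight i < 3 →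
        (h : Mat6) i j = 0 := by
      intro h hh i j hj hi
      have hv : (Pi.single j 1 : Fin 3 ⊕ Fin 3 → ℝ) ∈ flagN1 := by
        rw [mem_flagN1]
        intro k hk
        rw [Pi.single_apply, if_neg]
        rintro rfl
        omega
      have := mem_flagN1.mp (Sp3.map_le_of_mem_stab hh hv) i hi
      rwa [Matrix.mulVec_single_one] at this
    have hN2 : ∀ i j, mongeWeight j = 1 → mongeWeight i < 1 → (g : Mat6) i j = 0 := by
      intro i j hj hi
      have hv : (Pi.single j 1 : Fin 3 ⊕ Fin 3 → ℝ) ∈ flagN2 := by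
        rw [mem_flagN2]
        intro k hk
        rw [Pi.single_apply, if_neg]
        rintro rfl
        omega
      have := mem_flagN2.mp (Sp3.map_le_of_mem_stab h2 hv) i hi
      rwa [Matrix.mulVec_single_one] at this
    rw [isMongeTriangular_iff]
    intro i j hij
    have hw : ∀ k, mongeWeight k = 3 ∨ mongeWeight k = 1 ∨ mongeWeight k = -1 ∨
      mongeWeight k = -3 := by decide
    rcases hw j with hj | hj | hj | hj
    · exact hN1 g h1 i j hj (by omega)
    · exact hN2 i j hj (by omega)
    · rcases j with j | j
      · have := mongeWeight_inl_pos j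
        omega
      rcases i with i | i
      · have := mongeWeight_inl_pos i
        omega
      rw [← Sp3.inv_apply]
      simp only [mongeWeight_inr] at hj hij
      refine hN1 _ (inv_mem h1) _ _ ?_ ?_
      · rcases hw (.inl i) with h | h | h | h <;> omega
      · omega
    · have := hw i
      omega
  · exact fun h => mem_flagStabilizer_of_pos fun i j _ hij => isMongeTriangular_iff.mp h i j hij

/-- The coordinates of the Lie algebra. -/
noncomputable def spParam : EuclideanSpace ℝ (Fin 21) →ₗ[ℝ] Mat6 where
  toFun p := spMatrix p
  map_add' p q := by
    rw [← Matrix.ext_iff]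
    simp [Fin.forall_fin_succ, spMatrix]
    ring_nf
    simp
  map_smul' r p := by
    rw [← Matrix.ext_iff]
    simp [Fin.forall_fin_succ, spMatrix]

noncomputable def spParamInv : Mat6 →ₗ[ℝ] EuclideanSpace ℝ (Fin 21) where
  toFun X := WithLp.toLp 2 (spCoord X)
  map_add' X Y := by
    ext i
    fin_cases i <;> rfl
  map_smul' r X := by
    ext i
    fin_cases i <;> rfl

theorem isCayleyGroup_sp3 : IsCayleyGroup (Submonoid.subtype (Matrix.symplecticGroup (Fin 3) ℝ))
    spParam spParamInv where
  isInducing := Topology.IsInducing.subtypeVal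
  injective := Subtype.val_injective
  left_inv a := by
    change WithLp.toLp 2 (spCoord (spMatrix a)) = a
    rw [spCoord_spMatrix]
  cayley_mem g hg := (LieSp3.eq_spMatrix ⟨_, cayley_mem_sp g.2 hg⟩).symm
  exists_eq a ha := ⟨⟨_, cayleyInv_mem_symplecticGroup (spMatrix_mem_sp _) ha⟩, rfl⟩

/-- The coordinates of the Lie algebra of the stabilizer of the flag. -/
noncomputable def flagParam : EuclideanSpace ℝ (Fin 13) →ₗ[ℝ] Mat6 where
  toFun p := spMatrix ![p 0, p 1, p 2, p 3, p 4, p 5, 0, 0, p 6, p 7, p 8, p 9, p 10, p 11, p 12,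
    0, 0, 0, 0, 0, 0]
  map_add' p q := by
    rw [← Matrix.ext_iff]
    simp [Fin.forall_fin_succ, spMatrix]
    ring_nf
    simp
  map_smul' r p := by
    rw [← Matrix.ext_iff]
    simp [Fin.forall_fin_succ, spMatrix]

noncomputable def flagParamInv : Mat6 →ₗ[ℝ] EuclideanSpace ℝ (Fin 13) where
  toFun X := !₂[X (.inl 0) (.inl 0), X (.inl 0) (.inl 1), X (.inl 0) (.inl 2),
    X (.inl 1) (.inl 0), X (.inl 1) (.inl 1), X (.inl 1) (.inl 2), X (.inl 2) (.inl 2),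
    X (.inl 0) (.inr 0), X (.inl 0) (.inr 1), X (.inl 0) (.inr 2), X (.inl 1) (.inr 1),
    X (.inl 1) (.inr 2), X (.inl 2) (.inr 2)]
  map_add' X Y := by
    ext i
    fin_cases i <;> rfl
  map_smul' r X := by
    ext i
    fin_cases i <;> rfl

theorem isMongeTriangular_flagParam (a : EuclideanSpace ℝ (Fin 13)) :
    IsMongeTriangular (flagParam a) := by
  rw [isMongeTriangular_iff]
  simp [Fin.forall_fin_succ, flagParam, spMatrix, mongeWeight]

theorem flagParam_flagParamInv (X : LieSp3) (hX : IsMongeTriangular (X : Mat6)) :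
    flagParam (flagParamInv X) = X := by
  rw [isMongeTriangular_iff] at hX
  conv_rhs => rw [X.eq_spMatrix]
  refine congrArg spMatrix ?_
  rw [spCoord, hX (.inl 2) (.inl 0) (by decide), hX (.inl 2) (.inl 1) (by decide),
    hX (.inr 0) (.inl 0) (by decide), hX (.inr 0) (.inl 1) (by decide),
    hX (.inr 0) (.inl 2) (by decide), hX (.inr 1) (.inl 1) (by decide),
    hX (.inr 1) (.inl 2) (by decide), hX (.inr 2) (.inl 2) (by decide)]
  rfl

theorem isCayleyGroup_flagStabilizer : IsCayleyGroup
    ((Submonoid.subtype (Matrix.symplecticGroup (Fin 3) ℝ)).comp flagStabilizer.subtype)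
    flagParam flagParamInv where
  isInducing := Topology.IsInducing.subtypeVal.comp Topology.IsInducing.subtypeVal
  injective := Subtype.val_injective.comp Subtype.val_injective
  left_inv a := by
    ext i
    fin_cases i <;> rfl
  cayley_mem g hg := flagParam_flagParamInv ⟨_, cayley_mem_sp g.1.2 hg⟩
    ((mem_flagStabilizer.mp g.2).cayley hg)
  exists_eq a ha := ⟨⟨⟨_, cayleyInv_mem_symplecticGroup (spMatrix_mem_sp _) ha⟩,
    mem_flagStabilizer.mpr ((isMongeTriangular_flagParam a).cayleyInv ha)⟩, rfl⟩

noncomputable instance Sp3.instChartedSpace : ChartedSpace (EuclideanSpace ℝ (Fin 21)) Sp3 :=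
  isCayleyGroup_sp3.chartedSpace

noncomputable instance flagStabilizer.instChartedSpace :
    ChartedSpace (EuclideanSpace ℝ (Fin 13)) flagStabilizer :=
  isCayleyGroup_flagStabilizer.chartedSpace

instance Sp3.instLieGroup : LieGroup (𝓡 21) ∞ Sp3 := isCayleyGroup_sp3.lieGroup

instance flagStabilizer.instLieGroup : LieGroup (𝓡 13) ∞ flagStabilizer :=
  isCayleyGroup_flagStabilizer.lieGroup

theorem Sp3.isEmbeddedAtlas : IsEmbeddedAtlas (E := EuclideanSpace ℝ (Fin 21)) Sp3.entries :=
  isCayleyGroup_sp3.isEmbeddedAtlas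

theorem flagStabilizer.isEmbeddedAtlas : IsEmbeddedAtlas (E := EuclideanSpace ℝ (Fin 13))
    fun p : flagStabilizer => Sp3.entries p :=
  isCayleyGroup_flagStabilizer.isEmbeddedAtlas

theorem flagStabilizer.contMDiff_coe :
    ContMDiff (𝓡 13) (𝓡 21) ∞ (fun p : flagStabilizer => (p : Sp3)) :=
  fun p => Sp3.isEmbeddedAtlas.contMDiffAt_of_comp (flagStabilizer.isEmbeddedAtlas.contMDiff p)

theorem flagStabilizer.injective_mfderiv_coe (p : flagStabilizer) :
    Injective (mfderiv (𝓡 13) (𝓡 21) (fun p : flagStabilizer => (p : Sp3)) p) := by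
  have h := flagStabilizer.isEmbeddedAtlas.injective_mfderiv p
  have h2 := mfderiv_comp (I := 𝓡 13) (I' := 𝓡 21)
    (I'' := 𝓘(ℝ, Fin 3 ⊕ Fin 3 → Fin 3 ⊕ Fin 3 → ℝ)) p
    (Sp3.isEmbeddedAtlas.contMDiff.mdifferentiableAt (by simp) (x := (p : Sp3)))
    (flagStabilizer.contMDiff_coe.mdifferentiableAt (by simp) (x := p))
  intro v w hvw
  apply h
  refine (congrArg (fun l => l v) h2).trans (Eq.trans ?_ (congrArg (fun l => l w) h2).symm)
  exact congrArg (mfderiv (𝓡 21) 𝓘(ℝ, Fin 3 ⊕ Fin 3 → Fin 3 ⊕ Fin 3 → ℝ) Sp3.entries (p : Sp3)) hvw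

/-! ### The big cell of the flag manifold -/

/-- The upper left block of a matrix. -/
abbrev ulBlock (m : Mat6) : Matrix (Fin 3) (Fin 3) ℝ := m.toBlocks₁₁

/-- The lower left block of a matrix. -/
abbrev llBlock (m : Mat6) : Matrix (Fin 3) (Fin 3) ℝ := m.toBlocks₂₁

/-- The minor of the first two rows and columns. -/
def ulMinor (A : Matrix (Fin 3) (Fin 3) ℝ) : ℝ := A 0 0 * A 1 1 - A 0 1 * A 1 0

/-- The matrices in the big cell. -/
def bigCell : Set Mat6 := {m | (ulBlock m).det ≠ 0 ∧ ulMinor (ulBlock m) ≠ 0}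

/-- The coordinates on the big cell. -/
noncomputable def cellCoord (m : Mat6) : Fin 8 → ℝ :=
  ![(llBlock m * (ulBlock m)⁻¹) 2 2, (llBlock m * (ulBlock m)⁻¹) 2 0,
    (llBlock m * (ulBlock m)⁻¹) 2 1,
    (ulBlock m 2 1 * ulBlock m 1 0 - ulBlock m 2 0 * ulBlock m 1 1) * (ulMinor (ulBlock m))⁻¹,
    (ulBlock m 2 0 * ulBlock m 0 1 - ulBlock m 2 1 * ulBlock m 0 0) * (ulMinor (ulBlock m))⁻¹,
    (llBlock m * (ulBlock m)⁻¹) 0 0, (llBlock m * (ulBlock m)⁻¹) 0 1,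
    (llBlock m * (ulBlock m)⁻¹) 1 1]

/-- The unipotent matrix with last row `-y₁, -y₂, 1`. -/
def cellL (a : Fin 8 → ℝ) : Matrix (Fin 3) (Fin 3) ℝ := !![1, 0, 0; 0, 1, 0; -a 3, -a 4, 1]

/-- The inverse of `cellL`. -/
def cellLInv (a : Fin 8 → ℝ) : Matrix (Fin 3) (Fin 3) ℝ := !![1, 0, 0; 0, 1, 0; a 3, a 4, 1]

/-- The symmetric matrix of the coordinates `z`, `x` and `t`. -/
def cellK (a : Fin 8 → ℝ) : Matrix (Fin 3) (Fin 3) ℝ :=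
  !![a 5, a 6, a 1; a 6, a 7, a 2; a 1, a 2, a 0]

theorem cellL_mul_cellLInv (a : Fin 8 → ℝ) : cellL a * cellLInv a = 1 := by
  simp [cellL, cellLInv, Matrix.one_fin_three]

theorem cellLInv_mul_cellL (a : Fin 8 → ℝ) : cellLInv a * cellL a = 1 := by
  simp [cellL, cellLInv, Matrix.one_fin_three]

theorem cellK_transpose (a : Fin 8 → ℝ) : (cellK a)ᵀ = cellK a := by
  ext i j
  fin_cases i <;> fin_cases j <;> rfl

/-- The section over the big cell. -/
def cellSection (a : Fin 8 → ℝ) : Mat6 :=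
  Matrix.fromBlocks (cellL a) 0 (cellK a * cellL a) (cellLInv a)ᵀ

/-- The inverse of the section over the big cell. -/
def cellSectionInv (a : Fin 8 → ℝ) : Mat6 :=
  Matrix.fromBlocks (cellLInv a) 0 (-((cellL a)ᵀ * cellK a)) (cellL a)ᵀ

theorem cellSection_mul_cellSectionInv (a : Fin 8 → ℝ) :
    cellSection a * cellSectionInv a = 1 := by
  rw [cellSection, cellSectionInv, Matrix.fromBlocks_multiply, ← Matrix.fromBlocks_one]
  congr 1
  · rw [cellL_mul_cellLInv, Matrix.zero_mul, add_zero]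
  · simp
  · rw [Matrix.mul_assoc, cellL_mul_cellLInv, Matrix.mul_neg, ← Matrix.mul_assoc,
      ← Matrix.transpose_mul, cellL_mul_cellLInv, Matrix.transpose_one, Matrix.one_mul,
      Matrix.mul_one, add_neg_cancel]
  · rw [Matrix.mul_zero, zero_add, ← Matrix.transpose_mul, cellL_mul_cellLInv, Matrix.transpose_one]

theorem cellSection_mem (a : Fin 8 → ℝ) :
    cellSection a ∈ Matrix.symplecticGroup (Fin 3) ℝ := by
  rw [cellSection, SymplecticGroup.fromBlocks_mem_iff]
  refine ⟨?_, ?_, ?_⟩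
  · rw [Matrix.transpose_mul, cellK_transpose, Matrix.mul_assoc]
  · simp
  · rw [← Matrix.transpose_mul, cellLInv_mul_cellL]
    simp

theorem cellSection_mem_bigCell (a : Fin 8 → ℝ) : cellSection a ∈ bigCell := by
  rw [bigCell, mem_ofPred_eq, cellSection, ulBlock, Matrix.toBlocks_fromBlocks₁₁]
  constructor
  · have h := congrArg Matrix.det (cellL_mul_cellLInv a)
    rw [Matrix.det_mul, Matrix.det_one] at h
    exact left_ne_zero_of_mul (h.trans_ne one_ne_zero)
  · simp [ulMinor, cellL]

theorem cellCoord_cellSection (a : Fin 8 → ℝ) : cellCoord (cellSection a) = a := by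
  have h : llBlock (cellSection a) * (ulBlock (cellSection a))⁻¹ = cellK a := by
    rw [cellSection, ulBlock, llBlock, Matrix.toBlocks_fromBlocks₁₁, Matrix.toBlocks_fromBlocks₂₁,
      Matrix.inv_eq_right_inv (cellL_mul_cellLInv a), Matrix.mul_assoc, cellL_mul_cellLInv,
      Matrix.mul_one]
  have h' : ulBlock (cellSection a) = cellL a := by
    rw [cellSection, ulBlock, Matrix.toBlocks_fromBlocks₁₁]
  rw [cellCoord, h, h']
  ext i
  fin_cases i <;> simp [cellK, cellL, ulMinor]

theorem IsMongeTriangular.llBlock_eq_zero {p : Mat6} (hp : IsMongeTriangular p) :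
    llBlock p = 0 := by
  ext i j
  refine isMongeTriangular_iff.mp hp _ _ ?_
  rw [mongeWeight_inr]
  have := mongeWeight_inl_pos i
  have := mongeWeight_inl_pos j
  omega

theorem IsMongeTriangular.ulBlock_apply {p : Mat6} (hp : IsMongeTriangular p) :
    ulBlock p 2 0 = 0 ∧ ulBlock p 2 1 = 0 :=
  ⟨isMongeTriangular_iff.mp hp _ _ (by decide), isMongeTriangular_iff.mp hp _ _ (by decide)⟩

theorem ulBlock_mul {m p : Mat6} (hp : IsMongeTriangular p) :
    ulBlock (m * p) = ulBlock m * ulBlock p := by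
  conv_lhs => rw [← Matrix.fromBlocks_toBlocks m, ← Matrix.fromBlocks_toBlocks p,
    Matrix.fromBlocks_multiply, ulBlock, Matrix.toBlocks_fromBlocks₁₁,
    show p.toBlocks₂₁ = 0 from hp.llBlock_eq_zero, Matrix.mul_zero, add_zero]

theorem llBlock_mul {m p : Mat6} (hp : IsMongeTriangular p) :
    llBlock (m * p) = llBlock m * ulBlock p := by
  conv_lhs => rw [← Matrix.fromBlocks_toBlocks m, ← Matrix.fromBlocks_toBlocks p,
    Matrix.fromBlocks_multiply, llBlock, Matrix.toBlocks_fromBlocks₂₁,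
    show p.toBlocks₂₁ = 0 from hp.llBlock_eq_zero, Matrix.mul_zero, add_zero]

theorem ulMinor_mul {A B : Matrix (Fin 3) (Fin 3) ℝ} (h : B 2 0 = 0 ∧ B 2 1 = 0) :
    ulMinor (A * B) = ulMinor A * ulMinor B := by
  simp only [ulMinor, Matrix.mul_apply, Fin.sum_univ_three, h.1, h.2]
  ring

theorem IsMongeTriangular.mem_bigCell {p : Mat6} (hp : IsMongeTriangular p) (h : p.det ≠ 0) :
    p ∈ bigCell := by
  have h1 : ulBlock p * ulBlock p⁻¹ = 1 := by
    rw [← ulBlock_mul (hp.inv h), Matrix.mul_nonsing_inv _ h.isUnit, ulBlock,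
      ← Matrix.fromBlocks_one, Matrix.toBlocks_fromBlocks₁₁]
  constructor
  · have h2 := congrArg Matrix.det h1
    rw [Matrix.det_mul, Matrix.det_one] at h2
    exact left_ne_zero_of_mul (h2.trans_ne one_ne_zero)
  · have h2 := congrArg ulMinor h1
    rw [ulMinor_mul (hp.inv h).ulBlock_apply] at h2
    refine left_ne_zero_of_mul (h2.trans_ne ?_)
    simp [ulMinor]

theorem mul_mem_bigCell_iff {m p : Mat6} (hp : IsMongeTriangular p) (h : p.det ≠ 0) :
    m * p ∈ bigCell ↔ m ∈ bigCell := by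
  obtain ⟨h1, h2⟩ := hp.mem_bigCell h
  rw [bigCell, mem_ofPred_eq, mem_ofPred_eq, ulBlock_mul hp, Matrix.det_mul,
    ulMinor_mul hp.ulBlock_apply, mul_ne_zero_iff, mul_ne_zero_iff]
  tauto

theorem cellCoord_mul {m p : Mat6} (hp : IsMongeTriangular p) (h : p.det ≠ 0) :
    cellCoord (m * p) = cellCoord m := by
  obtain ⟨h1, h2⟩ := hp.mem_bigCell h
  have h3 : llBlock (m * p) * (ulBlock (m * p))⁻¹ = llBlock m * (ulBlock m)⁻¹ := by
    rw [llBlock_mul hp, ulBlock_mul hp, Matrix.mul_inv_rev, Matrix.mul_assoc,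
      ← Matrix.mul_assoc (ulBlock p), Matrix.mul_nonsing_inv _ h1.isUnit, Matrix.one_mul]
  obtain ⟨h4, h5⟩ := hp.ulBlock_apply
  rw [cellCoord, cellCoord, h3, ulBlock_mul hp, ulMinor_mul hp.ulBlock_apply, mul_inv]
  have h6 : ∀ x y : ℝ, x = y * ulMinor (ulBlock p) →
      x * ((ulMinor (ulBlock m))⁻¹ * (ulMinor (ulBlock p))⁻¹) = y * (ulMinor (ulBlock m))⁻¹ := by
    rintro x y rfl
    field_simp
  congr 3
  congr 1
  · apply h6
    simp only [ulMinor, Matrix.mul_apply, Fin.sum_univ_three, h4, h5]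
    ring
  · congr 1
    apply h6
    simp only [ulMinor, Matrix.mul_apply, Fin.sum_univ_three, h4, h5]
    ring

/-- The section over the big cell, as a map to the group. -/
def spSection (a : EuclideanSpace ℝ (Fin 8)) : Sp3 := ⟨cellSection a, cellSection_mem a⟩

/-- The coordinates of an element of the group in the big cell. -/
noncomputable def spCellCoord (g : Sp3) : EuclideanSpace ℝ (Fin 8) :=
  WithLp.toLp 2 (cellCoord (g : Mat6))

theorem spCellCoord_spSection (a : EuclideanSpace ℝ (Fin 8)) : spCellCoord (spSection a) = a := by
  rw [spCellCoord, spSection, cellCoord_cellSection]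

theorem spCellCoord_mul (g : Sp3) (p : flagStabilizer) :
    spCellCoord (g * p) = spCellCoord g := by
  rw [spCellCoord, Submonoid.coe_mul, cellCoord_mul (mem_flagStabilizer.mp p.2)
    (Sp3.coe_det_ne_zero _), spCellCoord]

theorem coe_spSection_inv (a : EuclideanSpace ℝ (Fin 8)) :
    (((spSection a)⁻¹ : Sp3) : Mat6) = cellSectionInv a := by
  rw [SymplecticGroup.coe_inv']
  exact Matrix.inv_eq_right_inv (cellSection_mul_cellSectionInv a)

theorem Sp3.ulBlock_transpose_mul (g : Sp3) :
    (ulBlock (g : Mat6))ᵀ * llBlock (g : Mat6) = (llBlock (g : Mat6))ᵀ * ulBlock (g : Mat6) := by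
  have h := g.2
  rw [← Matrix.fromBlocks_toBlocks (g : Mat6), SymplecticGroup.fromBlocks_mem_iff] at h
  exact h.1

theorem spSection_inv_mul_mem {g : Sp3} (hg : (g : Mat6) ∈ bigCell) :
    (spSection (spCellCoord g))⁻¹ * g ∈ flagStabilizer := by
  obtain ⟨h1, h2⟩ := hg
  set A := ulBlock (g : Mat6) with hA
  set C := llBlock (g : Mat6) with hC
  have hAA : A * A⁻¹ = 1 := Matrix.mul_nonsing_inv _ h1.isUnit
  have hAA' : A⁻¹ * A = 1 := Matrix.nonsing_inv_mul _ h1.isUnit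
  have hsymm : (C * A⁻¹)ᵀ = C * A⁻¹ := by
    have h3 := g.ulBlock_transpose_mul
    have h4 : (A⁻¹)ᵀ * Aᵀ = 1 := by rw [← Matrix.transpose_mul, hAA, Matrix.transpose_one]
    calc (C * A⁻¹)ᵀ = (A⁻¹)ᵀ * (Cᵀ * A) * A⁻¹ := by
          rw [Matrix.transpose_mul, Matrix.mul_assoc, Matrix.mul_assoc, hAA, Matrix.mul_one]
      _ = ((A⁻¹)ᵀ * Aᵀ) * C * A⁻¹ := by rw [← h3, ← Matrix.mul_assoc]
      _ = C * A⁻¹ := by rw [h4, Matrix.one_mul]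
  have hsymm' : ∀ i j, (C * A⁻¹) i j = (C * A⁻¹) j i := fun i j => congrFun (congrFun hsymm j) i
  have hK : cellK (cellCoord (g : Mat6)) = C * A⁻¹ := by
    ext i j
    fin_cases i <;> fin_cases j <;> first | rfl | exact hsymm' _ _
  have hprod : (((spSection (spCellCoord g))⁻¹ * g : Sp3) : Mat6) =
      Matrix.fromBlocks (cellLInv (cellCoord (g : Mat6))) 0
        (-((cellL (cellCoord (g : Mat6)))ᵀ * cellK (cellCoord (g : Mat6))))
        (cellL (cellCoord (g : Mat6)))ᵀ * Matrix.fromBlocks A (g : Mat6).toBlocks₁₂ C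
          (g : Mat6).toBlocks₂₂ := by
    rw [Submonoid.coe_mul, coe_spSection_inv, Matrix.fromBlocks_toBlocks]
    rfl
  rw [Matrix.fromBlocks_multiply, hK] at hprod
  have hll : -((cellL (cellCoord (g : Mat6)))ᵀ * (C * A⁻¹)) * A +
      (cellL (cellCoord (g : Mat6)))ᵀ * C = 0 := by
    rw [Matrix.neg_mul, Matrix.mul_assoc, Matrix.mul_assoc, hAA', Matrix.mul_one, neg_add_cancel]
  rw [hll] at hprod
  refine mem_flagStabilizer_of_pos fun i j hj hij => ?_
  rw [hprod]
  rcases j with j | j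
  · rcases i with i | i
    · have h3 : cellCoord (g : Mat6) 3 = (A 2 1 * A 1 0 - A 2 0 * A 1 1) * (ulMinor A)⁻¹ := rfl
      have h4 : cellCoord (g : Mat6) 4 = (A 2 0 * A 0 1 - A 2 1 * A 0 0) * (ulMinor A)⁻¹ := rfl
      rw [Matrix.fromBlocks_apply₁₁, Matrix.zero_mul, add_zero, cellLInv, Matrix.mul_apply,
        Fin.sum_univ_three]
      have h5 : ulMinor A * (ulMinor A)⁻¹ = 1 := mul_inv_cancel₀ h2
      rw [ulMinor] at h3 h4 h5
      fin_cases i <;> fin_cases j <;> simp [mongeWeight] at hij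
      · simp [h3, h4]
        linear_combination (-A 2 0) * h5
      · simp [h3, h4]
        linear_combination (-A 2 1) * h5
    · rfl
  · rw [mongeWeight_inr] at hj
    have := mongeWeight_inl_pos j
    omega

/-! ### Smoothness of the coordinates and of the section -/

section CellSmooth

variable {EY : Type*} [NormedAddCommGroup EY]
  [NormedSpace ℝ EY] {HY : Type*} [TopologicalSpace HY] {IY : ModelWithCorners ℝ EY HY}
  {Y : Type*} [TopologicalSpace Y] [ChartedSpace HY Y] {y : Y}

theorem MatSmoothAt.fromBlocks {A B C D : Y → Matrix (Fin 3) (Fin 3) ℝ} (hA : MatSmoothAt IY A y)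
    (hB : MatSmoothAt IY B y) (hC : MatSmoothAt IY C y) (hD : MatSmoothAt IY D y) :
    MatSmoothAt IY (fun z => Matrix.fromBlocks (A z) (B z) (C z) (D z)) y := by
  rintro (i | i) (j | j)
  exacts [hA i j, hB i j, hC i j, hD i j]

theorem contMDiffAt_cellCoord {f : Y → Mat6} (hf : MatSmoothAt IY f y) (hy : f y ∈ bigCell) :
    ContMDiffAt IY (𝓡 8) ∞ (fun z => WithLp.toLp 2 (cellCoord (f z))) y := by
  have hA : MatSmoothAt IY (fun z => ulBlock (f z)) y := fun i j => hf _ _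
  have hC : MatSmoothAt IY (fun z => llBlock (f z)) y := fun i j => hf _ _
  have hK := hC.mul (hA.inv hy.1)
  have hm : ContMDiffAt IY 𝓘(ℝ, ℝ) ∞ (fun z => (ulMinor (ulBlock (f z)))⁻¹) y :=
    (((hA 0 0).mul (hA 1 1)).sub ((hA 0 1).mul (hA 1 0))).inv₀ hy.2
  have h : ContMDiffAt IY 𝓘(ℝ, Fin 8 → ℝ) ∞ (fun z => cellCoord (f z)) y := by
    rw [contMDiffAt_pi_space]
    intro i
    fin_cases i
    · exact hK 2 2
    · exact hK 2 0
    · exact hK 2 1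
    · exact (((hA 2 1).mul (hA 1 0)).sub ((hA 2 0).mul (hA 1 1))).mul hm
    · exact (((hA 2 0).mul (hA 0 1)).sub ((hA 2 1).mul (hA 0 0))).mul hm
    · exact hK 0 0
    · exact hK 0 1
    · exact hK 1 1
  exact (EuclideanSpace.equiv (Fin 8) ℝ).symm.contDiff.contDiffAt.contMDiffAt.comp y h

end CellSmooth

theorem matSmoothAt_cellSection (a : EuclideanSpace ℝ (Fin 8)) :
    MatSmoothAt (𝓡 8) (fun a : EuclideanSpace ℝ (Fin 8) => cellSection a) a := by
  have h : ∀ i, ContMDiffAt (𝓡 8) 𝓘(ℝ, ℝ) ∞ (fun a : EuclideanSpace ℝ (Fin 8) => a i) a :=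
    fun i => (EuclideanSpace.proj (𝕜 := ℝ) i).contDiff.contDiffAt.contMDiffAt
  have hL : MatSmoothAt (𝓡 8) (fun a : EuclideanSpace ℝ (Fin 8) => cellL a) a := by
    intro i j
    fin_cases i <;> fin_cases j <;> first | exact contMDiffAt_const | exact (h _).neg
  have hLI : MatSmoothAt (𝓡 8) (fun a : EuclideanSpace ℝ (Fin 8) => cellLInv a) a := by
    intro i j
    fin_cases i <;> fin_cases j <;> first | exact contMDiffAt_const | exact h _
  have hK : MatSmoothAt (𝓡 8) (fun a : EuclideanSpace ℝ (Fin 8) => cellK a) a := by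
    intro i j
    fin_cases i <;> fin_cases j <;> exact h _
  exact hL.fromBlocks (.const 0) (hK.mul hL) hLI.transpose

theorem Sp3.matSmoothAt_coe (g : Sp3) : MatSmoothAt (𝓡 21) (fun g : Sp3 => (g : Mat6)) g :=
  contMDiffAt_iff_matSmoothAt.mp (Sp3.isEmbeddedAtlas.contMDiff g)

theorem contMDiff_spSection : ContMDiff (𝓡 8) (𝓡 21) ∞ spSection := fun a =>
  Sp3.isEmbeddedAtlas.contMDiffAt_of_comp
    (contMDiffAt_iff_matSmoothAt (f := fun a => Sp3.entries (spSection a)).mpr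
      (matSmoothAt_cellSection a))

instance Sp3.instIsTopologicalGroup : IsTopologicalGroup Sp3 :=
  topologicalGroup_of_lieGroup (𝓡 21) ∞

theorem contMDiff_mul_left' (g : Sp3) : ContMDiff (𝓡 21) (𝓡 21) ∞ (fun h : Sp3 => g * h) :=
  contMDiff_mul_left

/-! ### The flag manifold -/

/-- The elements of the group over the domain of the chart of the flag manifold at `g`. -/
def cellPreimage (g : Sp3) : Set Sp3 := {h | ((g⁻¹ * h : Sp3) : Mat6) ∈ bigCell}

theorem contMDiffAt_spCellCoord {g h : Sp3} (hh : h ∈ cellPreimage g) :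
    ContMDiffAt (𝓡 21) (𝓡 8) ∞ (fun h => spCellCoord (g⁻¹ * h)) h :=
  contMDiffAt_cellCoord (fun i j =>
    (Sp3.matSmoothAt_coe (g⁻¹ * h) i j).comp h (contMDiff_mul_left' g⁻¹ h)) hh

theorem isOpen_cellPreimage (g : Sp3) : IsOpen (cellPreimage g) := by
  have hA : ∀ h : Sp3, MatSmoothAt (𝓡 21) (fun h : Sp3 => ulBlock ((g⁻¹ * h : Sp3) : Mat6)) h :=
    fun h i j => (Sp3.matSmoothAt_coe (g⁻¹ * h) _ _).comp h (contMDiff_mul_left' g⁻¹ h)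
  have h1 : Continuous fun h : Sp3 => (ulBlock ((g⁻¹ * h : Sp3) : Mat6)).det :=
    continuous_iff_continuousAt.mpr fun h => (hA h).det.continuousAt
  have h2 : Continuous fun h : Sp3 => ulMinor (ulBlock ((g⁻¹ * h : Sp3) : Mat6)) :=
    continuous_iff_continuousAt.mpr fun h =>
      (((hA h 0 0).mul (hA h 1 1)).sub ((hA h 0 1).mul (hA h 1 0))).continuousAt
  exact (isOpen_ne_fun h1 continuous_const).inter (isOpen_ne_fun h2 continuous_const)

theorem mul_mem_cellPreimage_iff {g h : Sp3} (p : flagStabilizer) :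
    h * p ∈ cellPreimage g ↔ h ∈ cellPreimage g := by
  rw [cellPreimage, mem_ofPred_eq, mem_ofPred_eq, ← mul_assoc, Submonoid.coe_mul,
    mul_mem_bigCell_iff (mem_flagStabilizer.mp p.2) (Sp3.coe_det_ne_zero _)]

theorem mk_out_mem_cellPreimage_iff {g h : Sp3} :
    (h : Sp3 ⧸ flagStabilizer).out ∈ cellPreimage g ↔ h ∈ cellPreimage g := by
  obtain ⟨p, hp⟩ := QuotientGroup.mk_out_eq_mul flagStabilizer h
  rw [hp, mul_mem_cellPreimage_iff]

theorem spCellCoord_mk_out (g h : Sp3) :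
    spCellCoord (g⁻¹ * (h : Sp3 ⧸ flagStabilizer).out) = spCellCoord (g⁻¹ * h) := by
  obtain ⟨p, hp⟩ := QuotientGroup.mk_out_eq_mul flagStabilizer h
  rw [hp, ← mul_assoc, spCellCoord_mul]

theorem mul_spSection_mem_cellPreimage (g : Sp3) (a : EuclideanSpace ℝ (Fin 8)) :
    g * spSection a ∈ cellPreimage g := by
  rw [cellPreimage, mem_ofPred_eq, inv_mul_cancel_left]
  exact cellSection_mem_bigCell a

theorem mk_mul_spSection {g h : Sp3} (hh : h ∈ cellPreimage g) :
    ((g * spSection (spCellCoord (g⁻¹ * h)) : Sp3) : Sp3 ⧸ flagStabilizer) = h := by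
  rw [QuotientGroup.eq, mul_inv_rev, mul_assoc]
  exact spSection_inv_mul_mem hh

theorem isOpen_cellImage (g : Sp3) :
    IsOpen {x : Sp3 ⧸ flagStabilizer | x.out ∈ cellPreimage g} := by
  have h : (QuotientGroup.mk : Sp3 → Sp3 ⧸ flagStabilizer) ⁻¹'
      {x : Sp3 ⧸ flagStabilizer | x.out ∈ cellPreimage g} = cellPreimage g := by
    ext k
    rw [mem_preimage, mem_ofPred_eq, mk_out_mem_cellPreimage_iff]
  rw [← (QuotientGroup.isQuotientMap_mk flagStabilizer).isOpen_preimage, h]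
  exact isOpen_cellPreimage g

theorem continuousOn_flagCoord (g : Sp3) :
    ContinuousOn (fun x : Sp3 ⧸ flagStabilizer => spCellCoord (g⁻¹ * x.out))
      {x : Sp3 ⧸ flagStabilizer | x.out ∈ cellPreimage g} := by
  intro x hx
  obtain ⟨h, rfl⟩ := QuotientGroup.mk_surjective x
  refine ContinuousAt.continuousWithinAt ?_
  rw [← QuotientGroup.isOpenQuotientMap_mk.continuousAt_comp_iff]
  refine (contMDiffAt_spCellCoord (mk_out_mem_cellPreimage_iff.mp hx)).continuousAt.congr ?_
  exact .of_forall fun k => (spCellCoord_mk_out g k).symm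

theorem continuous_mk_mul_spSection (g : Sp3) : Continuous
    fun a : EuclideanSpace ℝ (Fin 8) => ((g * spSection a : Sp3) : Sp3 ⧸ flagStabilizer) :=
  QuotientGroup.continuous_mk.comp ((continuous_const_mul g).comp contMDiff_spSection.continuous)

/-- The chart of the flag manifold on the translate by `g` of the big cell. -/
noncomputable def flagChart (g : Sp3) :
    OpenPartialHomeomorph (Sp3 ⧸ flagStabilizer) (EuclideanSpace ℝ (Fin 8)) where
  toFun x := spCellCoord (g⁻¹ * x.out)
  invFun a := (g * spSection a : Sp3)
  source := {x | x.out ∈ cellPreimage g}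
  target := univ
  map_source' _ _ := mem_univ _
  map_target' a _ := by
    rw [mem_ofPred_eq, mk_out_mem_cellPreimage_iff]
    exact mul_spSection_mem_cellPreimage g a
  left_inv' x hx := by
    have h := mk_mul_spSection hx
    exact h.trans (QuotientGroup.out_eq' x)
  right_inv' a _ := by
    have h := spCellCoord_mk_out g (g * spSection a)
    rw [inv_mul_cancel_left, spCellCoord_spSection] at h
    exact h
  open_source := isOpen_cellImage g
  open_target := isOpen_univ
  continuousOn_toFun := continuousOn_flagCoord g
  continuousOn_invFun := (continuous_mk_mul_spSection g).continuousOn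

theorem mk_mem_flagChart_source {g h : Sp3} :
    (h : Sp3 ⧸ flagStabilizer) ∈ (flagChart g).source ↔ h ∈ cellPreimage g :=
  mk_out_mem_cellPreimage_iff

theorem flagChart_mk (g h : Sp3) :
    flagChart g (h : Sp3 ⧸ flagStabilizer) = spCellCoord (g⁻¹ * h) := spCellCoord_mk_out g h

theorem mem_flagChart_source (g : Sp3) : (g : Sp3 ⧸ flagStabilizer) ∈ (flagChart g).source := by
  rw [mk_mem_flagChart_source, cellPreimage, mem_ofPred_eq, inv_mul_cancel]
  exact isMongeTriangular_one.mem_bigCell (by rw [Matrix.det_one]; exact one_ne_zero)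

noncomputable instance flagManifold.instChartedSpace :
    ChartedSpace (EuclideanSpace ℝ (Fin 8)) (Sp3 ⧸ flagStabilizer) where
  atlas := range flagChart
  chartAt x := flagChart x.out
  mem_chart_source x := by
    have h := mem_flagChart_source x.out
    rwa [QuotientGroup.out_eq'] at h
  chart_mem_atlas _ := mem_range_self _

instance flagManifold.instIsManifold : IsManifold (𝓡 8) ∞ (Sp3 ⧸ flagStabilizer) := by
  refine isManifold_of_contDiffOn _ _ _ fun e e' he he' => ?_
  obtain ⟨g, rfl⟩ := he
  obtain ⟨g', rfl⟩ := he'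
  intro a ha
  simp only [modelWithCornersSelf_coe, modelWithCornersSelf_coe_symm, preimage_id_eq, id_eq,
    range_id, inter_univ, OpenPartialHomeomorph.trans_source, OpenPartialHomeomorph.symm_source,
    mem_inter_iff, mem_preimage] at ha
  have h1 : g * spSection a ∈ cellPreimage g' := mk_mem_flagChart_source.mp ha.2
  have h2 : ContMDiffAt (𝓡 8) (𝓡 8) ∞ (fun a => spCellCoord (g'⁻¹ * (g * spSection a))) a :=
    ContMDiffAt.comp (g := fun h => spCellCoord (g'⁻¹ * h)) a (contMDiffAt_spCellCoord h1)
      ((contMDiff_mul_left' g _).comp a (contMDiff_spSection a))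
  refine (h2.contDiffAt.congr_of_eventuallyEq (.of_forall fun b => ?_)).contDiffWithinAt
  exact flagChart_mk g' _

theorem flagChart_mem_maximalAtlas (g : Sp3) :
    flagChart g ∈ IsManifold.maximalAtlas (𝓡 8) ∞ (Sp3 ⧸ flagStabilizer) :=
  IsManifold.subset_maximalAtlas (mem_range_self g)

theorem contMDiff_flagMk :
    ContMDiff (𝓡 21) (𝓡 8) ∞ (QuotientGroup.mk : Sp3 → Sp3 ⧸ flagStabilizer) := by
  intro h
  rw [contMDiffAt_iff_target_of_mem_source (y := (h : Sp3 ⧸ flagStabilizer)) (mem_chart_source _ _)]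
  refine ⟨QuotientGroup.continuous_mk.continuousAt, ?_⟩
  refine (contMDiffAt_spCellCoord (g := (h : Sp3 ⧸ flagStabilizer).out) ?_).congr_of_eventuallyEq
    (.of_forall fun k => ?_)
  · rw [← mk_mem_flagChart_source]
    exact mem_chart_source (EuclideanSpace ℝ (Fin 8)) (h : Sp3 ⧸ flagStabilizer)
  · exact flagChart_mk _ k

/-- The local section of the projection over the domain of a chart. -/
noncomputable def flagSection (g : Sp3) (x : Sp3 ⧸ flagStabilizer) : Sp3 :=
  g * spSection (flagChart g x)

theorem mk_flagSection {g : Sp3} {x : Sp3 ⧸ flagStabilizer} (hx : x ∈ (flagChart g).source) :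
    (flagSection g x : Sp3 ⧸ flagStabilizer) = x := (flagChart g).left_inv hx

theorem contMDiffAt_flagSection {g : Sp3} {x : Sp3 ⧸ flagStabilizer}
    (hx : x ∈ (flagChart g).source) : ContMDiffAt (𝓡 8) (𝓡 21) ∞ (flagSection g) x :=
  (contMDiff_mul_left' g _).comp x ((contMDiff_spSection _).comp x
    (contMDiffAt_of_mem_maximalAtlas (flagChart_mem_maximalAtlas g) hx))

theorem contMDiff_flag_smul : ContMDiff ((𝓡 21).prod (𝓡 8)) (𝓡 8) ∞
    (fun q : Sp3 × (Sp3 ⧸ flagStabilizer) => q.1 • q.2) := by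
  intro q
  have hx : q.2 ∈ (flagChart q.2.out).source := mem_chart_source (EuclideanSpace ℝ (Fin 8)) q.2
  have h1 : ContMDiffAt ((𝓡 21).prod (𝓡 8)) (𝓡 21) ∞
      (fun q : Sp3 × (Sp3 ⧸ flagStabilizer) => q.1) q := contMDiffAt_fst
  have h2 : ContMDiffAt ((𝓡 21).prod (𝓡 8)) (𝓡 21) ∞
      (fun q' : Sp3 × (Sp3 ⧸ flagStabilizer) => flagSection q.2.out q'.2) q :=
    (contMDiffAt_flagSection hx).comp q contMDiffAt_snd
  have h3 := (contMDiff_flagMk (q.1 * flagSection q.2.out q.2)).comp q (h1.mul h2)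
  refine h3.congr_of_eventuallyEq ?_
  have ho : (flagChart q.2.out).source ∈ nhds q.2 := (flagChart q.2.out).open_source.mem_nhds hx
  filter_upwards [continuous_snd.continuousAt.preimage_mem_nhds ho] with q' hq'
  change q'.1 • q'.2 = ((q'.1 * flagSection q.2.out q'.2 : Sp3) : Sp3 ⧸ flagStabilizer)
  rw [← smul_eq_mul, ← MulAction.Quotient.smul_coe, mk_flagSection hq']

theorem isClosed_flagStabilizer : IsClosed {g : Sp3 | g ∈ flagStabilizer} := by
  simp only [mem_flagStabilizer, isMongeTriangular_iff, ofPred_forall]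
  refine isClosed_iInter fun i => isClosed_iInter fun j => isClosed_iInter fun _ => ?_
  have h : Continuous fun g : Sp3 => (g : Mat6) i j :=
    continuous_iff_continuousAt.mpr fun g => (Sp3.matSmoothAt_coe g i j).continuousAt
  exact isClosed_eq h continuous_const

instance flagManifold.instT2Space : T2Space (Sp3 ⧸ flagStabilizer) := by
  rw [t2Space_iff_of_isOpenQuotientMap QuotientGroup.isOpenQuotientMap_mk]
  simp only [QuotientGroup.eq]
  exact isClosed_flagStabilizer.preimage (continuous_fst.inv.mul continuous_snd)

/-! ### The principal bundle over the flag manifold -/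

theorem flagSection_inv_mul_mem {g h : Sp3} (hh : h ∈ cellPreimage g) :
    (flagSection g (h : Sp3 ⧸ flagStabilizer))⁻¹ * h ∈ flagStabilizer := by
  rw [← QuotientGroup.eq, mk_flagSection (mk_mem_flagChart_source.mpr hh)]

open Classical in
/-- The component in the structure group of the trivialization at `g`. -/
noncomputable def flagFibreCoord (g h : Sp3) : flagStabilizer :=
  if hp : (flagSection g (h : Sp3 ⧸ flagStabilizer))⁻¹ * h ∈ flagStabilizer then ⟨_, hp⟩ else 1

theorem coe_flagFibreCoord {g h : Sp3} (hh : h ∈ cellPreimage g) :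
    (flagFibreCoord g h : Sp3) = (flagSection g (h : Sp3 ⧸ flagStabilizer))⁻¹ * h := by
  rw [flagFibreCoord, dif_pos (flagSection_inv_mul_mem hh)]

theorem contMDiffAt_flagFibreCoord {g h : Sp3} (hh : h ∈ cellPreimage g) :
    ContMDiffAt (𝓡 21) (𝓡 13) ∞ (flagFibreCoord g) h := by
  have hs : ContMDiffAt (𝓡 21) (𝓡 21) ∞
      (fun k : Sp3 => flagSection g (k : Sp3 ⧸ flagStabilizer)) h :=
    (contMDiffAt_flagSection (mk_mem_flagChart_source.mpr hh)).comp h (contMDiff_flagMk h)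
  have h2 := (Sp3.isEmbeddedAtlas.contMDiff _).comp h (hs.inv.mul contMDiffAt_id)
  refine flagStabilizer.isEmbeddedAtlas.contMDiffAt_of_comp (h2.congr_of_eventuallyEq ?_)
  filter_upwards [(isOpen_cellPreimage g).mem_nhds hh] with k hk
  rw [coe_flagFibreCoord hk]
  rfl

theorem contMDiffAt_flagSection_mul {g : Sp3} {q : (Sp3 ⧸ flagStabilizer) × flagStabilizer}
    (hq : q.1 ∈ (flagChart g).source) :
    ContMDiffAt ((𝓡 8).prod (𝓡 13)) (𝓡 21) ∞
      (fun q : (Sp3 ⧸ flagStabilizer) × flagStabilizer => flagSection g q.1 * q.2) q :=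
  ((contMDiffAt_flagSection hq).comp q contMDiffAt_fst).mul
    ((flagStabilizer.contMDiff_coe q.2).comp q contMDiffAt_snd)

theorem mk_flagSection_mul {g : Sp3} {x : Sp3 ⧸ flagStabilizer} (hx : x ∈ (flagChart g).source)
    (p : flagStabilizer) : ((flagSection g x * p : Sp3) : Sp3 ⧸ flagStabilizer) = x := by
  rw [QuotientGroup.mk_mul_of_mem _ p.2, mk_flagSection hx]

theorem flagSection_mul_mem_cellPreimage {g : Sp3} {x : Sp3 ⧸ flagStabilizer}
    (hx : x ∈ (flagChart g).source) (p : flagStabilizer) :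
    flagSection g x * p ∈ cellPreimage g := by
  rw [← mk_mem_flagChart_source, mk_flagSection_mul hx]
  exact hx

theorem contMDiffOn_flagTriv (g : Sp3) : ContMDiffOn (𝓡 21) ((𝓡 8).prod (𝓡 13)) ∞
    (fun h : Sp3 => ((h : Sp3 ⧸ flagStabilizer), flagFibreCoord g h)) (cellPreimage g) :=
  fun h hh => ((contMDiff_flagMk h).prodMk (contMDiffAt_flagFibreCoord hh)).contMDiffWithinAt

theorem contMDiffOn_flagTriv_symm (g : Sp3) : ContMDiffOn ((𝓡 8).prod (𝓡 13)) (𝓡 21) ∞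
    (fun q : (Sp3 ⧸ flagStabilizer) × flagStabilizer => flagSection g q.1 * q.2)
    ((flagChart g).source ×ˢ univ) :=
  fun _ hq => (contMDiffAt_flagSection_mul hq.1).contMDiffWithinAt

theorem flagTriv_left_inv {g h : Sp3} (hh : h ∈ cellPreimage g) :
    flagSection g (h : Sp3 ⧸ flagStabilizer) * (flagFibreCoord g h : Sp3) = h := by
  rw [coe_flagFibreCoord hh, mul_inv_cancel_left]

theorem flagFibreCoord_flagSection_mul {g : Sp3} {x : Sp3 ⧸ flagStabilizer}
    (hx : x ∈ (flagChart g).source) (p : flagStabilizer) :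
    flagFibreCoord g (flagSection g x * p) = p := by
  refine Subtype.ext ?_
  rw [coe_flagFibreCoord (flagSection_mul_mem_cellPreimage hx p), mk_flagSection_mul hx,
    inv_mul_cancel_left]

theorem flagTriv_right_inv {g : Sp3} {q : (Sp3 ⧸ flagStabilizer) × flagStabilizer}
    (hx : q.1 ∈ (flagChart g).source) :
    (((flagSection g q.1 * q.2 : Sp3) : Sp3 ⧸ flagStabilizer),
      flagFibreCoord g (flagSection g q.1 * q.2)) = q := by
  rw [mk_flagSection_mul hx, flagFibreCoord_flagSection_mul hx]

/-- The trivialization of the projection over the domain of a chart. -/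
noncomputable def flagTriv (g : Sp3) :
    Bundle.Trivialization flagStabilizer (QuotientGroup.mk : Sp3 → Sp3 ⧸ flagStabilizer) where
  toFun h := ((h : Sp3 ⧸ flagStabilizer), flagFibreCoord g h)
  invFun q := flagSection g q.1 * q.2
  source := cellPreimage g
  target := (flagChart g).source ×ˢ univ
  map_source' _ hh := ⟨mk_mem_flagChart_source.mpr hh, mem_univ _⟩
  map_target' _ hq := flagSection_mul_mem_cellPreimage hq.1 _
  left_inv' _ hh := flagTriv_left_inv hh
  right_inv' _ hq := flagTriv_right_inv hq.1
  open_source := isOpen_cellPreimage g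
  open_target := (flagChart g).open_source.prod isOpen_univ
  continuousOn_toFun := (contMDiffOn_flagTriv g).continuousOn
  continuousOn_invFun := (contMDiffOn_flagTriv_symm g).continuousOn
  baseSet := (flagChart g).source
  open_baseSet := (flagChart g).open_source
  source_eq := by
    ext h
    rw [mem_preimage, mk_mem_flagChart_source]
  target_eq := rfl
  proj_toFun _ _ := rfl

theorem flagTriv_mul {g h : Sp3} (hh : h ∈ cellPreimage g) (p : flagStabilizer) :
    flagTriv g (h * p) = ((flagTriv g h).1, (flagTriv g h).2 * p) := by
  have hm : ((h * p : Sp3) : Sp3 ⧸ flagStabilizer) = h := QuotientGroup.mk_mul_of_mem _ p.2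
  refine Prod.ext hm (Subtype.ext ?_)
  change (flagFibreCoord g (h * p) : Sp3) = flagFibreCoord g h * p
  rw [coe_flagFibreCoord ((mul_mem_cellPreimage_iff p).mpr hh), coe_flagFibreCoord hh, hm, mul_assoc]

theorem isHomogeneousFibration_flagStabilizer : IsHomogeneousFibration flagStabilizer
    (EuclideanSpace ℝ (Fin 21)) (EuclideanSpace ℝ (Fin 13)) (EuclideanSpace ℝ (Fin 8)) where
  lieGroup_total := inferInstance
  lieGroup_fibre := inferInstance
  contMDiff_coe := flagStabilizer.contMDiff_coe
  injective_mfderiv_coe := flagStabilizer.injective_mfderiv_coe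
  t2Space_base := inferInstance
  contMDiff_smul := contMDiff_flag_smul
  contMDiff_mk := contMDiff_flagMk
  exists_trivialization x := ⟨flagTriv x.out, mem_chart_source (EuclideanSpace ℝ (Fin 8)) x,
    contMDiffOn_flagTriv _, contMDiffOn_flagTriv_symm _, fun _ hg p => flagTriv_mul hg p⟩

/-! ### The stabilizer of the flag is parabolic -/

theorem mem_iSup_mongeGrading {X : LieSp3} :
    X ∈ (⨆ k : ℕ, mongeGrading k) ↔ IsMongeTriangular (X : Mat6) := by
  constructor
  · intro hX
    rw [isMongeTriangular_iff]
    intro i j hij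
    refine Submodule.iSup_induction (fun k : ℕ => mongeGrading k)
      (motive := fun X => (X : Mat6) i j = 0) hX (fun k X hX => hX i j (by omega)) rfl ?_
    intro X Y hX hY
    rw [AddMemClass.coe_add, Matrix.add_apply, hX, hY, add_zero]
  · intro hX
    rw [isMongeTriangular_iff] at hX
    rw [← sum_mongeProj X]
    refine Submodule.sum_mem _ fun k _ => ?_
    rcases lt_or_ge k 0 with hk | hk
    · have h : mongeProj k X = 0 := by
        ext i j
        rw [mongeProj_apply]
        split_ifs with h
        · exact hX i j (by omega)
        · rfl
      rw [h]
      exact Submodule.zero_mem _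
    · lift k to ℕ using hk
      exact Submodule.mem_iSup_of_mem k (mongeProj_mem _ _)

theorem Sp3.mul_coe_inv (g : Sp3) : (g : Mat6) * ((g⁻¹ : Sp3) : Mat6) = 1 :=
  congrArg Subtype.val (mul_inv_cancel g)

theorem Sp3.coe_inv_mul (g : Sp3) : ((g⁻¹ : Sp3) : Mat6) * (g : Mat6) = 1 :=
  congrArg Subtype.val (inv_mul_cancel g)

theorem Sp3.conj_mem_sp (g : Sp3) (X : LieSp3) :
    (g : Mat6) * (X : Mat6) * ((g⁻¹ : Sp3) : Mat6) ∈ LieAlgebra.Symplectic.sp (Fin 3) ℝ := by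
  have h1 := SymplecticGroup.mem_iff'.mp (g⁻¹).2
  have h2 := mem_sp_iff_transpose_mul.mp X.2
  have h3 : (g : Mat6)ᵀ * Matrix.J (Fin 3) ℝ = Matrix.J (Fin 3) ℝ * ((g⁻¹ : Sp3) : Mat6) := by
    conv_rhs => rw [← SymplecticGroup.mem_iff'.mp g.2, mul_assoc, g.mul_coe_inv, mul_one]
  have h4 : (((g⁻¹ : Sp3) : Mat6))ᵀ * Matrix.J (Fin 3) ℝ = Matrix.J (Fin 3) ℝ * (g : Mat6) := by
    conv_rhs => rw [← h1, mul_assoc, g.coe_inv_mul, mul_one]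
  rw [mem_sp_iff_transpose_mul, Matrix.transpose_mul, Matrix.transpose_mul, mul_assoc, mul_assoc, h3,
    ← mul_assoc (X : Mat6)ᵀ, h2, neg_mul, mul_neg, ← mul_assoc, ← mul_assoc, h4]
  simp only [mul_assoc]

/-- The adjoint action. -/
def Sp3.conj (g : Sp3) (X : LieSp3) : LieSp3 := ⟨_, g.conj_mem_sp X⟩

theorem Sp3.coe_conj (g : Sp3) (X : LieSp3) :
    (g.conj X : Mat6) = (g : Mat6) * (X : Mat6) * ((g⁻¹ : Sp3) : Mat6) := rfl

theorem Sp3.conj_inv_conj (g : Sp3) (X : LieSp3) : g⁻¹.conj (g.conj X) = X := by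
  refine Subtype.ext ?_
  rw [Sp3.coe_conj, Sp3.coe_conj, inv_inv, mul_assoc (g : Mat6), ← mul_assoc _ (g : Mat6),
    g.coe_inv_mul, one_mul, mul_assoc, g.coe_inv_mul, mul_one]

theorem Sp3.conj_symElt (g : Sp3) (u v : Fin 3 ⊕ Fin 3 → ℝ) :
    g.conj (symElt u v) = symElt ((g : Mat6) *ᵥ u) ((g : Mat6) *ᵥ v) := by
  have h : ∀ w : Fin 3 ⊕ Fin 3 → ℝ, (w ᵥ* Matrix.J (Fin 3) ℝ) ᵥ* ((g⁻¹ : Sp3) : Mat6) =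
      ((g : Mat6) *ᵥ w) ᵥ* Matrix.J (Fin 3) ℝ := by
    intro w
    have h3 : Matrix.J (Fin 3) ℝ * ((g⁻¹ : Sp3) : Mat6) = (g : Mat6)ᵀ * Matrix.J (Fin 3) ℝ := by
      conv_lhs => rw [← SymplecticGroup.mem_iff'.mp g.2, mul_assoc, g.mul_coe_inv, mul_one]
    rw [Matrix.vecMul_vecMul, h3, ← Matrix.vecMul_vecMul, Matrix.vecMul_transpose]
  refine Subtype.ext ?_
  rw [Sp3.coe_conj, coe_symElt, coe_symElt, mul_add, add_mul, Matrix.mul_vecMulVec,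
    Matrix.mul_vecMulVec, Matrix.vecMulVec_mul, Matrix.vecMulVec_mul, h, h]

theorem vecMul_J_inl (v : Fin 3 ⊕ Fin 3 → ℝ) (i : Fin 3) :
    (v ᵥ* Matrix.J (Fin 3) ℝ) (.inl i) = v (.inr i) := by
  simp [Matrix.vecMul, dotProduct, Matrix.J, Matrix.one_apply]

theorem vecMul_J_inr (v : Fin 3 ⊕ Fin 3 → ℝ) (i : Fin 3) :
    (v ᵥ* Matrix.J (Fin 3) ℝ) (.inr i) = -v (.inl i) := by
  simp [Matrix.vecMul, dotProduct, Matrix.J, Matrix.one_apply]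

theorem symElt_apply_inl (u v : Fin 3 ⊕ Fin 3 → ℝ) (i : Fin 3 ⊕ Fin 3) (j : Fin 3) :
    (symElt u v : Mat6) i (.inl j) = u i * v (.inr j) + v i * u (.inr j) := by
  rw [coe_symElt, Matrix.add_apply, Matrix.vecMulVec_apply, Matrix.vecMulVec_apply, vecMul_J_inl,
    vecMul_J_inl]

theorem symElt_apply_inr (u v : Fin 3 ⊕ Fin 3 → ℝ) (i : Fin 3 ⊕ Fin 3) (j : Fin 3) :
    (symElt u v : Mat6) i (.inr j) = -(u i * v (.inl j) + v i * u (.inl j)) := by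
  rw [coe_symElt, Matrix.add_apply, Matrix.vecMulVec_apply, Matrix.vecMulVec_apply, vecMul_J_inr,
    vecMul_J_inr]
  ring

theorem isMongeTriangular_symElt_inl (k : Fin 3) :
    IsMongeTriangular (symElt (Pi.single (.inl k) 1) (Pi.single (.inl k) 1) : Mat6) := by
  rw [isMongeTriangular_iff]
  rintro i (j | j) hij
  · simp [symElt_apply_inl]
  · rcases i with i | i
    · rw [mongeWeight_inr] at hij
      have := mongeWeight_inl_pos i
      have := mongeWeight_inl_pos j
      omega
    · simp [symElt_apply_inr]

theorem isMongeTriangular_symElt_inr {k : Fin 3} (hk : mongeWeight (.inl k) = 3) :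
    IsMongeTriangular (symElt (Pi.single (.inl k) 1) (Pi.single (.inr 2) 1) : Mat6) := by
  rw [isMongeTriangular_iff]
  fin_cases k <;> simp [mongeWeight] at hk <;>
    simp [Fin.forall_fin_succ, mongeWeight, symElt_apply_inl, symElt_apply_inr]

theorem mem_flagStabilizer_of_conj {g : Sp3}
    (h : ∀ X : LieSp3, IsMongeTriangular (X : Mat6) → IsMongeTriangular (g.conj X : Mat6)) :
    g ∈ flagStabilizer := by
  have h1 : ∀ i k : Fin 3, (g : Mat6) (.inr i) (.inl k) = 0 := by
    intro i k
    have h2 := h _ (isMongeTriangular_symElt_inl k)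
    rw [Sp3.conj_symElt, isMongeTriangular_iff] at h2
    have h3 := h2 (.inr i) (.inl i) (by
      rw [mongeWeight_inr]
      have := mongeWeight_inl_pos i
      omega)
    rw [symElt_apply_inl, Matrix.mulVec_single_one] at h3
    have h4 : (g : Mat6) (.inr i) (.inl k) * (g : Mat6) (.inr i) (.inl k) = 0 := by
      change (g : Mat6) (.inr i) (.inl k) * (g : Mat6) (.inr i) (.inl k) +
        (g : Mat6) (.inr i) (.inl k) * (g : Mat6) (.inr i) (.inl k) = 0 at h3
      linarith
    exact mul_self_eq_zero.mp h4
  have h5 : ∀ k : Fin 3, mongeWeight (.inl k) = 3 → (g : Mat6) (.inl 2) (.inl k) = 0 := by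
    intro k hk
    by_contra hne
    have h2 := h _ (isMongeTriangular_symElt_inr hk)
    rw [Sp3.conj_symElt, isMongeTriangular_iff] at h2
    have h3 : ∀ j : Fin 3, mongeWeight (.inl j) = 3 → (g : Mat6) (.inr j) (.inr 2) = 0 := by
      intro j hj
      have h4 := h2 (.inl 2) (.inl j) (by rw [hj]; decide)
      rw [symElt_apply_inl, Matrix.mulVec_single_one, Matrix.mulVec_single_one] at h4
      change (g : Mat6) (.inl 2) (.inl k) * (g : Mat6) (.inr j) (.inr 2) +
        (g : Mat6) (.inl 2) (.inr 2) * (g : Mat6) (.inr j) (.inl k) = 0 at h4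
      rw [h1, mul_zero, add_zero] at h4
      exact (mul_eq_zero.mp h4).resolve_left hne
    have hsymp := g.2
    rw [← Matrix.fromBlocks_toBlocks (g : Mat6), SymplecticGroup.fromBlocks_mem_iff] at hsymp
    have hC : (g : Mat6).toBlocks₂₁ = 0 := by
      ext i j
      exact h1 i j
    have hAD := hsymp.2.2
    rw [hC, Matrix.transpose_zero, Matrix.zero_mul, sub_zero] at hAD
    have hcol : ∀ l : Fin 3, (g : Mat6) (.inl 2) (.inl l) * (g : Mat6) (.inr 2) (.inr 2) =
        (1 : Matrix (Fin 3) (Fin 3) ℝ) l 2 := by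
      intro l
      have h4 := congrFun (congrFun hAD l) 2
      rw [Matrix.mul_apply, Fin.sum_univ_three] at h4
      change (g : Mat6) (.inl 0) (.inl l) * (g : Mat6) (.inr 0) (.inr 2) +
        (g : Mat6) (.inl 1) (.inl l) * (g : Mat6) (.inr 1) (.inr 2) +
        (g : Mat6) (.inl 2) (.inl l) * (g : Mat6) (.inr 2) (.inr 2) = _ at h4
      rwa [h3 0 rfl, h3 1 rfl, mul_zero, mul_zero, zero_add, zero_add] at h4
    have h6 := hcol k
    rw [Matrix.one_apply_ne (by rintro rfl; revert hk; decide)] at h6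
    have h7 := hcol 2
    rw [(mul_eq_zero.mp h6).resolve_left hne, mul_zero, Matrix.one_apply_eq] at h7
    exact zero_ne_one h7
  refine mem_flagStabilizer_of_pos fun i j hj hij => ?_
  rcases j with j | j
  · rcases i with i | i
    · have key : ∀ i j : Fin 3, mongeWeight (.inl i) < mongeWeight (.inl j) →
          i = 2 ∧ mongeWeight (.inl j) = 3 := by decide
      obtain ⟨rfl, hj3⟩ := key i j hij
      exact h5 j hj3
    · exact h1 i j
  · rw [mongeWeight_inr] at hj
    have := mongeWeight_inl_pos j
    omega

theorem isMongeTriangular_conj {p : Sp3} (hp : p ∈ flagStabilizer) {X : LieSp3}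
    (hX : IsMongeTriangular (X : Mat6)) : IsMongeTriangular (p.conj X : Mat6) :=
  ((mem_flagStabilizer.mp hp).mul hX).mul (mem_flagStabilizer.mp (inv_mem hp))

theorem isParabolicSubgroup_flagStabilizer : IsParabolicSubgroup flagStabilizer := by
  refine ⟨mongeGrading, isLieGrading_mongeGrading, fun g => ?_⟩
  simp only [mem_iSup_mongeGrading]
  constructor
  · intro hg X
    constructor
    · exact fun hX => ⟨g.conj X, isMongeTriangular_conj hg hX, rfl⟩
    · rintro ⟨Y, hY, hYX⟩
      have h : Y = g.conj X := Subtype.ext hYX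
      rw [← g.conj_inv_conj X, ← h]
      exact isMongeTriangular_conj (inv_mem hg) hY
  · intro h
    refine mem_flagStabilizer_of_conj fun X hX => ?_
    obtain ⟨Y, hY, hYX⟩ := (h X).mp hX
    rw [Sp3.coe_conj, ← hYX]
    exact hY

/-! ### The differential of the coordinates on the big cell -/

/-- The coordinates on the big cell as a function of the matrix entries. -/
noncomputable def cellChart (m : Fin 3 ⊕ Fin 3 → Fin 3 ⊕ Fin 3 → ℝ) : EuclideanSpace ℝ (Fin 8) :=
  WithLp.toLp 2 (cellCoord (Matrix.of m))

theorem differentiableAt_cellChart {M : Mat6} (hM : M ∈ bigCell) :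
    DifferentiableAt ℝ cellChart (matEntries M) := by
  have h : MatSmoothAt 𝓘(ℝ, Fin 3 ⊕ Fin 3 → Fin 3 ⊕ Fin 3 → ℝ)
      (fun m : Fin 3 ⊕ Fin 3 → Fin 3 ⊕ Fin 3 → ℝ => Matrix.of m) (matEntries M) :=
    contMDiffAt_iff_matSmoothAt.mp contMDiffAt_id
  exact (contMDiffAt_cellCoord h hM).contDiffAt.differentiableAt (by simp)

/-- Multiplication of matrices on both sides, on the entries. -/
noncomputable def entriesMul (A B : Mat6) :
    (Fin 3 ⊕ Fin 3 → Fin 3 ⊕ Fin 3 → ℝ) →L[ℝ] (Fin 3 ⊕ Fin 3 → Fin 3 ⊕ Fin 3 → ℝ) :=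
  LinearMap.toContinuousLinearMap
    { toFun := fun m => matEntries (A * Matrix.of m * B)
      map_add' := fun m n => by
        rw [← Matrix.of_add_of, mul_add, add_mul]
        rfl
      map_smul' := fun r m => by
        rw [← Matrix.smul_of, mul_smul_comm, smul_mul_assoc]
        rfl }

theorem entriesMul_matEntries (A B M : Mat6) :
    entriesMul A B (matEntries M) = matEntries (A * M * B) := rfl

theorem fderiv_cellChart_mul_right {M p : Mat6} (hM : M ∈ bigCell) (hp : IsMongeTriangular p)
    (h : p.det ≠ 0) (W : Mat6) :
    fderiv ℝ cellChart (matEntries (M * p)) (matEntries (W * p)) =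
      fderiv ℝ cellChart (matEntries M) (matEntries W) := by
  have h1 : cellChart ∘ entriesMul 1 p = cellChart := by
    funext m
    change WithLp.toLp 2 (cellCoord (1 * Matrix.of m * p)) = _
    rw [one_mul, cellCoord_mul hp h]
    rfl
  have h2 : entriesMul 1 p (matEntries M) = matEntries (M * p) := by
    rw [entriesMul_matEntries, one_mul]
  have h3 := ((h2 ▸ differentiableAt_cellChart ((mul_mem_bigCell_iff hp h).mpr hM) :
    DifferentiableAt ℝ cellChart (entriesMul 1 p (matEntries M))).hasFDerivAt.comp _
      (entriesMul 1 p).hasFDerivAt).fderiv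
  rw [h1, h2] at h3
  rw [h3, ContinuousLinearMap.comp_apply, entriesMul_matEntries, one_mul]

theorem hasDerivAt_matEntries_quadratic (A B C : Mat6) :
    HasDerivAt (fun t : ℝ => matEntries (A + t • B + t ^ 2 • C)) (matEntries B) 0 := by
  rw [hasDerivAt_pi]
  intro i
  rw [hasDerivAt_pi]
  intro j
  have h := (((hasDerivAt_id (0 : ℝ)).mul_const (B i j)).const_add (A i j)).add
    (((hasDerivAt_id (0 : ℝ)).pow 2).mul_const (C i j))
  exact h.congr_deriv (by simp [matEntries])

theorem hasDerivAt_cellChart_quadratic {A : Mat6} (hA : A ∈ bigCell) (B C : Mat6) :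
    HasDerivAt (fun t : ℝ => cellChart (matEntries (A + t • B + t ^ 2 • C)))
      (fderiv ℝ cellChart (matEntries A) (matEntries B)) 0 := by
  have h0 : matEntries (A + (0 : ℝ) • B + (0 : ℝ) ^ 2 • C) = matEntries A := by simp
  have h : HasFDerivAt cellChart (fderiv ℝ cellChart (matEntries A))
      (matEntries (A + (0 : ℝ) • B + (0 : ℝ) ^ 2 • C)) := by
    rw [h0]
    exact (differentiableAt_cellChart hA).hasFDerivAt
  exact h.comp_hasDerivAt (0 : ℝ) (hasDerivAt_matEntries_quadratic A B C)

theorem fderiv_cellChart_triangular {M Y : Mat6} (hM : M ∈ bigCell) (hY : IsMongeTriangular Y) :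
    fderiv ℝ cellChart (matEntries M) (matEntries (M * Y)) = 0 := by
  have h1 := hasDerivAt_cellChart_quadratic hM (M * Y) 0
  refine h1.unique (HasDerivAt.congr_of_eventuallyEq (hasDerivAt_const (0 : ℝ)
    (cellChart (matEntries M))) ?_)
  have hdet : ContinuousAt (fun t : ℝ => (1 + t • Y).det) 0 := by
    refine Continuous.continuousAt (Continuous.matrix_det ?_)
    fun_prop
  have hne : (1 + (0 : ℝ) • Y).det ≠ 0 := by simp
  filter_upwards [hdet.eventually_ne hne] with t ht
  have h2 : M + t • (M * Y) + t ^ 2 • (0 : Mat6) = M * (1 + t • Y) := by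
    rw [smul_zero, add_zero, mul_add, mul_one, mul_smul_comm]
  have h3 : IsMongeTriangular (1 + t • Y) := by
    rw [isMongeTriangular_iff] at hY ⊢
    intro i j hij
    rw [Matrix.add_apply, Matrix.smul_apply, hY i j hij, isMongeTriangular_iff.mp
      isMongeTriangular_one i j hij, smul_zero, add_zero]
  rw [h2]
  exact congrArg (WithLp.toLp 2) (cellCoord_mul h3 ht)

/-- The quadratic part of the section over the big cell. -/
noncomputable def cellSectionQuad (w : Fin 8 → ℝ) : Mat6 :=
  Matrix.fromBlocks 0 0 (cellK w * !![0, 0, 0; 0, 0, 0; -w 3, -w 4, 0]) 0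

theorem cellSection_add_smul (a : EuclideanSpace ℝ (Fin 8)) (c : Fin 8 → ℝ) (t : ℝ) :
    cellSection (a + t • flatFrame a c : EuclideanSpace ℝ (Fin 8)) =
      cellSection a + t • (cellSection a * symbolMatrix c) +
        t ^ 2 • cellSectionQuad (flatFrame a c) := by
  rw [cellSection, cellSection, symbolMatrix, cellSectionQuad, Matrix.fromBlocks_multiply,
    Matrix.fromBlocks_smul, Matrix.fromBlocks_smul, Matrix.fromBlocks_add, Matrix.fromBlocks_add]
  congr 1
  · ext i j
    fin_cases i <;> fin_cases j <;>
      simp [cellL, flatFrame, Matrix.mul_apply, Fin.sum_univ_three] <;> ring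
  · simp
  · ext i j
    fin_cases i <;> fin_cases j <;>
      simp [cellL, cellK, cellLInv, flatFrame, Matrix.mul_apply, Fin.sum_univ_three] <;> ring
  · ext i j
    fin_cases i <;> fin_cases j <;>
      simp [cellLInv, flatFrame, Matrix.mul_apply, Fin.sum_univ_three]

theorem fderiv_cellChart_cellSection (a : EuclideanSpace ℝ (Fin 8)) (c : Fin 8 → ℝ) :
    fderiv ℝ cellChart (matEntries (cellSection a)) (matEntries (cellSection a * symbolMatrix c)) =
      flatFrame a c := by
  have h1 := hasDerivAt_cellChart_quadratic (cellSection_mem_bigCell a)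
    (cellSection a * symbolMatrix c) (cellSectionQuad (flatFrame a c))
  have h2 : (fun t : ℝ => cellChart (matEntries (cellSection a +
      t • (cellSection a * symbolMatrix c) + t ^ 2 • cellSectionQuad (flatFrame a c)))) =
      fun t : ℝ => a + t • flatFrame a c := by
    funext t
    rw [← cellSection_add_smul]
    exact congrArg (WithLp.toLp 2) (cellCoord_cellSection _)
  rw [h2] at h1
  refine h1.unique ?_
  simpa using ((hasDerivAt_id (0 : ℝ)).smul_const (flatFrame a c)).const_add a

theorem fderiv_cellChart_mul {k : Sp3} (hk : (k : Mat6) ∈ bigCell) {X : LieSp3} {c : Fin 8 → ℝ}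
    (h : IsMongeTriangular
      ((((spSection (spCellCoord k))⁻¹ * k).conj X : Mat6) - symbolMatrix c)) :
    fderiv ℝ cellChart (matEntries k) (matEntries ((k : Mat6) * X)) =
      flatFrame (spCellCoord k) c := by
  set a := spCellCoord k with ha
  set p : Sp3 := (spSection a)⁻¹ * k with hp
  have hp' : p ∈ flagStabilizer := spSection_inv_mul_mem hk
  have h1 : (k : Mat6) = cellSection a * (p : Mat6) := by
    have h2 : k = spSection a * p := by rw [hp, mul_inv_cancel_left]
    exact congrArg Subtype.val h2
  have h2 : (k : Mat6) * X = cellSection a * (p.conj X : Mat6) * (p : Mat6) := by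
    rw [h1, Sp3.coe_conj, mul_assoc, mul_assoc, mul_assoc _ _ (p : Mat6), p.coe_inv_mul, mul_one]
  have h3 : cellSection a * (p.conj X : Mat6) = cellSection a * symbolMatrix c +
      cellSection a * ((p.conj X : Mat6) - symbolMatrix c) := by
    rw [← mul_add, add_sub_cancel]
  rw [h2, h1, fderiv_cellChart_mul_right (cellSection_mem_bigCell a) (mem_flagStabilizer.mp hp')
    p.coe_det_ne_zero, h3]
  change fderiv ℝ cellChart _ (matEntries _ + matEntries _) = _
  rw [map_add, fderiv_cellChart_cellSection,
    fderiv_cellChart_triangular (cellSection_mem_bigCell a) h, add_zero]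

/-! ### The differential on the left translates of the component of degree `-1` -/

theorem mul_apply_eq_zero_of_weight {r s : ℤ} {A B : Mat6}
    (hA : ∀ i j, mongeWeight i - mongeWeight j < r → A i j = 0)
    (hB : ∀ i j, mongeWeight i - mongeWeight j < s → B i j = 0) (i j : Fin 3 ⊕ Fin 3)
    (hij : mongeWeight i - mongeWeight j < r + s) : (A * B) i j = 0 := by
  rw [Matrix.mul_apply]
  refine Finset.sum_eq_zero fun l _ => ?_
  by_cases h : mongeWeight i - mongeWeight l < r
  · rw [hA i l h, zero_mul]
  · rw [hB l j (by omega), mul_zero]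

theorem isMongeTriangular_conj_sub {p : Sp3} (hp : p ∈ flagStabilizer) {X : LieSp3}
    (hX : X ∈ mongeGrading (-1)) :
    IsMongeTriangular ((p.conj X : Mat6) - mongeProj (-1) (p.conj X)) := by
  have htri : ∀ q ∈ flagStabilizer, ∀ i j, mongeWeight i - mongeWeight j < 0 →
      (q : Mat6) i j = 0 := fun q hq i j hij =>
    isMongeTriangular_iff.mp (mem_flagStabilizer.mp hq) i j (by omega)
  have h1 : ∀ i j, mongeWeight i - mongeWeight j < -2 → (p.conj X : Mat6) i j = 0 :=
    mul_apply_eq_zero_of_weight (r := 0 + -2) (s := 0)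
      (mul_apply_eq_zero_of_weight (r := 0) (s := -2) (htri p hp)
        (fun i j hij => hX i j (by omega))) (htri _ (inv_mem hp))
  rw [isMongeTriangular_iff]
  intro i j hij
  rw [Matrix.sub_apply, mongeProj_apply]
  split_ifs with h
  · exact sub_self _
  · obtain ⟨l, -, hl⟩ := mongeWeight_sub_mem i j
    rw [h1 i j (by omega), sub_zero]

theorem Sp3.coe_conj_sub (g : Sp3) (X Y : LieSp3) :
    (g.conj (X - Y) : Mat6) = (g.conj X : Mat6) - g.conj Y := by
  rw [Sp3.coe_conj, Sp3.coe_conj, Sp3.coe_conj, AddSubgroupClass.coe_sub, mul_sub, sub_mul]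

theorem symbolElt_mem_iff_mem_symbolFiltration {c : Fin 8 → ℝ} :
    (symbolElt c : LieSp3) ∈ mongeGrading (-1) ↔ c ∈ symbolFiltration 1 := by
  have h := symbolElt_mem_iff le_rfl c
  rw [mem_mongeSymbolGrading (by decide)] at h
  refine h.trans (forall_congr' fun i => ?_)
  have hi : symbolDegree i ≠ 1 ↔ 1 < symbolDegree i := by
    revert i
    decide
  rw [hi]

theorem exists_mem_symbolFiltration {X : LieSp3} (hX : X ∈ mongeGrading (-1)) :
    ∃ c ∈ symbolFiltration 1, (symbolElt c : LieSp3) = X := by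
  obtain ⟨c, hc⟩ := symbolEquiv.surjective ⟨X, mongeGrading_le_mongeSymbol (by norm_num) hX⟩
  have h : (symbolElt c : LieSp3) = X := congrArg Subtype.val hc
  refine ⟨c, ?_, h⟩
  rw [← symbolElt_mem_iff_mem_symbolFiltration, h]
  exact hX

theorem fderiv_cellChart_mem_flatMonge {k : Sp3} (hk : (k : Mat6) ∈ bigCell) {X : LieSp3}
    (hX : X ∈ mongeGrading (-1)) :
    fderiv ℝ cellChart (matEntries k) (matEntries ((k : Mat6) * X)) ∈
      flatMonge (spCellCoord k) := by
  have hp := spSection_inv_mul_mem hk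
  obtain ⟨c, hc, hcX⟩ := exists_mem_symbolFiltration
    (mongeProj_mem (-1) (((spSection (spCellCoord k))⁻¹ * k).conj X))
  have h := isMongeTriangular_conj_sub hp hX
  rw [← hcX] at h
  rw [fderiv_cellChart_mul hk h, mem_flatMonge, flatCoframe_flatFrame]
  exact hc

theorem exists_fderiv_cellChart_eq {k : Sp3} (hk : (k : Mat6) ∈ bigCell)
    {w : EuclideanSpace ℝ (Fin 8)} (hw : w ∈ flatMonge (spCellCoord k)) :
    ∃ X ∈ mongeGrading (-1),
      fderiv ℝ cellChart (matEntries k) (matEntries ((k : Mat6) * X)) = w := by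
  have hp := spSection_inv_mul_mem hk
  set p : Sp3 := (spSection (spCellCoord k))⁻¹ * k with hpk
  have hc := symbolElt_mem_iff_mem_symbolFiltration.mpr (mem_flatMonge.mp hw)
  set Z : LieSp3 := (symbolElt (flatCoframe (spCellCoord k) w)).1 with hZ
  set Y := p⁻¹.conj Z with hY
  refine ⟨mongeProj (-1) Y, mongeProj_mem _ _, ?_⟩
  have h1 : IsMongeTriangular (p.conj (Y - mongeProj (-1) Y) : Mat6) :=
    isMongeTriangular_conj hp (isMongeTriangular_conj_sub (inv_mem hp) hc)
  have h2 : p.conj Y = Z := by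
    have := p⁻¹.conj_inv_conj Z
    rwa [inv_inv] at this
  have h3 : IsMongeTriangular ((p.conj (mongeProj (-1) Y) : Mat6) -
      symbolMatrix (flatCoframe (spCellCoord k) w)) := by
    have h4 : (p.conj (Y - mongeProj (-1) Y) : Mat6) = (Z : Mat6) - p.conj (mongeProj (-1) Y) := by
      rw [Sp3.coe_conj_sub, h2]
    rw [h4] at h1
    have h5 := Matrix.BlockTriangular.neg h1
    rwa [neg_sub] at h5
  rw [fderiv_cellChart_mul hk h3]
  exact (flatCoframeEquiv _).left_inv w

/-! ### Left translates of elements of the Lie algebra -/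

theorem Sp3.mdifferentiableAt_entries (g : Sp3) :
    MDifferentiableAt (𝓡 21) 𝓘(ℝ, Fin 3 ⊕ Fin 3 → Fin 3 ⊕ Fin 3 → ℝ) Sp3.entries g :=
  Sp3.isEmbeddedAtlas.contMDiff.mdifferentiableAt (by simp)

theorem Sp3.mfderiv_entries_mul_left (g h : Sp3) (ξ : TangentSpace (𝓡 21) h) :
    mfderiv (𝓡 21) 𝓘(ℝ, Fin 3 ⊕ Fin 3 → Fin 3 ⊕ Fin 3 → ℝ) Sp3.entries (g * h)
      (mfderiv (𝓡 21) (𝓡 21) (fun k : Sp3 => g * k) h ξ) =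
    entriesMul g 1
      (mfderiv (𝓡 21) 𝓘(ℝ, Fin 3 ⊕ Fin 3 → Fin 3 ⊕ Fin 3 → ℝ) Sp3.entries h ξ) := by
  have h1 : Sp3.entries ∘ (fun k : Sp3 => g * k) = entriesMul g 1 ∘ Sp3.entries := by
    funext k
    change matEntries ((g : Mat6) * (k : Mat6)) = matEntries ((g : Mat6) * (k : Mat6) * 1)
    rw [mul_one]
  have h2 := mfderiv_comp_apply (I := 𝓡 21) (I' := 𝓡 21)
    (I'' := 𝓘(ℝ, Fin 3 ⊕ Fin 3 → Fin 3 ⊕ Fin 3 → ℝ)) h (Sp3.mdifferentiableAt_entries (g * h))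
    ((contMDiff_mul_left' g).mdifferentiableAt (by simp) (x := h)) ξ
  have h3 := ((entriesMul g 1).hasMFDerivAt.comp h
    (Sp3.mdifferentiableAt_entries h).hasMFDerivAt).mfderiv
  refine h2.symm.trans ?_
  rw [h1]
  exact congrArg (fun l => l ξ) h3

theorem Sp3.exists_mfderiv_entries_eq (g : Sp3) {X : LieSp3} (hX : X ∈ mongeSymbol) :
    ∃ ξ : TangentSpace (𝓡 21) g,
      mfderiv (𝓡 21) 𝓘(ℝ, Fin 3 ⊕ Fin 3 → Fin 3 ⊕ Fin 3 → ℝ) Sp3.entries g ξ =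
        matEntries ((g : Mat6) * X) := by
  obtain ⟨c, hc⟩ := symbolEquiv.surjective ⟨X, hX⟩
  have hcX : symbolMatrix c = (X : Mat6) := congrArg (fun Y : mongeSymbol => (Y : Mat6)) hc
  have h1 : cellSection (0 : EuclideanSpace ℝ (Fin 8)) = 1 := by
    rw [cellSection, ← Matrix.fromBlocks_one]
    congr 1
    · simp [cellL, Matrix.one_fin_three]
    · ext i j
      fin_cases i <;> fin_cases j <;> simp [cellK, cellL]
    · ext i j
      fin_cases i <;> fin_cases j <;> simp [cellLInv]
  have h0 : g * spSection 0 = g := Subtype.ext (by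
    rw [Submonoid.coe_mul, show (spSection 0 : Mat6) = 1 from h1, mul_one])
  have hf : flatFrame 0 c = c := by
    ext i
    fin_cases i <;> simp [flatFrame]
  have hs : ContMDiff (𝓡 8) (𝓡 21) ∞ (fun a => g * spSection a) :=
    (contMDiff_mul_left' g).comp contMDiff_spSection
  have hs' := (hs.mdifferentiableAt (by simp) (x := 0))
  have hc' := mfderiv_comp_apply (I := 𝓡 8) (I' := 𝓡 21)
    (I'' := 𝓘(ℝ, Fin 3 ⊕ Fin 3 → Fin 3 ⊕ Fin 3 → ℝ)) (0 : EuclideanSpace ℝ (Fin 8))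
    (Sp3.mdifferentiableAt_entries (g * spSection 0)) hs' c
  have hd : DifferentiableAt ℝ (fun a => Sp3.entries (g * spSection a)) 0 :=
    ((Sp3.mdifferentiableAt_entries _).comp 0 hs').differentiableAt
  have hl := hd.hasFDerivAt.hasLineDerivAt c
  have hq := hasDerivAt_matEntries_quadratic (g : Mat6) ((g : Mat6) * symbolMatrix c)
    ((g : Mat6) * cellSectionQuad c)
  have hfun : (fun t : ℝ => Sp3.entries (g * spSection (0 + t • c))) = fun t : ℝ =>
      matEntries ((g : Mat6) + t • ((g : Mat6) * symbolMatrix c) +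
        t ^ 2 • ((g : Mat6) * cellSectionQuad c)) := by
    funext t
    change matEntries ((g : Mat6) * cellSection (0 + t • c : EuclideanSpace ℝ (Fin 8))) = _
    have h := cellSection_add_smul 0 c t
    rw [hf, h1, one_mul] at h
    rw [h, mul_add, mul_add, mul_one, mul_smul_comm, mul_smul_comm]
  have key : ∃ ξ : TangentSpace (𝓡 21) (g * spSection 0),
      mfderiv (𝓡 21) 𝓘(ℝ, Fin 3 ⊕ Fin 3 → Fin 3 ⊕ Fin 3 → ℝ) Sp3.entries (g * spSection 0) ξ =
        matEntries ((g : Mat6) * X) := by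
    refine ⟨_, hc'.symm.trans ?_⟩
    rw [← hcX, mfderiv_eq_fderiv]
    rw [HasLineDerivAt, hfun] at hl
    exact hl.unique hq
  rwa [h0] at key

/-! ### The invariant distribution -/

theorem mfderiv_flagChart_mk {g h : Sp3} (hh : h ∈ cellPreimage g) {ξ : TangentSpace (𝓡 21) h}
    {X : LieSp3}
    (hξ : mfderiv (𝓡 21) 𝓘(ℝ, Fin 3 ⊕ Fin 3 → Fin 3 ⊕ Fin 3 → ℝ) Sp3.entries h ξ =
      matEntries ((h : Mat6) * X)) :
    mfderiv (𝓡 8) (𝓡 8) (flagChart g) (h : Sp3 ⧸ flagStabilizer)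
      (mfderiv (𝓡 21) (𝓡 8) (QuotientGroup.mk : Sp3 → Sp3 ⧸ flagStabilizer) h ξ) =
    fderiv ℝ cellChart (matEntries ((g⁻¹ * h : Sp3) : Mat6))
      (matEntries (((g⁻¹ * h : Sp3) : Mat6) * X)) := by
  have h1 : flagChart g ∘ (QuotientGroup.mk : Sp3 → Sp3 ⧸ flagStabilizer) =
      cellChart ∘ (entriesMul (g⁻¹ : Sp3) 1 ∘ Sp3.entries) := by
    funext k
    refine (flagChart_mk g k).trans ?_
    change _ = cellChart (matEntries (((g⁻¹ : Sp3) : Mat6) * (k : Mat6) * 1))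
    rw [mul_one]
    rfl
  have h2 := mfderiv_comp_apply (I := 𝓡 21) (I' := 𝓡 8) (I'' := 𝓡 8) h
    ((mdifferentiable_of_mem_maximalAtlas (flagChart_mem_maximalAtlas g)).mdifferentiableAt
      (mk_mem_flagChart_source.mpr hh)) (contMDiff_flagMk.mdifferentiableAt (by simp) (x := h)) ξ
  have hpt : (entriesMul (g⁻¹ : Sp3) 1 ∘ Sp3.entries) h = matEntries ((g⁻¹ * h : Sp3) : Mat6) := by
    change matEntries (((g⁻¹ : Sp3) : Mat6) * (h : Mat6) * 1) = _
    rw [mul_one]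
    rfl
  have hF : HasMFDerivAt 𝓘(ℝ, Fin 3 ⊕ Fin 3 → Fin 3 ⊕ Fin 3 → ℝ) (𝓡 8) cellChart
      ((entriesMul (g⁻¹ : Sp3) 1 ∘ Sp3.entries) h)
      (fderiv ℝ cellChart (matEntries ((g⁻¹ * h : Sp3) : Mat6))) := by
    rw [hpt]
    exact (differentiableAt_cellChart hh).hasFDerivAt.hasMFDerivAt
  have h3 := (hF.comp h ((entriesMul (g⁻¹ : Sp3) 1).hasMFDerivAt.comp h
    (Sp3.mdifferentiableAt_entries h).hasMFDerivAt)).mfderiv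
  refine h2.symm.trans ?_
  rw [h1]
  refine (congrArg (fun l => l ξ) h3).trans ?_
  change fderiv ℝ cellChart _ (entriesMul (g⁻¹ : Sp3) 1
    (mfderiv (𝓡 21) 𝓘(ℝ, Fin 3 ⊕ Fin 3 → Fin 3 ⊕ Fin 3 → ℝ) Sp3.entries h ξ)) = _
  rw [hξ, entriesMul_matEntries, mul_one, ← mul_assoc]
  rfl

/-- The distribution on the flag manifold given by the component of degree `-1`. -/
noncomputable def flagDistribution : TangentDistribution (𝓡 8) (Sp3 ⧸ flagStabilizer) := fun x =>
  (flatMonge (flagChart x.out x)).comap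
    (mfderiv (𝓡 8) (𝓡 8) (flagChart x.out) x).toLinearMap

theorem injective_mfderiv_flagChart {g : Sp3} {x : Sp3 ⧸ flagStabilizer}
    (hx : x ∈ (flagChart g).source) :
    Injective (mfderiv (𝓡 8) (𝓡 8) (flagChart g) x) :=
  (isInvertible_mfderiv_chart
    (mdifferentiable_of_mem_maximalAtlas (flagChart_mem_maximalAtlas g)) hx).injective

theorem mem_cellPreimage_out (h : Sp3) :
    h ∈ cellPreimage (h : Sp3 ⧸ flagStabilizer).out := by
  rw [← mk_mem_flagChart_source]
  exact mem_chart_source (EuclideanSpace ℝ (Fin 8)) (h : Sp3 ⧸ flagStabilizer)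

theorem exists_mfderiv_flagMk_eq {g h : Sp3} (hh : h ∈ cellPreimage g)
    {v : TangentSpace (𝓡 8) (h : Sp3 ⧸ flagStabilizer)} {w : EuclideanSpace ℝ (Fin 8)}
    (hvw : mfderiv (𝓡 8) (𝓡 8) (flagChart g) (h : Sp3 ⧸ flagStabilizer) v = w)
    (hw : w ∈ flatMonge (flagChart g (h : Sp3 ⧸ flagStabilizer))) :
    ∃ (ξ : TangentSpace (𝓡 21) h) (X : LieSp3), X ∈ mongeGrading (-1) ∧
      mfderiv (𝓡 21) 𝓘(ℝ, Fin 3 ⊕ Fin 3 → Fin 3 ⊕ Fin 3 → ℝ) Sp3.entries h ξ =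
        matEntries ((h : Mat6) * X) ∧
      mfderiv (𝓡 21) (𝓡 8) (QuotientGroup.mk : Sp3 → Sp3 ⧸ flagStabilizer) h ξ = v := by
  rw [flagChart_mk] at hw
  obtain ⟨X, hX, hXw⟩ := exists_fderiv_cellChart_eq hh hw
  obtain ⟨ξ, hξ⟩ := h.exists_mfderiv_entries_eq (mongeGrading_le_mongeSymbol (by norm_num) hX)
  refine ⟨ξ, X, hX, hξ, injective_mfderiv_flagChart (mk_mem_flagChart_source.mpr hh) ?_⟩
  exact ((mfderiv_flagChart_mk hh hξ).trans hXw).trans hvw.symm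

theorem mfderiv_flagChart_mk_mem_flatMonge {g h : Sp3} (hh : h ∈ cellPreimage g)
    {ξ : TangentSpace (𝓡 21) h} {X : LieSp3} (hX : X ∈ mongeGrading (-1))
    (hξ : mfderiv (𝓡 21) 𝓘(ℝ, Fin 3 ⊕ Fin 3 → Fin 3 ⊕ Fin 3 → ℝ) Sp3.entries h ξ =
      matEntries ((h : Mat6) * X)) :
    mfderiv (𝓡 8) (𝓡 8) (flagChart g) (h : Sp3 ⧸ flagStabilizer)
      (mfderiv (𝓡 21) (𝓡 8) (QuotientGroup.mk : Sp3 → Sp3 ⧸ flagStabilizer) h ξ) ∈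
      flatMonge (flagChart g (h : Sp3 ⧸ flagStabilizer)) := by
  rw [mfderiv_flagChart_mk hh hξ, flagChart_mk]
  exact fderiv_cellChart_mem_flatMonge hh hX

theorem mem_flagDistribution_mk {h : Sp3} {v : TangentSpace (𝓡 8) (h : Sp3 ⧸ flagStabilizer)} :
    v ∈ flagDistribution (h : Sp3 ⧸ flagStabilizer) ↔
      ∃ (ξ : TangentSpace (𝓡 21) h) (X : LieSp3), X ∈ mongeGrading (-1) ∧
        mfderiv (𝓡 21) 𝓘(ℝ, Fin 3 ⊕ Fin 3 → Fin 3 ⊕ Fin 3 → ℝ) Sp3.entries h ξ =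
          matEntries ((h : Mat6) * X) ∧
        mfderiv (𝓡 21) (𝓡 8) (QuotientGroup.mk : Sp3 → Sp3 ⧸ flagStabilizer) h ξ = v := by
  constructor
  · exact fun hv => exists_mfderiv_flagMk_eq (mem_cellPreimage_out h) rfl hv
  · rintro ⟨ξ, X, hX, hξ, rfl⟩
    exact mfderiv_flagChart_mk_mem_flatMonge (mem_cellPreimage_out h) hX hξ

theorem map_mfderiv_flagChart {g : Sp3} {x : Sp3 ⧸ flagStabilizer}
    (hx : x ∈ (flagChart g).source) :
    (flagDistribution x).map (mfderiv (𝓡 8) (𝓡 8) (flagChart g) x).toLinearMap =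
      flatMonge (flagChart g x) := by
  obtain ⟨h, rfl⟩ := QuotientGroup.mk_surjective x
  have hh := mk_mem_flagChart_source.mp hx
  refine le_antisymm ?_ fun w hw => ?_
  · rintro _ ⟨v, hv, rfl⟩
    obtain ⟨ξ, X, hX, hξ, rfl⟩ := mem_flagDistribution_mk.mp hv
    exact mfderiv_flagChart_mk_mem_flatMonge hh hX hξ
  · obtain ⟨v, rfl⟩ := (isInvertible_mfderiv_chart
      (mdifferentiable_of_mem_maximalAtlas (flagChart_mem_maximalAtlas g)) hx).surjective w
    exact ⟨v, mem_flagDistribution_mk.mpr (exists_mfderiv_flagMk_eq hh rfl hw), rfl⟩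

theorem flagDistribution_isFlatMonge : flagDistribution.IsFlatMonge := fun x =>
  ⟨flagChart x.out, flagChart_mem_maximalAtlas _, mem_chart_source (EuclideanSpace ℝ (Fin 8)) x,
    fun _ hy => map_mfderiv_flagChart hy⟩

theorem mfderiv_flag_smul_mk (g h : Sp3) (ξ : TangentSpace (𝓡 21) h) :
    mfderiv (𝓡 8) (𝓡 8) (fun y : Sp3 ⧸ flagStabilizer => g • y) (h : Sp3 ⧸ flagStabilizer)
      (mfderiv (𝓡 21) (𝓡 8) (QuotientGroup.mk : Sp3 → Sp3 ⧸ flagStabilizer) h ξ) =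
    mfderiv (𝓡 21) (𝓡 8) (QuotientGroup.mk : Sp3 → Sp3 ⧸ flagStabilizer) (g * h)
      (mfderiv (𝓡 21) (𝓡 21) (fun k : Sp3 => g * k) h ξ) := by
  have hs : ContMDiff (𝓡 8) (𝓡 8) ∞ (fun y : Sp3 ⧸ flagStabilizer => g • y) :=
    contMDiff_flag_smul.comp (contMDiff_const.prodMk contMDiff_id)
  have h1 := mfderiv_comp_apply (I := 𝓡 21) (I' := 𝓡 8) (I'' := 𝓡 8) h
    (hs.mdifferentiableAt (by simp) (x := (h : Sp3 ⧸ flagStabilizer)))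
    (contMDiff_flagMk.mdifferentiableAt (by simp) (x := h)) ξ
  have h2 := mfderiv_comp_apply (I := 𝓡 21) (I' := 𝓡 21) (I'' := 𝓡 8) h
    (contMDiff_flagMk.mdifferentiableAt (by simp) (x := g * h))
    ((contMDiff_mul_left' g).mdifferentiableAt (by simp) (x := h)) ξ
  exact h1.symm.trans h2

theorem flagDistribution_isInvariant : flagDistribution.IsInvariant := by
  intro g x
  obtain ⟨h, rfl⟩ := QuotientGroup.mk_surjective x
  have htr : ∀ (ξ : TangentSpace (𝓡 21) h) (X : LieSp3),
      mfderiv (𝓡 21) 𝓘(ℝ, Fin 3 ⊕ Fin 3 → Fin 3 ⊕ Fin 3 → ℝ) Sp3.entries h ξ =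
        matEntries ((h : Mat6) * X) →
      mfderiv (𝓡 21) 𝓘(ℝ, Fin 3 ⊕ Fin 3 → Fin 3 ⊕ Fin 3 → ℝ) Sp3.entries (g * h)
        (mfderiv (𝓡 21) (𝓡 21) (fun k : Sp3 => g * k) h ξ) =
        matEntries (((g * h : Sp3) : Mat6) * X) := by
    intro ξ X hξ
    rw [Sp3.mfderiv_entries_mul_left, hξ, entriesMul_matEntries, mul_one, ← mul_assoc]
    rfl
  refine le_antisymm ?_ fun w hw => ?_
  · rintro _ ⟨v, hv, rfl⟩
    obtain ⟨ξ, X, hX, hξ, rfl⟩ := mem_flagDistribution_mk.mp hv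
    refine mem_flagDistribution_mk (h := g * h).mpr ⟨_, X, hX, htr ξ X hξ, ?_⟩
    exact (mfderiv_flag_smul_mk g h ξ).symm
  · obtain ⟨ξ', X, hX, hξ', hw'⟩ := mem_flagDistribution_mk (h := g * h).mp hw
    obtain ⟨ξ, hξ⟩ := h.exists_mfderiv_entries_eq (mongeGrading_le_mongeSymbol (by norm_num) hX)
    have h1 : mfderiv (𝓡 21) (𝓡 21) (fun k : Sp3 => g * k) h ξ = ξ' :=
      Sp3.isEmbeddedAtlas.injective_mfderiv (g * h) ((htr ξ X hξ).trans hξ'.symm)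
    refine ⟨_, mem_flagDistribution_mk.mpr ⟨ξ, X, hX, hξ, rfl⟩, ?_⟩
    refine (mfderiv_flag_smul_mk g h ξ).trans ?_
    rw [h1]
    exact hw'

theorem mainTheorem10 :
    ∃ (_ : ChartedSpace (EuclideanSpace ℝ (Fin 21)) Sp3)
      (_ : ChartedSpace (EuclideanSpace ℝ (Fin 13)) flagStabilizer)
      (_ : ChartedSpace (EuclideanSpace ℝ (Fin 8)) (Sp3 ⧸ flagStabilizer))
      (_ : IsManifold (𝓡 8) ∞ (Sp3 ⧸ flagStabilizer)),
      -- the smooth structure of the group is that of a submanifold of the space of matrices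
      ContMDiff (𝓡 21) 𝓘(ℝ, Fin 3 ⊕ Fin 3 → Fin 3 ⊕ Fin 3 → ℝ) ∞ Sp3.entries ∧
      (∀ g : Sp3, Function.Injective
        (mfderiv (𝓡 21) 𝓘(ℝ, Fin 3 ⊕ Fin 3 → Fin 3 ⊕ Fin 3 → ℝ) Sp3.entries g)) ∧
      -- the fibration over the homogeneous space, with parabolic structure group
      IsHomogeneousFibration flagStabilizer (EuclideanSpace ℝ (Fin 21))
        (EuclideanSpace ℝ (Fin 13)) (EuclideanSpace ℝ (Fin 8)) ∧
      IsParabolicSubgroup flagStabilizer ∧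
      -- the invariant Monge distribution
      ∃ D : TangentDistribution (𝓡 8) (Sp3 ⧸ flagStabilizer),
        D.IsSmoothOfRank 3 ∧ D.IsInvariant ∧ D.IsMonge ∧
        (∀ x, D.HasSymbolAt x mongeSymbolGrading) ∧
        IsTanakaProlongation mongeSymbolGrading mongeGrading mongeSymbol.incl ∧
        -- it is the projection of the left translates of the component of degree `-1`
        (∀ (g : Sp3) (v : TangentSpace (𝓡 8) (g : Sp3 ⧸ flagStabilizer)),
          v ∈ D (g : Sp3 ⧸ flagStabilizer) ↔
            ∃ (ξ : TangentSpace (𝓡 21) g) (X : LieSp3), X ∈ mongeGrading (-1) ∧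
              mfderiv (𝓡 21) 𝓘(ℝ, Fin 3 ⊕ Fin 3 → Fin 3 ⊕ Fin 3 → ℝ) Sp3.entries g ξ =
                (fun i j => ((g : Matrix (Fin 3 ⊕ Fin 3) (Fin 3 ⊕ Fin 3) ℝ) *
                  (X : Matrix (Fin 3 ⊕ Fin 3) (Fin 3 ⊕ Fin 3) ℝ)) i j) ∧
              mfderiv (𝓡 21) (𝓡 8) (QuotientGroup.mk : Sp3 → Sp3 ⧸ flagStabilizer) g ξ = v) ∧
        -- it is the flat Monge geometry
        D.IsFlatMonge := by
  refine ⟨inferInstance, inferInstance, inferInstance, inferInstance,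
    Sp3.isEmbeddedAtlas.contMDiff, Sp3.isEmbeddedAtlas.injective_mfderiv,
    isHomogeneousFibration_flagStabilizer, isParabolicSubgroup_flagStabilizer, flagDistribution,
    flagDistribution_isFlatMonge.isSmoothOfRank, flagDistribution_isInvariant,
    flagDistribution_isFlatMonge.isMonge, flagDistribution_isFlatMonge.hasSymbolAt,
    isTanakaProlongation_mongeGrading, fun _ _ => mem_flagDistribution_mk,
    flagDistribution_isFlatMonge⟩
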